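/- Let $X^n_t$ be the continuous-time random adjacent-transposition walk on the permutations of $\{1,\dots,n\}$: $X^n_0$ is the identity, $X^n_t(j)$ is the position of particle $j$, and at rate $1$ an index $1\le i\le n-1$ is chosen uniformly at random and the particles at positions $i$ and $i+1$ are exchanged. Let $D^n_t$ be the minimal number of adjacent transpositions needed to build $X^n_t$ from the identity; it equals the number of inversions $\#\{i<j : X^n_t(i)>X^n_t(j)\}$. For an integer $x\ge 0$ let $T^x$ be the hitting time of the level $x$ by the continuous-time simple random walk on $\mathbb{Z}$ started at $0$ with total jump rate $4$ (so $T^0=0$). Let two particles $Y,Y'$ with $Y(0)=0$ and $Y'(0)=1$ be moved by random stirring on $\mathbb{Z}$ (for every $k\in\mathbb{Z}$, independently and at rate $1$, the contents of the sites $k$ and $k+1$ are exchanged), and let $p(u)=P[Y(u)>Y'(u)]$. For $t>0$ put $$ f(t)=\sum_{x=0}^{\infty}\int_{[0,t]} P[T^x\in ds]\,p(t-s), $$ where the integrals exist and the series converges. Then for every $t>0$, $n^{-1}D^n_{nt}\to f(t)$ in probability as $n\to\infty$. The function $f$ is infinitely differentiable on $(0,\infty)$, and $$ \lim_{t\to\infty}\frac{f(t)}{\sqrt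 t}=\frac12\,E\Bigl(\max_{0\le s\le 1}B_{4s}\Bigr)=\sqrt{\frac2\pi}, $$ where $B$ is a standard Brownian motion (and the maximum is integrable). -/

import Mathlib

open MeasureTheory ProbabilityTheory Filter Topology
open scoped NNReal ENNReal

namespace Stirring

noncomputable section

/-! ### Continuous-time Markov chains with a bounded generator -/

/-- The transition function `P_t(x, y) = (e^{tL} 1_{y})(x)` of the continuous-time Markov chain on
a countable set `S` with (bounded) generator `L`, as an exponential series. -/
def transition {S : Type*} (L : (S → ℝ) → S → ℝ) (t : ℝ) (x y : S) : ℝ :=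
  ∑' k : ℕ, t ^ k / (k.factorial : ℝ) * (L^[k] (Set.indicator {y} 1)) x

/-- `X` is, under the probability measure `μ`, a continuous-time Markov chain on `S` with generator
`L`, started at `a`: its finite-dimensional distributions are those given by the transition
function of `L`, and almost all its paths are right-continuous step functions with left limits
(for the discrete topology on `S`). -/
structure IsMarkovChain {S Ω : Type*} [MeasurableSpace Ω] (L : (S → ℝ) → S → ℝ) (a : S)
    (X : ℝ≥0 → Ω → S) (μ : Measure Ω) : Prop where
  isProbabilityMeasure : IsProbabilityMeasure μ
  measurableSet_eq : ∀ (t : ℝ≥0) (x : S), MeasurableSet {ω | X t ω = x}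
  finiteDimensional : ∀ (m : ℕ) (t : ℕ → ℝ≥0) (x : ℕ → S), t 0 = 0 → Monotone t → x 0 = a →
    μ.real {ω | ∀ i ≤ m, X (t i) ω = x i} =
      ∏ i ∈ Finset.range m, transition L ((t (i + 1) : ℝ) - (t i : ℝ)) (x i) (x (i + 1))
  right_continuous : ∀ᵐ ω ∂μ, ∀ t : ℝ≥0, ∀ᶠ s in 𝓝[>] t, X s ω = X t ω
  left_limits : ∀ᵐ ω ∂μ, ∀ t : ℝ≥0, ∃ y : S, ∀ᶠ s in 𝓝[<] t, X s ω = y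

/-! ### Random adjacent transpositions -/

/-- The pairs `(i, i + 1)` of neighbouring positions among `n` positions. -/
def adjacentPairs (n : ℕ) : Finset (Fin n × Fin n) :=
  {e | (e.1 : ℕ) + 1 = (e.2 : ℕ)}

/-- The generator of the random adjacent-transposition walk: at rate 1 one of the `n - 1` pairs of
neighbouring positions is chosen uniformly and the two particles there are exchanged. A
permutation `σ` records the position `σ j` of each particle `j`, so the exchange of the particles
at `i` and `i + 1` multiplies `σ` on the left by the transposition of `i` and `i + 1`. -/
def adjacentGenerator (n : ℕ) (g : Equiv.Perm (Fin n) → ℝ) (σ : Equiv.Perm (Fin n)) : ℝ :=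
  1 / ((n : ℝ) - 1) * ∑ e ∈ adjacentPairs n, (g (Equiv.swap e.1 e.2 * σ) - g σ)

/-- The graph on the permutations of `n` elements in which two permutations are joined when they
differ by one adjacent transposition. -/
def adjacentGraph (n : ℕ) : SimpleGraph (Equiv.Perm (Fin n)) :=
  SimpleGraph.fromRel fun σ τ => ∃ e ∈ adjacentPairs n, τ = Equiv.swap e.1 e.2 * σ

/-- The minimal number of adjacent transpositions needed to build `σ` from the identity. -/
def adjacentDist {n : ℕ} (σ : Equiv.Perm (Fin n)) : ℕ :=
  (adjacentGraph n).dist 1 σ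

/-- The number of inversions of `σ`. -/
def inversions {n : ℕ} (σ : Equiv.Perm (Fin n)) : ℕ :=
  Finset.card {e : Fin n × Fin n | e.1 < e.2 ∧ σ e.2 < σ e.1}

/-! ### Random walk and random stirring on the integers -/

/-- The generator of simple random walk on `ℤ` with total jump rate `r`. -/
def walkGenerator (r : ℝ) (g : ℤ → ℝ) (x : ℤ) : ℝ :=
  r / 2 * (g (x + 1) - g x) + r / 2 * (g (x - 1) - g x)

/-- The generator of the motion of two particles under random stirring on `ℤ`: for each `k`, at
rate 1, independently, the contents of the sites `k` and `k + 1` are exchanged. Only the at most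
four edges that touch one of the two particles contribute to the sum. -/
def stirringGenerator (g : ℤ × ℤ → ℝ) (y : ℤ × ℤ) : ℝ :=
  ∑' k : ℤ, (g (Equiv.swap k (k + 1) y.1, Equiv.swap k (k + 1) y.2) - g y)

/-- The first time at which the path of `W` is at `x` (`∞` if there is none). -/
def hittingTime {Ω : Type*} (W : ℝ≥0 → Ω → ℤ) (x : ℤ) (ω : Ω) : ℝ≥0∞ :=
  ⨅ (t : ℝ≥0) (_ : W t ω = x), (t : ℝ≥0∞)

/-- The probability that at time `u` the particles `Y` and `Y'`, of which `Y` starts to the left of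
`Y'`, are exchanged. -/
def exchangeProb {Ω : Type*} [MeasurableSpace Ω] (Y Y' : ℝ≥0 → Ω → ℤ) (ν : Measure Ω)
    (u : ℝ≥0) : ℝ :=
  ν.real {ω | Y u ω > Y' u ω}

/-- The law `P[T ^ x ∈ ds]` of the hitting time of `x`. -/
def hittingLaw {Ω : Type*} [MeasurableSpace Ω] (W : ℝ≥0 → Ω → ℤ) (μ : Measure Ω) (x : ℤ) :
    Measure ℝ≥0∞ :=
  μ.map (hittingTime W x)

/-- `f(t) = ∑_{x ≥ 0} ∫_{[0,t]} P[T ^ x ∈ ds] p(t - s)`. -/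
def limitFn {Ω : Type*} [MeasurableSpace Ω] (W : ℝ≥0 → Ω → ℤ) (μ : Measure Ω) (p : ℝ≥0 → ℝ)
    (t : ℝ) : ℝ :=
  ∑' x : ℕ, ∫ s in Set.Iic (ENNReal.ofReal t), p (t - s.toReal).toNNReal ∂(hittingLaw W μ x)

end

end Stirring

/-! Everything is expressed through one function: with `L = walkGenerator 4`, `meanSign t x` is
`e^{tL} sign` at `x`, the mean sign at time `t` of the rate-four walk started at `x`. Write m_t(x)
for it.

An exchange of two sites acts on an antisymmetric function of two positions as the sum of its
actions on each variable (`swap_sub_eq_add`). Hence the sign of the difference of two stirred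
particles evolves under `L`, and p(u) = (1 - m_u(1))/2 (`exchangeProb_eq`).

The limit function. Reflection gives P[T^x ≤ s] = 1 - m_s(x) (`measureReal_hittingTime_le`); it is
obtained by killing the walk at `x` on fine grids. Particles at distance x+1 can be exchanged only
after they have become neighbours, which suggests ∫ P[T^x ∈ ds] p(t-s) = (1 - m_t(x+1))/2; this is
proved analytically by a Duhamel argument (`integral_exchangeDeriv_mul`, `integral_hittingLaw`). In
the sum over x the time derivative is a telescoping second difference, so f(t) = ∫_0^t m_s(1) ds,
which is `limitProfile`. It is smooth because m is.

The law of large numbers. The distance is the number of inversions. The generator of the permutation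
walk maps it to the sum over neighbouring positions of the order signs of the labels there, with
factor 1/(n-1). Away from the ends these signs again evolve like the sign of the rate-four walk,
slowed by n-1. The Taylor coefficients in t of E D_{nt}/n therefore converge to those of
`limitProfile`, under a bound uniform in n (`tendsto_mean_inversions`). The variance of D_{nt} is
O(n): exchanging two neighbours in the initial state changes the mean by at most twice their
expected separation, which stays bounded up to time nt (`variance_inversions_le`). Chebyshev's
inequality finishes.

Large times. Fourier inversion gives √t m_t(1) → 1/√(2π), and integration gives f(t)/√t → √(2/π).
The Brownian maximum is computed independently of the walk: Spitzer's identity E max_{k≤n} S_k =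
Σ_{k≤n} E S_k^+ / k on dyadic grids, followed by monotone convergence (`brownian_maximum`). -/

namespace Stirring

/-! ### Distance in the graph of adjacent transpositions equals the number of inversions. -/

section Inversions

variable {n : ℕ}

lemma mem_adjacentPairs {e : Fin n × Fin n} :
    e ∈ adjacentPairs n ↔ (e.1 : ℕ) + 1 = (e.2 : ℕ) := by
  simp [adjacentPairs]

/-- No position lies strictly between two neighbours, so their exchange can reverse the order of no
pair but themselves. -/
lemma swap_adjacent_lt_iff {e : Fin n × Fin n} (he : e ∈ adjacentPairs n) {u v : Fin n}
    (h₁ : ¬(u = e.1 ∧ v = e.2)) (h₂ : ¬(u = e.2 ∧ v = e.1)) :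
    Equiv.swap e.1 e.2 u < Equiv.swap e.1 e.2 v ↔ u < v := by
  rw [mem_adjacentPairs] at he
  obtain ⟨a, b⟩ := e
  simp only [Equiv.swap_apply_def, Fin.ext_iff, Fin.lt_def] at *
  split_ifs <;> omega

/-- The only pair of labels whose relative order changes is the one sitting at the two exchanged
positions; it enters the set of inversions. -/
lemma inversions_swap_mul_of_lt {e : Fin n × Fin n} (he : e ∈ adjacentPairs n)
    {σ : Equiv.Perm (Fin n)} (h : σ⁻¹ e.1 < σ⁻¹ e.2) :
    inversions (Equiv.swap e.1 e.2 * σ) = inversions σ + 1 := by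
  have he' := mem_adjacentPairs.1 he
  have hlt : e.1 < e.2 := by rw [Fin.lt_def]; omega
  have key : (Finset.univ.filter fun d : Fin n × Fin n =>
      d.1 < d.2 ∧ (Equiv.swap e.1 e.2 * σ) d.2 < (Equiv.swap e.1 e.2 * σ) d.1) =
      insert (σ⁻¹ e.1, σ⁻¹ e.2)
        (Finset.univ.filter fun d : Fin n × Fin n => d.1 < d.2 ∧ σ d.2 < σ d.1) := by
    ext ⟨j, k⟩
    simp only [Finset.mem_filter, Finset.mem_univ, true_and, Finset.mem_insert, Prod.mk.injEq]
    rw [Equiv.Perm.mul_apply, Equiv.Perm.mul_apply]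
    by_cases h1 : j = σ⁻¹ e.1 ∧ k = σ⁻¹ e.2
    · obtain ⟨rfl, rfl⟩ := h1
      simp only [h, and_self, true_or, true_and, iff_true]
      simpa using hlt
    · by_cases h2 : k = σ⁻¹ e.1 ∧ j = σ⁻¹ e.2
      · obtain ⟨rfl, rfl⟩ := h2
        have : ¬ σ⁻¹ e.2 < σ⁻¹ e.1 := not_lt.2 h.le
        simp only [this, false_and, or_false, false_iff]
        exact fun h' => h1 h'
      · rw [swap_adjacent_lt_iff he]
        · simp only [h1, false_or]
        · rintro ⟨h3, h4⟩
          exact h2 ⟨by simp [← h3], by simp [← h4]⟩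
        · rintro ⟨h3, h4⟩
          exact h1 ⟨by simp [← h4], by simp [← h3]⟩
  unfold inversions
  rw [key, Finset.card_insert_of_notMem]
  simp [hlt.le]

lemma inversions_swap_mul_of_gt {e : Fin n × Fin n} (he : e ∈ adjacentPairs n)
    {σ : Equiv.Perm (Fin n)} (h : σ⁻¹ e.2 < σ⁻¹ e.1) :
    inversions (Equiv.swap e.1 e.2 * σ) + 1 = inversions σ := by
  rw [← inversions_swap_mul_of_lt he, Equiv.swap_mul_self_mul]
  simpa using h

lemma inversions_swap_mul {e : Fin n × Fin n} (he : e ∈ adjacentPairs n)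
    (σ : Equiv.Perm (Fin n)) :
    inversions (Equiv.swap e.1 e.2 * σ) = inversions σ + 1 ∨
      inversions (Equiv.swap e.1 e.2 * σ) + 1 = inversions σ := by
  rcases lt_trichotomy (σ⁻¹ e.1) (σ⁻¹ e.2) with h | h | h
  · exact .inl (inversions_swap_mul_of_lt he h)
  · have := mem_adjacentPairs.1 he
    rw [(σ⁻¹).injective h] at this
    omega
  · exact .inr (inversions_swap_mul_of_gt he h)

lemma inversions_one : inversions (1 : Equiv.Perm (Fin n)) = 0 := by
  simp only [inversions, Finset.card_eq_zero, Finset.filter_eq_empty_iff]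
  rintro ⟨j, k⟩ - ⟨h, h'⟩
  exact lt_asymm h h'

lemma eq_one_of_forall_adjacent {σ : Equiv.Perm (Fin n)}
    (h : ∀ e ∈ adjacentPairs n, σ e.1 < σ e.2) : σ = 1 := by
  cases n with
  | zero => exact Subsingleton.elim _ _
  | succ m =>
    have hm : StrictMono σ := by
      rw [Fin.strictMono_iff_lt_succ]
      exact fun i => h (i.castSucc, i.succ) (by simp [mem_adjacentPairs])
    let o : Fin (m + 1) ≃o Fin (m + 1) := hm.orderIsoOfSurjective σ σ.surjective
    have : o = OrderIso.refl _ := Subsingleton.elim _ _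
    ext i
    have := DFunLike.congr_fun this i
    simpa [o] using congrArg Fin.val this

/-- Bubble sort: if no adjacent exchange removed an inversion, `σ⁻¹` would increase along all
neighbouring pairs, and an increasing permutation of a finite chain is the identity. -/
lemma exists_inversions_swap_mul {σ : Equiv.Perm (Fin n)} (hσ : σ ≠ 1) :
    ∃ e ∈ adjacentPairs n, inversions (Equiv.swap e.1 e.2 * σ) + 1 = inversions σ := by
  by_contra! hc
  apply hσ
  have : σ⁻¹ = 1 := eq_one_of_forall_adjacent fun e he => by
    rcases lt_trichotomy (σ⁻¹ e.1) (σ⁻¹ e.2) with h | h | h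
    · exact h
    · have := mem_adjacentPairs.1 he
      rw [(σ⁻¹).injective h] at this
      omega
    · exact absurd (inversions_swap_mul_of_gt he h) (hc e he)
  simpa using this

lemma adjacentGraph_adj_iff {σ τ : Equiv.Perm (Fin n)} :
    (adjacentGraph n).Adj σ τ ↔ ∃ e ∈ adjacentPairs n, τ = Equiv.swap e.1 e.2 * σ := by
  rw [adjacentGraph, SimpleGraph.fromRel_adj]
  constructor
  · rintro ⟨-, h | ⟨e, he, rfl⟩⟩
    · exact h
    · exact ⟨e, he, by simp⟩
  · rintro ⟨e, he, rfl⟩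
    refine ⟨fun h => ?_, .inl ⟨e, he, rfl⟩⟩
    have := inversions_swap_mul he σ
    rw [← h] at this
    omega

lemma exists_walk_length_eq_inversions (m : ℕ) (σ : Equiv.Perm (Fin n)) (h : inversions σ = m) :
    ∃ w : (adjacentGraph n).Walk 1 σ, w.length = m := by
  induction m generalizing σ with
  | zero =>
    have : σ = 1 := by
      by_contra hσ
      obtain ⟨e, _, he⟩ := exists_inversions_swap_mul hσ
      omega
    subst this
    exact ⟨.nil, rfl⟩
  | succ m ih =>
    have hσ : σ ≠ 1 := by
      rintro rfl
      rw [inversions_one] at h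
      omega
    obtain ⟨e, he, h'⟩ := exists_inversions_swap_mul hσ
    obtain ⟨w, hw⟩ := ih (Equiv.swap e.1 e.2 * σ) (by omega)
    have hadj : (adjacentGraph n).Adj (Equiv.swap e.1 e.2 * σ) σ :=
      adjacentGraph_adj_iff.2 ⟨e, he, by simp⟩
    exact ⟨w.concat hadj, by simp [hw]⟩

lemma inversions_le_add_length {σ τ : Equiv.Perm (Fin n)} (w : (adjacentGraph n).Walk σ τ) :
    inversions τ ≤ inversions σ + w.length := by
  induction w with
  | nil => simp
  | cons h w ih =>
    obtain ⟨e, he, rfl⟩ := adjacentGraph_adj_iff.1 h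
    have := inversions_swap_mul he
    rw [SimpleGraph.Walk.length_cons]
    grind

theorem adjacentDist_eq_inversions (σ : Equiv.Perm (Fin n)) : adjacentDist σ = inversions σ := by
  obtain ⟨w, hw⟩ := exists_walk_length_eq_inversions _ σ rfl
  apply le_antisymm
  · exact hw ▸ SimpleGraph.dist_le w
  · obtain ⟨w', hw'⟩ := w.reachable.exists_walk_length_eq_dist
    have := inversions_le_add_length w'
    rw [inversions_one, hw', zero_add] at this
    exact this

/-- Exchanging the contents of two positions changes the number of inversions by at most twice
their distance. -/
lemma abs_inversions_swap_mul_sub_le (d : ℕ) (a b : Fin n) (hab : (a : ℕ) + d = b)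
    (τ : Equiv.Perm (Fin n)) :
    |(inversions (Equiv.swap a b * τ) : ℝ) - inversions τ| ≤ 2 * d := by
  induction d generalizing b τ with
  | zero =>
    obtain rfl : a = b := Fin.ext (by omega)
    rw [Equiv.swap_self]
    simp [← Equiv.Perm.one_def]
  | succ d ih =>
    have step : ∀ e ∈ adjacentPairs n, ∀ τ : Equiv.Perm (Fin n),
        |(inversions (Equiv.swap e.1 e.2 * τ) : ℝ) - inversions τ| ≤ 1 := by
      intro e he τ
      rcases inversions_swap_mul he τ with h | h
      · rw [h]; push_cast; simp
      · rw [← h]; push_cast; simp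
    let c : Fin n := ⟨a + d, by omega⟩
    have hcb : (c, b) ∈ adjacentPairs n := by
      rw [mem_adjacentPairs]; simp only [c]; omega
    rcases Nat.eq_zero_or_pos d with rfl | hd
    · have hac : a = c := Fin.ext (by simp [c])
      have := step (c, b) hcb τ
      rw [hac]
      push_cast
      linarith
    · have hac : a ≠ c := by simp only [ne_eq, Fin.ext_iff, c]; omega
      have hab' : a ≠ b := by simp only [ne_eq, Fin.ext_iff]; omega
      -- Conjugating by the last adjacent transposition brings the two positions one step closer and
      -- costs two adjacent exchanges; this is the factor 2.
      have hsw : Equiv.swap a b * τ =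
          Equiv.swap c b * (Equiv.swap a c * (Equiv.swap c b * τ)) := by
        rw [← mul_assoc, ← mul_assoc, Equiv.swap_mul_swap_mul_swap hac hab', Equiv.swap_comm]
      have h1 := step (c, b) hcb τ
      have h2 := ih c rfl (Equiv.swap c b * τ)
      have h3 := step (c, b) hcb (Equiv.swap a c * (Equiv.swap c b * τ))
      rw [hsw]
      push_cast
      simp only at h1 h3
      rw [abs_le] at *
      constructor <;> linarith [h1.1, h1.2, h2.1, h2.2, h3.1, h3.2]

end Inversions

end Stirring

namespace Stirring

/-! ### Local bounded operators, their exponential series, and the finite-dimensional laws of a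
chain. -/

section LocalBounded

variable {S : Type*}

/-- A linear operator on functions that is bounded by `C` in the supremum norm and whose value at
each point depends on finitely many values of its argument. -/
structure IsLocalBounded (L : (S → ℝ) → S → ℝ) (C : ℝ) : Prop where
  nonneg : 0 ≤ C
  add : ∀ g h, L (g + h) = L g + L h
  smul : ∀ (c : ℝ) g, L (c • g) = c • L g
  bound : ∀ g M, (∀ x, |g x| ≤ M) → ∀ x, |L g x| ≤ C * M
  locality : ∀ x, ∃ F : Finset S, ∀ g : S → ℝ, (∀ y ∈ F, g y = 0) → L g x = 0

namespace IsLocalBounded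

variable {L : (S → ℝ) → S → ℝ} {C : ℝ}

lemma iterate (hL : IsLocalBounded L C) (k : ℕ) : IsLocalBounded (L^[k]) (C ^ k) := by
  classical
  induction k with
  | zero =>
    exact ⟨by simp, fun _ _ => rfl, fun _ _ => rfl, fun g M h x => by simpa using h x,
      fun x => ⟨{x}, fun g h => h x (by simp)⟩⟩
  | succ k ih =>
    refine ⟨pow_nonneg hL.nonneg _, fun g h => ?_, fun c g => ?_, fun g M h x => ?_, fun x => ?_⟩
    · rw [Function.iterate_succ_apply', Function.iterate_succ_apply',
        Function.iterate_succ_apply', ih.add, hL.add]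
    · rw [Function.iterate_succ_apply', Function.iterate_succ_apply', ih.smul, hL.smul]
    · rw [Function.iterate_succ_apply', pow_succ', mul_assoc]
      exact hL.bound _ _ (ih.bound g M h) x
    · obtain ⟨F, hF⟩ := hL.locality x
      choose F' hF' using ih.locality
      refine ⟨F.biUnion F', fun g hg => ?_⟩
      rw [Function.iterate_succ_apply']
      exact hF _ fun y hy => hF' y g fun z hz => hg z (Finset.mem_biUnion.2 ⟨y, hy, hz⟩)

lemma sum (hL : IsLocalBounded L C) {ι : Type*} (T : Finset ι) (g : ι → S → ℝ) :
    L (∑ i ∈ T, g i) = ∑ i ∈ T, L (g i) := by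
  let l : (S → ℝ) →ₗ[ℝ] S → ℝ := ⟨⟨L, hL.add⟩, hL.smul⟩
  exact map_sum l g T

lemma zero (hL : IsLocalBounded L C) : L 0 = 0 := by
  simpa using hL.smul 0 0

lemma sub (hL : IsLocalBounded L C) (g h : S → ℝ) : L (g - h) = L g - L h := by
  have : g - h = g + (-1 : ℝ) • h := by simp [sub_eq_add_neg]
  rw [this, hL.add, hL.smul]
  simp [sub_eq_add_neg]

/-- Applying `L` to the function of signs of its matrix row turns the sum of absolute values into a
single value of `L` on a function bounded by one. -/
lemma sum_abs_le (hL : IsLocalBounded L C) (x : S) (T : Finset S) :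
    ∑ y ∈ T, |L (Set.indicator {y} 1) x| ≤ C := by
  classical
  let ε : S → ℝ := fun y => SignType.sign (L (Set.indicator {y} 1) x)
  have h1 : ∀ y, |L (Set.indicator {y} 1) x| = L (ε y • Set.indicator {y} 1) x := fun y => by
    rw [hL.smul, Pi.smul_apply, smul_eq_mul, ← sign_mul_self]
  have h2 : ∑ y ∈ T, |L (Set.indicator {y} 1) x| = L (∑ y ∈ T, ε y • Set.indicator {y} 1) x := by
    rw [hL.sum, Finset.sum_apply]
    exact Finset.sum_congr rfl fun y _ => h1 y
  rw [h2]
  refine (le_abs_self _).trans ((hL.bound _ 1 (fun z => ?_) x).trans_eq (mul_one _))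
  have hε : |ε z| ≤ 1 := by
    simp only [ε]
    rcases SignType.sign (L (Set.indicator {z} 1) x) with _ | _ | _ <;> simp
  rw [Finset.sum_apply]
  simp only [Pi.smul_apply, Set.indicator_apply, Set.mem_singleton_iff, Pi.one_apply, smul_eq_mul,
    mul_ite, mul_one, mul_zero, Finset.sum_ite_eq]
  split_ifs
  · exact hε
  · simp

/-- This is where locality is needed: a bounded functional on bounded functions may vanish on all
finitely supported ones, so boundedness alone would not let the matrix determine the operator. -/
lemma hasSum_apply (hL : IsLocalBounded L C) (g : S → ℝ) (x : S) :
    HasSum (fun y => L (Set.indicator {y} 1) x * g y) (L g x) := by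
  classical
  obtain ⟨F, hF⟩ := hL.locality x
  have h1 : L g x = ∑ y ∈ F, L (Set.indicator {y} 1) x * g y := by
    have h2 : L (∑ y ∈ F, g y • Set.indicator {y} 1) x
        = ∑ y ∈ F, L (Set.indicator {y} 1) x * g y := by
      rw [hL.sum, Finset.sum_apply]
      exact Finset.sum_congr rfl fun y _ => by
        rw [hL.smul, Pi.smul_apply, smul_eq_mul, mul_comm]
    rw [← h2, ← sub_eq_zero, ← Pi.sub_apply, ← hL.sub]
    refine hF _ fun y hy => ?_
    rw [Pi.sub_apply, Finset.sum_apply]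
    simp only [Pi.smul_apply, Set.indicator_apply, Set.mem_singleton_iff, Pi.one_apply,
      smul_eq_mul, mul_ite, mul_one, mul_zero, Finset.sum_ite_eq, hy, if_true, sub_self]
  rw [h1]
  refine hasSum_sum_of_ne_finset_zero fun y hy => ?_
  rw [hF (Set.indicator {y} 1) (fun z hz => ?_), zero_mul]
  rw [Set.indicator_of_notMem]
  rintro rfl
  exact hy hz

/-- The transition function integrates bounded functions to the exponential series. -/
lemma hasSum_transition (hL : IsLocalBounded L C) (t : ℝ) (g : S → ℝ) {M : ℝ}
    (hg : ∀ x, |g x| ≤ M) (x : S) :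
    HasSum (fun y => transition L t x y * g y)
      (∑' k : ℕ, t ^ k / (k.factorial : ℝ) * L^[k] g x) := by
  have hM : 0 ≤ M := (abs_nonneg _).trans (hg x)
  let a : ℕ × S → ℝ := fun q =>
    t ^ q.1 / (q.1.factorial : ℝ) * L^[q.1] (Set.indicator {q.2} 1) x * g q.2
  have hrow : ∀ k, HasSum (fun y => a (k, y)) (t ^ k / (k.factorial : ℝ) * L^[k] g x) := fun k => by
    have := ((hL.iterate k).hasSum_apply g x).mul_left (t ^ k / (k.factorial : ℝ))
    simpa only [a, mul_assoc] using this
  have hfin : ∀ k (T : Finset S),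
      ∑ y ∈ T, ‖a (k, y)‖ ≤ (|t| * C) ^ k / k.factorial * M := fun k T => by
    calc ∑ y ∈ T, ‖a (k, y)‖
        ≤ ∑ y ∈ T, |t| ^ k / k.factorial * M * |L^[k] (Set.indicator {y} 1) x| := by
          refine Finset.sum_le_sum fun y _ => ?_
          simp only [a, norm_mul, norm_div, norm_pow, Real.norm_eq_abs, Nat.abs_cast]
          rw [mul_right_comm]
          gcongr
          exact hg y
      _ ≤ |t| ^ k / k.factorial * M * C ^ k := by
          rw [← Finset.mul_sum]
          gcongr
          exact (hL.iterate k).sum_abs_le x T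
      _ = _ := by rw [mul_pow]; ring
  -- Absolute summability over powers and states together allows the two sums to be exchanged.
  have hsum : Summable a := by
    refine Summable.of_norm ((summable_prod_of_nonneg fun _ => norm_nonneg _).2 ⟨fun k => ?_, ?_⟩)
    · exact summable_of_sum_le (fun _ => norm_nonneg _) (hfin k)
    · refine Summable.of_nonneg_of_le (fun k => tsum_nonneg fun _ => norm_nonneg _) (fun k => ?_)
        ((Real.summable_pow_div_factorial (|t| * C)).mul_right M)
      exact Real.tsum_le_of_sum_le (fun _ => norm_nonneg _) (hfin k)
  have h1 : ∑' k : ℕ, t ^ k / (k.factorial : ℝ) * L^[k] g x = ∑' q, a q := by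
    rw [hsum.tsum_prod]
    exact tsum_congr fun k => (hrow k).tsum_eq.symm
  have hsum' : HasSum (fun q : S × ℕ => a q.swap) (∑' q, a q) :=
    (Equiv.prodComm S ℕ).hasSum_iff.2 hsum.hasSum
  rw [h1]
  refine hsum'.prod_fiberwise fun y => ?_
  have h3 : Summable fun k => a (k, y) := hsum'.summable.prod_factor y
  have h2 : ∑' k, a (k, y) = transition L t x y * g y := by
    rw [transition, ← tsum_mul_right]
  rw [← h2]
  exact h3.hasSum

end IsLocalBounded

end LocalBounded

section MarkovChain

variable {S Ω : Type*} [MeasurableSpace Ω] {L : (S → ℝ) → S → ℝ} {a : S} {X : ℝ≥0 → Ω → S}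
  {μ : Measure Ω}

lemma measureReal_eq_tsum_fiber [Countable S] [IsFiniteMeasure μ] {Z : Ω → S}
    (hZ : ∀ x, MeasurableSet {ω | Z ω = x}) {E : Set Ω} (hE : MeasurableSet E) :
    μ.real E = ∑' x, μ.real (E ∩ {ω | Z ω = x}) := by
  have h : E = ⋃ x, E ∩ {ω | Z ω = x} := by
    ext ω
    simp
  have h' : μ E = ∑' x, μ (E ∩ {ω | Z ω = x}) := by
    conv_lhs => rw [h]
    refine measure_iUnion (fun x y hxy => ?_) fun x => hE.inter (hZ x)
    refine Set.disjoint_left.2 fun ω h1 h2 => hxy ?_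
    exact (show Z ω = x from h1.2).symm.trans h2.2
  rw [measureReal_def, h', ENNReal.tsum_toReal_eq fun _ => measure_ne_top _ _]
  rfl

/-- Probability that the chain is in `A` at the times `δ, 2δ, …, Nδ`. -/
lemma IsMarkovChain.measureReal_forall_mem [Countable S] (hX : IsMarkovChain L a X μ) (A : Set S)
    (δ : ℝ≥0) (N : ℕ) :
    μ.real {ω | ∀ l, 1 ≤ l → l ≤ N → X (l * δ) ω ∈ A} =
      (fun (g : S → ℝ) y => ∑' z, transition L δ y z * A.indicator g z)^[N] 1 a := by
  classical
  have := hX.isProbabilityMeasure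
  set R : (S → ℝ) → S → ℝ := fun g y => ∑' z, transition L δ y z * A.indicator g z with hR
  have hmeasA : ∀ t, MeasurableSet {ω | X t ω ∈ A} := fun t => by
    have : {ω | X t ω ∈ A} = ⋃ x ∈ A, {ω | X t ω = x} := by ext; simp
    rw [this]
    exact MeasurableSet.biUnion (Set.to_countable A) fun x _ => hX.measurableSet_eq t x
  -- The induction needs a mixed event: a prescribed path for the first `i` steps, then confinement
  -- to `A` for `j` more. Splitting over the next position lowers `j` and lengthens the prescribed
  -- path.
  have key : ∀ (j i : ℕ) (x : ℕ → S), x 0 = a →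
      μ.real {ω | (∀ l ≤ i, X (l * δ) ω = x l) ∧
        ∀ l, i + 1 ≤ l → l ≤ i + j → X (l * δ) ω ∈ A} =
      (∏ l ∈ Finset.range i, transition L δ (x l) (x (l + 1))) * R^[j] 1 (x i) := by
    intro j
    induction j with
    | zero =>
      intro i x hx
      have h := hX.finiteDimensional i (fun l => l * δ) x (by simp)
        (fun p q h => mul_le_mul_left (Nat.cast_le.2 h) _) hx
      have h2 : ∀ l : ℕ, (((↑(l + 1) * δ : ℝ≥0) : ℝ)) - ((↑l * δ : ℝ≥0) : ℝ) = (δ : ℝ) := by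
        intro l; push_cast; ring
      simp only [h2] at h
      simp only [Function.iterate_zero, id, Pi.one_apply, mul_one]
      rw [← h]
      congr 1
      ext ω
      simp only [Set.mem_ofPred_eq, and_iff_left_iff_imp]
      intro _ l h1 h2
      omega
    | succ j ih =>
      intro i x hx
      have hE : MeasurableSet {ω | (∀ l ≤ i, X (l * δ) ω = x l) ∧
          ∀ l, i + 1 ≤ l → l ≤ i + (j + 1) → X (l * δ) ω ∈ A} := by
        have : {ω | (∀ l ≤ i, X (l * δ) ω = x l) ∧
            ∀ l, i + 1 ≤ l → l ≤ i + (j + 1) → X (l * δ) ω ∈ A} =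
            (⋂ (l : ℕ) (_ : l ≤ i), {ω | X (l * δ) ω = x l}) ∩
              ⋂ (l : ℕ) (_ : i + 1 ≤ l) (_ : l ≤ i + (j + 1)), {ω | X (l * δ) ω ∈ A} := by
          ext ω
          simp
        rw [this]
        exact (MeasurableSet.iInter fun _ => MeasurableSet.iInter fun _ =>
          hX.measurableSet_eq _ _).inter (MeasurableSet.iInter fun _ =>
            MeasurableSet.iInter fun _ => MeasurableSet.iInter fun _ => hmeasA _)
      rw [measureReal_eq_tsum_fiber (hX.measurableSet_eq (↑(i + 1) * δ)) hE,
        Function.iterate_succ_apply']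
      conv_rhs => rw [hR]
      simp only
      rw [← hR, ← tsum_mul_left]
      refine tsum_congr fun z => ?_
      by_cases hz : z ∈ A
      · rw [Set.indicator_of_mem hz]
        have := ih (i + 1) (fun l => if l ≤ i then x l else z) (by simpa using hx)
        simp only [add_le_iff_nonpos_right, nonpos_iff_eq_zero, one_ne_zero, if_false] at this
        rw [Finset.prod_range_succ] at this
        have h3 : ∏ l ∈ Finset.range i, transition L δ (if l ≤ i then x l else z)
            (if l + 1 ≤ i then x (l + 1) else z) =
            ∏ l ∈ Finset.range i, transition L δ (x l) (x (l + 1)) := by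
          refine Finset.prod_congr rfl fun l hl => ?_
          have := Finset.mem_range.1 hl
          rw [if_pos (by omega), if_pos (by omega)]
        rw [h3] at this
        simp only [le_refl, if_true, add_le_iff_nonpos_right, nonpos_iff_eq_zero, one_ne_zero,
          if_false] at this
        rw [← mul_assoc, ← this]
        congr 1
        ext ω
        simp only [Set.mem_inter_iff, Set.mem_ofPred_eq]
        constructor
        · rintro ⟨⟨h1, h2⟩, h3⟩
          refine ⟨fun l hl => ?_, fun l hl hl' => h2 l (by omega) (by omega)⟩
          split_ifs with h4
          · exact h1 l h4
          · obtain rfl : l = i + 1 := by omega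
            exact h3
        · rintro ⟨h1, h2⟩
          have h5 : X (↑(i + 1) * δ) ω = z := by
            simpa using h1 (i + 1) le_rfl
          refine ⟨⟨fun l hl => ?_, fun l hl hl' => ?_⟩, h5⟩
          · simpa [hl] using h1 l (by omega)
          · rcases Nat.lt_or_ge (i + 1) l with h6 | h6
            · exact h2 l (by omega) (by omega)
            · obtain rfl : l = i + 1 := by omega
              rw [h5]; exact hz
      · rw [Set.indicator_of_notMem hz, mul_zero, mul_zero]
        convert measureReal_empty
        ext ω
        simp only [Set.mem_inter_iff, Set.mem_ofPred_eq, Set.mem_empty_iff_false, iff_false]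
        rintro ⟨⟨_, h2⟩, h3⟩
        exact hz (h3 ▸ h2 (i + 1) le_rfl (by omega))
  have h0 := key N 0 (fun _ => a) rfl
  simp only [Finset.range_zero, Finset.prod_empty, one_mul, zero_add] at h0
  rw [← h0]
  -- The mixed event with `i = 0` still prescribes the position at time 0, which the event in
  -- question does not; the two agree almost surely.
  have hae : ∀ᵐ ω ∂μ, X 0 ω = a := by
    have h := hX.finiteDimensional 0 (fun _ => 0) (fun _ => a) rfl monotone_const rfl
    rw [Finset.range_zero, Finset.prod_empty] at h
    have h' : {ω | ∀ i ≤ 0, X 0 ω = a} = {ω | X 0 ω = a} := by ext; simp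
    rw [h'] at h
    exact (prob_compl_eq_zero_iff (hX.measurableSet_eq 0 a)).2 (by
      rwa [measureReal_def, ENNReal.toReal_eq_one_iff] at h)
  refine measureReal_congr ?_
  filter_upwards [hae] with ω hω
  refine propext ⟨fun h => ⟨fun l hl => ?_, h⟩, fun h => h.2⟩
  obtain rfl : l = 0 := by omega
  simpa using hω

lemma IsMarkovChain.measureReal_mem [Countable S] (hX : IsMarkovChain L a X μ) (A : Set S)
    (t : ℝ≥0) :
    μ.real {ω | X t ω ∈ A} = ∑' z, transition L t a z * A.indicator 1 z := by
  have h := hX.measureReal_forall_mem A t 1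
  rw [Function.iterate_one] at h
  rw [← h]
  congr 1
  ext ω
  simp only [Set.mem_ofPred_eq]
  constructor
  · intro h l h1 h2
    obtain rfl : l = 1 := by omega
    simpa using h
  · intro h
    simpa using h 1 le_rfl le_rfl

lemma IsMarkovChain.measureReal_mem_eq_series [Countable S] (hX : IsMarkovChain L a X μ) {C : ℝ}
    (hL : IsLocalBounded L C) (A : Set S) (t : ℝ≥0) :
    μ.real {ω | X t ω ∈ A} =
      ∑' k : ℕ, (t : ℝ) ^ k / (k.factorial : ℝ) * L^[k] (A.indicator 1) a := by
  classical
  rw [hX.measureReal_mem]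
  refine (hL.hasSum_transition t _ (M := 1) (fun x => ?_) a).tsum_eq
  rw [Set.indicator_apply]
  split_ifs <;> simp

end MarkovChain

end Stirring

namespace Stirring

/-! ### The three generators as local bounded operators. -/

section Generators

lemma walkGenerator_four (g : ℤ → ℝ) (x : ℤ) :
    walkGenerator 4 g x = 2 * (g (x + 1) - g x) + 2 * (g (x - 1) - g x) := by
  norm_num [walkGenerator]

lemma isLocalBounded_walkGenerator : IsLocalBounded (walkGenerator 4) 8 where
  nonneg := by norm_num
  add g h := by
    funext x
    simp only [Pi.add_apply, walkGenerator_four]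
    ring
  smul c g := by
    funext x
    simp only [Pi.smul_apply, smul_eq_mul, walkGenerator_four]
    ring
  bound g M h x := by
    have h1 := abs_le.1 (h x)
    have h2 := abs_le.1 (h (x + 1))
    have h3 := abs_le.1 (h (x - 1))
    rw [walkGenerator_four, abs_le]
    constructor <;> linarith
  locality x := ⟨{x, x + 1, x - 1}, fun g h => by
    rw [walkGenerator_four, h x (by simp), h (x + 1) (by simp), h (x - 1) (by simp)]
    simp⟩

lemma stirringGenerator_eq_sum (g : ℤ × ℤ → ℝ) (y : ℤ × ℤ) :
    stirringGenerator g y = ∑ k ∈ ({y.1 - 1, y.1, y.2 - 1, y.2} : Finset ℤ),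
      (g (Equiv.swap k (k + 1) y.1, Equiv.swap k (k + 1) y.2) - g y) := by
  refine tsum_eq_sum fun k hk => ?_
  simp only [Finset.mem_insert, Finset.mem_singleton, not_or] at hk
  rw [Equiv.swap_apply_of_ne_of_ne (by omega) (by omega),
    Equiv.swap_apply_of_ne_of_ne (by omega) (by omega), sub_self]

lemma isLocalBounded_stirringGenerator : IsLocalBounded stirringGenerator 8 where
  nonneg := by norm_num
  add g h := by
    funext x
    simp only [Pi.add_apply, stirringGenerator_eq_sum]
    rw [← Finset.sum_add_distrib]
    exact Finset.sum_congr rfl fun _ _ => by ring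
  smul c g := by
    funext x
    simp only [Pi.smul_apply, smul_eq_mul, stirringGenerator_eq_sum]
    rw [Finset.mul_sum]
    exact Finset.sum_congr rfl fun _ _ => by ring
  bound g M h y := by
    have hM : 0 ≤ M := (abs_nonneg _).trans (h y)
    rw [stirringGenerator_eq_sum]
    refine (Finset.abs_sum_le_sum_abs _ _).trans
      ((Finset.sum_le_card_nsmul _ _ (2 * M) fun k _ => ?_).trans ?_)
    · have h1 := abs_le.1 (h y)
      have h2 := abs_le.1 (h (Equiv.swap k (k + 1) y.1, Equiv.swap k (k + 1) y.2))
      rw [abs_le]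
      constructor <;> linarith
    · have hc : (({y.1 - 1, y.1, y.2 - 1, y.2} : Finset ℤ).card : ℝ) ≤ 4 := by
        exact_mod_cast Finset.card_le_four
      rw [nsmul_eq_mul]
      nlinarith
  locality y := by
    classical
    refine ⟨insert y (({y.1 - 1, y.1, y.2 - 1, y.2} : Finset ℤ).image fun k =>
      (Equiv.swap k (k + 1) y.1, Equiv.swap k (k + 1) y.2)), fun g h => ?_⟩
    rw [stirringGenerator_eq_sum]
    refine Finset.sum_eq_zero fun k hk => ?_
    rw [h y (Finset.mem_insert_self _ _),
      h _ (Finset.mem_insert_of_mem (Finset.mem_image_of_mem _ hk)), sub_self]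

lemma isLocalBounded_adjacentGenerator (n : ℕ) :
    IsLocalBounded (adjacentGenerator n) (|1 / ((n : ℝ) - 1)| * ((adjacentPairs n).card * 2)) where
  nonneg := by positivity
  add g h := by
    funext x
    simp only [Pi.add_apply, adjacentGenerator]
    rw [← mul_add, ← Finset.sum_add_distrib]
    congr 1
    exact Finset.sum_congr rfl fun _ _ => by ring
  smul c g := by
    funext x
    simp only [Pi.smul_apply, smul_eq_mul, adjacentGenerator]
    rw [mul_left_comm c, Finset.mul_sum _ _ c]
    congr 1
    exact Finset.sum_congr rfl fun _ _ => by ring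
  bound g M h σ := by
    rw [adjacentGenerator, abs_mul, mul_assoc]
    refine mul_le_mul_of_nonneg_left ((Finset.abs_sum_le_sum_abs _ _).trans
      ((Finset.sum_le_card_nsmul _ _ (2 * M) fun k _ => ?_).trans ?_)) (abs_nonneg _)
    · have h1 := abs_le.1 (h σ)
      have h2 := abs_le.1 (h (Equiv.swap k.1 k.2 * σ))
      rw [abs_le]
      constructor <;> linarith
    · rw [nsmul_eq_mul]
      linarith
  locality σ := ⟨Finset.univ, fun g h => by simp [adjacentGenerator, h]⟩

end Generators

/-! ### Antisymmetric functions: two stirred particles reduce to one rate-four walk. -/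

section OddFunctions

/-- The sign of an integer, as a real number. -/
def signFn (x : ℤ) : ℝ := (Int.sign x : ℝ)

lemma signFn_of_pos {x : ℤ} (h : 0 < x) : signFn x = 1 := by
  simp [signFn, Int.sign_eq_one_of_pos h]

lemma signFn_of_neg {x : ℤ} (h : x < 0) : signFn x = -1 := by
  simp [signFn, Int.sign_eq_neg_one_of_neg h]

@[simp] lemma signFn_zero : signFn 0 = 0 := by simp [signFn]

lemma signFn_neg (x : ℤ) : signFn (-x) = -signFn x := by simp [signFn]

lemma abs_signFn_le (x : ℤ) : |signFn x| ≤ 1 := by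
  rcases lt_trichotomy x 0 with h | rfl | h
  · simp [signFn_of_neg h]
  · simp
  · simp [signFn_of_pos h]

lemma walkGenerator_neg {g : ℤ → ℝ} (hg : ∀ x, g (-x) = -g x) (x : ℤ) :
    walkGenerator 4 g (-x) = -walkGenerator 4 g x := by
  rw [walkGenerator_four, walkGenerator_four, show -x + 1 = -(x - 1) by ring,
    show -x - 1 = -(x + 1) by ring, hg, hg, hg]
  ring

lemma walkGenerator_iterate_neg {g : ℤ → ℝ} (hg : ∀ x, g (-x) = -g x) (k : ℕ) (x : ℤ) :
    (walkGenerator 4)^[k] g (-x) = -(walkGenerator 4)^[k] g x := by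
  induction k generalizing g with
  | zero => exact hg x
  | succ k ih =>
    rw [Function.iterate_succ_apply]
    exact ih (walkGenerator_neg hg)

/-- For an antisymmetric function of two variables, exchanging the contents of two sites acts as
the sum of its actions on either variable. -/
lemma swap_sub_eq_add {α : Type*} [DecidableEq α] {G : α → α → ℝ} (hG : ∀ i j, G i j = -G j i)
    (a b i j : α) :
    G (Equiv.swap a b i) (Equiv.swap a b j) - G i j =
      (G (Equiv.swap a b i) j - G i j) + (G i (Equiv.swap a b j) - G i j) := by
  -- If `i` or `j` is not an exchanged site, one bracket vanishes and the identity is trivial. If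
  -- `i`, `j` are the two exchanged sites, both sides are `-2 * G i j` because the diagonal
  -- vanishes. If `i = j` is an exchanged site, both sides vanish by antisymmetry.
  have h0 : ∀ i, G i i = 0 := fun i => by linarith [hG i i]
  simp only [Equiv.swap_apply_def]
  have := hG a b
  grind

lemma hasSum_swap_sub (φ : ℤ → ℝ) (a : ℤ) :
    HasSum (fun k : ℤ => φ (Equiv.swap k (k + 1) a) - φ a) (φ (a + 1) + φ (a - 1) - 2 * φ a) := by
  have h : ∑ k ∈ ({a, a - 1} : Finset ℤ), (φ (Equiv.swap k (k + 1) a) - φ a) =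
      φ (a + 1) + φ (a - 1) - 2 * φ a := by
    rw [Finset.sum_pair (by omega), Equiv.swap_apply_left, sub_add_cancel,
      Equiv.swap_apply_right]
    ring
  rw [← h]
  refine hasSum_sum_of_ne_finset_zero fun k hk => ?_
  simp only [Finset.mem_insert, Finset.mem_singleton, not_or] at hk
  rw [Equiv.swap_apply_of_ne_of_ne (by omega) (by omega), sub_self]

/-- On odd functions of the difference of the two particles, random stirring acts as simple random
walk. -/
lemma stirringGenerator_odd {w : ℤ → ℝ} (hw : ∀ x, w (-x) = -w x) (y : ℤ × ℤ) :
    stirringGenerator (fun y => w (y.2 - y.1)) y = walkGenerator 4 w (y.2 - y.1) := by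
  have hG : ∀ i j : ℤ, w (j - i) = -w (i - j) := fun i j => by rw [← hw, neg_sub]
  have h := (hasSum_swap_sub (fun a => w (y.2 - a)) y.1).add
    (hasSum_swap_sub (fun a => w (a - y.1)) y.2)
  rw [stirringGenerator]
  have h' : ∀ k : ℤ, w (Equiv.swap k (k + 1) y.2 - Equiv.swap k (k + 1) y.1) - w (y.2 - y.1) =
      w (y.2 - Equiv.swap k (k + 1) y.1) - w (y.2 - y.1) +
        (w (Equiv.swap k (k + 1) y.2 - y.1) - w (y.2 - y.1)) := fun k =>
    swap_sub_eq_add (G := fun i j => w (j - i)) hG k (k + 1) y.1 y.2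
  simp only [h']
  rw [h.tsum_eq, walkGenerator_four, show y.2 - (y.1 + 1) = y.2 - y.1 - 1 by ring,
    show y.2 - (y.1 - 1) = y.2 - y.1 + 1 by ring, show y.2 + 1 - y.1 = y.2 - y.1 + 1 by ring,
    show y.2 - 1 - y.1 = y.2 - y.1 - 1 by ring]
  ring

lemma stirringGenerator_iterate_odd (k : ℕ) {w : ℤ → ℝ} (hw : ∀ x, w (-x) = -w x) (y : ℤ × ℤ) :
    stirringGenerator^[k] (fun y => w (y.2 - y.1)) y = (walkGenerator 4)^[k] w (y.2 - y.1) := by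
  induction k generalizing w with
  | zero => rfl
  | succ k ih =>
    rw [Function.iterate_succ_apply, Function.iterate_succ_apply, ← ih (walkGenerator_neg hw)]
    exact congrArg (fun g => stirringGenerator^[k] g y)
      (funext fun y => stirringGenerator_odd hw y)

/-- The indicator of exchange is half the indicator of distinct positions minus half the sign of the
difference. Stirring never merges two particles, so the first part is annihilated by the generator
and only the sign evolves. -/
lemma stirringGenerator_iterate_exchanged (k : ℕ) :
    stirringGenerator^[k] (Set.indicator {y : ℤ × ℤ | y.1 > y.2} 1) (0, 1) =
      (if k = 0 then 1 / 2 else 0) - 1 / 2 * (walkGenerator 4)^[k] signFn 1 := by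
  classical
  have hlb := isLocalBounded_stirringGenerator.iterate k
  let d : ℤ × ℤ → ℝ := fun y => if y.1 = y.2 then 0 else 1
  have h1 : Set.indicator {y : ℤ × ℤ | y.1 > y.2} (1 : ℤ × ℤ → ℝ) =
      (1 / 2 : ℝ) • d - (1 / 2 : ℝ) • fun y => signFn (y.2 - y.1) := by
    funext y
    simp only [Set.indicator_apply, Set.mem_ofPred_eq, Pi.one_apply, Pi.sub_apply, Pi.smul_apply,
      smul_eq_mul, d]
    rcases lt_trichotomy y.1 y.2 with h | h | h
    · rw [signFn_of_pos (by omega), if_neg (by omega), if_neg (by omega)]; ring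
    · simp [h]
    · rw [signFn_of_neg (by omega), if_pos h, if_neg (by omega)]; ring
  have hd : stirringGenerator d = 0 := by
    funext y
    rw [stirringGenerator_eq_sum]
    refine Finset.sum_eq_zero fun k _ => ?_
    simp [d]
  have hdk : stirringGenerator^[k] d (0, 1) = if k = 0 then 1 else 0 := by
    cases k with
    | zero => simp [d]
    | succ k =>
      rw [Function.iterate_succ_apply, hd, (isLocalBounded_stirringGenerator.iterate k).zero]
      simp
  rw [h1, hlb.sub, hlb.smul, hlb.smul, Pi.sub_apply, Pi.smul_apply, Pi.smul_apply, hdk,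
    stirringGenerator_iterate_odd k signFn_neg]
  split_ifs <;> simp

end OddFunctions

/-! ### Uniformly continuous semigroups and the mean sign of the walk. -/

section Semigroup

open BoundedContinuousFunction NormedSpace

section Banach

variable {E : Type*} [NormedAddCommGroup E] [NormedSpace ℝ E]

/-- The uniformly continuous semigroup with a given generator. -/
noncomputable def expSemigroup (A : E →L[ℝ] E) (t : ℝ) : E →L[ℝ] E := exp (t • A)

lemma expSemigroup_zero (A : E →L[ℝ] E) : expSemigroup A 0 = 1 := by
  simp [expSemigroup]

lemma expSemigroup_apply_comm (A : E →L[ℝ] E) (t : ℝ) (g : E) :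
    expSemigroup A t (A g) = A (expSemigroup A t g) := by
  have h : Commute (expSemigroup A t) A := ((Commute.refl A).smul_left t).exp_left
  exact DFunLike.congr_fun h.eq g

variable [CompleteSpace E]

lemma hasSum_expSemigroup (A : E →L[ℝ] E) (t : ℝ) (φ : E →L[ℝ] ℝ) (g : E) :
    HasSum (fun k : ℕ => t ^ k / (k.factorial : ℝ) * φ (A^[k] g)) (φ (expSemigroup A t g)) := by
  have h := (exp_series_hasSum_exp' (𝕂 := ℝ) (t • A)).mapL
    (φ.comp (ContinuousLinearMap.apply ℝ E g))
  refine h.congr_fun fun k => ?_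
  simp only [ContinuousLinearMap.comp_apply, ContinuousLinearMap.apply_apply, smul_pow, map_smul,
    smul_eq_mul, ← FunLike.coe_pow_eq_iterate]
  ring

lemma hasDerivAt_expSemigroup (A : E →L[ℝ] E) (t : ℝ) :
    HasDerivAt (expSemigroup A) (expSemigroup A t * A) t :=
  hasDerivAt_exp_smul_const A t

lemma hasDerivAt_expSemigroup_apply (A : E →L[ℝ] E) (φ : E →L[ℝ] ℝ) (g : E) (t : ℝ) :
    HasDerivAt (fun t => φ (expSemigroup A t g)) (φ (expSemigroup A t (A g))) t :=
  (φ.comp (ContinuousLinearMap.apply ℝ E g)).hasFDerivAt.comp_hasDerivAt t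
    (hasDerivAt_expSemigroup A t)

/-- Differentiation replaces `g` by `A g`, so the induction on the order of smoothness runs over all
`g` at once. -/
lemma contDiff_expSemigroup_apply (A : E →L[ℝ] E) (φ : E →L[ℝ] ℝ) (g : E) :
    ContDiff ℝ (⊤ : ℕ∞) fun t => φ (expSemigroup A t g) := by
  have h : ∀ (n : ℕ) (g : E), ContDiff ℝ n fun t => φ (expSemigroup A t g) := by
    intro n
    induction n with
    | zero =>
      intro g
      exact contDiff_zero.2 (continuous_iff_continuousAt.2 fun t =>
        (hasDerivAt_expSemigroup_apply A φ g t).continuousAt)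
    | succ n ih =>
      intro g
      push_cast
      refine contDiff_succ_iff_deriv.2
        ⟨fun t => (hasDerivAt_expSemigroup_apply A φ g t).differentiableAt,
          fun h => absurd h (WithTop.natCast_ne_top n), ?_⟩
      have : deriv (fun t => φ (expSemigroup A t g)) = fun t => φ (expSemigroup A t (A g)) :=
        funext fun t => (hasDerivAt_expSemigroup_apply A φ g t).deriv
      rw [this]
      exact ih (A g)
  exact contDiff_infty.2 fun n => h n g

end Banach

namespace IsLocalBounded

variable {S : Type*} [TopologicalSpace S] {T : (S → ℝ) → S → ℝ} {C : ℝ}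

lemma norm_apply_le (hT : IsLocalBounded T C) (g : S →ᵇ ℝ) (x : S) : ‖T g x‖ ≤ C * ‖g‖ :=
  hT.bound g ‖g‖ (fun x => g.norm_coe_le_norm x) x

variable [DiscreteTopology S]

/-- A local bounded operator as a linear operator on the space of bounded functions. -/
noncomputable def lin (hT : IsLocalBounded T C) : (S →ᵇ ℝ) →ₗ[ℝ] (S →ᵇ ℝ) where
  toFun g := ofNormedAddCommGroupDiscrete (T g) (C * ‖g‖) (hT.norm_apply_le g)
  map_add' g h := by
    ext x
    exact congrFun (hT.add g h) x
  map_smul' c g := by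
    ext x
    exact congrFun (hT.smul c g) x

lemma norm_lin_le (hT : IsLocalBounded T C) (g : S →ᵇ ℝ) : ‖hT.lin g‖ ≤ C * ‖g‖ :=
  (BoundedContinuousFunction.norm_le (mul_nonneg hT.nonneg (norm_nonneg _))).2 (hT.norm_apply_le g)

/-- A local bounded operator as a continuous operator on the space of bounded functions. -/
noncomputable def op (hT : IsLocalBounded T C) : (S →ᵇ ℝ) →L[ℝ] (S →ᵇ ℝ) :=
  hT.lin.mkContinuous C hT.norm_lin_le

lemma norm_op_le (hT : IsLocalBounded T C) : ‖hT.op‖ ≤ C :=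
  LinearMap.mkContinuous_norm_le _ hT.nonneg _

end IsLocalBounded

/-- The generator of the rate-four walk as a bounded operator on bounded functions. -/
noncomputable def walkOp : (ℤ →ᵇ ℝ) →L[ℝ] (ℤ →ᵇ ℝ) := isLocalBounded_walkGenerator.op

@[simp] lemma coe_walkOp (g : ℤ →ᵇ ℝ) : ⇑(walkOp g) = walkGenerator 4 g := rfl

lemma coe_walkOp_iterate (k : ℕ) (g : ℤ →ᵇ ℝ) : ⇑(walkOp^[k] g) = (walkGenerator 4)^[k] g := by
  induction k with
  | zero => rfl
  | succ k ih =>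
    rw [Function.iterate_succ_apply', coe_walkOp, ih, Function.iterate_succ_apply']

/-- The semigroup of the rate-four walk. -/
noncomputable def walkSemigroup (t : ℝ) : (ℤ →ᵇ ℝ) →L[ℝ] (ℤ →ᵇ ℝ) := expSemigroup walkOp t

lemma hasSum_walkSemigroup (t : ℝ) (g : ℤ →ᵇ ℝ) (x : ℤ) :
    HasSum (fun k : ℕ => t ^ k / (k.factorial : ℝ) * (walkGenerator 4)^[k] g x)
      (walkSemigroup t g x) := by
  have h := hasSum_expSemigroup walkOp t (evalCLM ℝ x) g
  simp only [coe_walkOp_iterate, evalCLM_apply] at h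
  exact h

lemma walkSemigroup_zero (g : ℤ →ᵇ ℝ) : walkSemigroup 0 g = g := by
  rw [walkSemigroup, expSemigroup_zero]
  rfl

lemma walkSemigroup_walkOp (t : ℝ) (g : ℤ →ᵇ ℝ) :
    walkSemigroup t (walkOp g) = walkOp (walkSemigroup t g) :=
  expSemigroup_apply_comm walkOp t g

lemma hasDerivAt_walkSemigroup_apply (g : ℤ →ᵇ ℝ) (x : ℤ) (t : ℝ) :
    HasDerivAt (fun t => walkSemigroup t g x) (walkSemigroup t (walkOp g) x) t :=
  hasDerivAt_expSemigroup_apply walkOp (evalCLM ℝ x) g t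

/-- The sign function as a bounded function. -/
noncomputable def signBdd : ℤ →ᵇ ℝ := ofNormedAddCommGroupDiscrete signFn 1 abs_signFn_le

@[simp] lemma coe_signBdd : ⇑signBdd = signFn := rfl

/-- The mean of the sign of the rate-four walk started at `x`. -/
noncomputable def meanSign (t : ℝ) (x : ℤ) : ℝ := walkSemigroup t signBdd x

lemma hasSum_meanSign (t : ℝ) (x : ℤ) :
    HasSum (fun k : ℕ => t ^ k / (k.factorial : ℝ) * (walkGenerator 4)^[k] signFn x)
      (meanSign t x) := hasSum_walkSemigroup t signBdd x

lemma meanSign_zero_left (x : ℤ) : meanSign 0 x = signFn x := by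
  rw [meanSign, walkSemigroup_zero, coe_signBdd]

lemma meanSign_neg (t : ℝ) (x : ℤ) : meanSign t (-x) = -meanSign t x := by
  rw [← (hasSum_meanSign t (-x)).tsum_eq, ← (hasSum_meanSign t x).tsum_eq, ← tsum_neg]
  simp only [walkGenerator_iterate_neg signFn_neg, mul_neg]

lemma meanSign_zero_right (t : ℝ) : meanSign t 0 = 0 := by
  have := meanSign_neg t 0
  rw [neg_zero] at this
  linarith

lemma hasDerivAt_meanSign (x : ℤ) (t : ℝ) :
    HasDerivAt (fun t => meanSign t x) (walkGenerator 4 (meanSign t) x) t := by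
  have h := hasDerivAt_walkSemigroup_apply signBdd x t
  rw [walkSemigroup_walkOp] at h
  exact h

lemma continuous_meanSign (x : ℤ) : Continuous fun t => meanSign t x :=
  continuous_iff_continuousAt.2 fun t => (hasDerivAt_meanSign x t).continuousAt

lemma contDiff_meanSign (x : ℤ) : ContDiff ℝ (⊤ : ℕ∞) fun t => meanSign t x :=
  contDiff_expSemigroup_apply walkOp (evalCLM ℝ x) signBdd

end Semigroup

section Exchange

variable {ΩY : Type*} [MeasurableSpace ΩY] {ν : Measure ΩY} {Y Y' : ℝ≥0 → ΩY → ℤ}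

/-- The probability that the two neighbouring particles are exchanged. -/
lemma exchangeProb_eq (hY : IsMarkovChain stirringGenerator (0, 1) (fun t ω => (Y t ω, Y' t ω)) ν)
    (u : ℝ≥0) : exchangeProb Y Y' ν u = (1 - meanSign u 1) / 2 := by
  have h := hY.measureReal_mem_eq_series isLocalBounded_stirringGenerator
    {y : ℤ × ℤ | y.1 > y.2} u
  rw [exchangeProb]
  simp only [stirringGenerator_iterate_exchanged, Set.mem_ofPred_eq] at h
  rw [h]
  have h1 : HasSum (fun k : ℕ => (u : ℝ) ^ k / (k.factorial : ℝ) * if k = 0 then 1 / 2 else 0)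
      (1 / 2) := by
    convert hasSum_ite_eq (0 : ℕ) (1 / 2 : ℝ) using 2 with k
    split_ifs with hk <;> simp [hk]
  have h2 := h1.sub ((hasSum_meanSign u 1).mul_left (1 / 2))
  rw [← (show (1 / 2 - 1 / 2 * meanSign u 1 : ℝ) = (1 - meanSign u 1) / 2 by ring), ← h2.tsum_eq]
  exact tsum_congr fun k => by ring

end Exchange

end Stirring

namespace Stirring

/-! ### The walk killed at a point: a product formula for survival on a grid. -/

section ProductFormula

lemma norm_pow_sub_pow_le {R : Type*} [NormedRing R] {a b : R} {c : ℝ} (hc : 1 ≤ c)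
    (ha : ‖a‖ ≤ c) (hb : ‖b‖ ≤ c) (m : ℕ) : ‖a ^ m - b ^ m‖ ≤ m * ‖a - b‖ * c ^ m := by
  have hpow : ∀ m : ℕ, ‖(a - b) * b ^ m‖ ≤ ‖a - b‖ * c ^ m := fun m => by
    induction m with
    | zero => simp
    | succ m ih =>
      rw [pow_succ, ← mul_assoc, pow_succ, ← mul_assoc]
      exact (norm_mul_le _ _).trans (mul_le_mul ih hb (norm_nonneg _) (by positivity))
  induction m with
  | zero => simp
  | succ m ih =>
    have h : a ^ (m + 1) - b ^ (m + 1) = a * (a ^ m - b ^ m) + (a - b) * b ^ m := by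
      rw [pow_succ', pow_succ']
      noncomm_ring
    rw [h]
    calc ‖a * (a ^ m - b ^ m) + (a - b) * b ^ m‖
        ≤ c * (m * ‖a - b‖ * c ^ m) + ‖a - b‖ * c ^ m :=
          (norm_add_le _ _).trans (add_le_add ((norm_mul_le _ _).trans
            (mul_le_mul ha ih (norm_nonneg _) (by positivity))) (hpow m))
      _ ≤ c * (m * ‖a - b‖ * c ^ m) + c * (‖a - b‖ * c ^ m) := by
          have := le_mul_of_one_le_left (show 0 ≤ ‖a - b‖ * c ^ m by positivity) hc
          linarith
      _ = _ := by push_cast; ring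

variable {R : Type*} [NormedRing R] [NormedAlgebra ℝ R]

lemma eventually_norm_le_of_hasDerivAt {F : ℝ → R} {K : R} (hF : HasDerivAt F K 0)
    (h0 : ‖F 0‖ ≤ 1) : ∀ᶠ δ in 𝓝 (0 : ℝ), ‖F δ‖ ≤ 1 + (‖K‖ + 1) * |δ| := by
  have h := hF.isLittleO.bound (c := 1) one_pos
  filter_upwards [h] with δ hδ
  simp only [sub_zero, one_mul, Real.norm_eq_abs] at hδ
  calc ‖F δ‖ = ‖F 0 + δ • K + (F δ - F 0 - δ • K)‖ := by congr 1; abel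
    _ ≤ ‖F 0‖ + ‖δ • K‖ + ‖F δ - F 0 - δ • K‖ := norm_add₃_le
    _ ≤ 1 + |δ| * ‖K‖ + |δ| := by
        gcongr
        rw [norm_smul, Real.norm_eq_abs]
    _ = _ := by ring

/-- Two curves with the same value, of norm at most one, and the same derivative at `0` have
asymptotically the same powers. -/
lemma tendsto_pow_sub_pow {F G : ℝ → R} {K : R} (hF : HasDerivAt F K 0) (hG : HasDerivAt G K 0)
    (h0 : F 0 = G 0) (h1 : ‖F 0‖ ≤ 1) (s : ℝ) :
    Tendsto (fun m : ℕ => F (s / m) ^ m - G (s / m) ^ m) atTop (𝓝 0) := by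
  have hs : Tendsto (fun m : ℕ => s / (m : ℝ)) atTop (𝓝 0) :=
    tendsto_const_div_atTop_nhds_zero_nat s
  have hd : (fun δ => F δ - G δ) =o[𝓝 0] fun δ : ℝ => δ := by
    have := hF.isLittleO.sub hG.isLittleO
    simpa [h0] using this
  -- Equal values and derivatives at 0 make the error of one step o(1/m). The `m` steps accumulate
  -- o(1), amplified at most by the factor `exp (c * |s|)` that bounds the powers.
  have hlim : Tendsto (fun m : ℕ => (m : ℝ) * ‖F (s / m) - G (s / m)‖) atTop (𝓝 0) := by
    have h2 : (fun m : ℕ => ‖F (s / m) - G (s / m)‖) =o[atTop] fun m : ℕ => 1 / (m : ℝ) := by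
      refine ((hd.comp_tendsto hs).norm_left).trans_isBigO ?_
      refine (Asymptotics.isBigO_const_mul_self s (fun m : ℕ => 1 / (m : ℝ)) atTop).congr_left ?_
      intro m
      simp [div_eq_mul_inv]
    refine h2.tendsto_div_nhds_zero.congr fun m => ?_
    rw [one_div, div_inv_eq_mul, mul_comm]
  set c : ℝ := ‖K‖ + 1
  refine squeeze_zero_norm' ?_ (by simpa using hlim.mul_const (Real.exp (c * |s|)))
  filter_upwards [hs.eventually (eventually_norm_le_of_hasDerivAt hF h1),
    hs.eventually (eventually_norm_le_of_hasDerivAt hG (h0 ▸ h1)), eventually_gt_atTop 0]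
    with m hm hm' hm0
  have hc : 1 ≤ 1 + c * |s / m| := by
    have : 0 ≤ c := by positivity
    nlinarith [abs_nonneg (s / m)]
  refine (norm_pow_sub_pow_le hc hm hm' m).trans ?_
  gcongr
  have h3 : 1 + c * |s / m| ≤ Real.exp (c * |s / m|) := by
    linarith [Real.add_one_le_exp (c * |s / m|)]
  refine (pow_le_pow_left₀ (by linarith) h3 m).trans_eq ?_
  rw [← Real.exp_nat_mul, abs_div, Nat.abs_cast]
  congr 1
  field_simp

end ProductFormula

section Killing

variable {E : Type*} [NormedAddCommGroup E] [NormedSpace ℝ E] [CompleteSpace E]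

/-- Killing at the times of a fine grid approximates the semigroup of the compressed generator. -/
lemma tendsto_killed_product (A D : E →L[ℝ] E) (hD : D * D = D) (hn : ‖D‖ ≤ 1) (s : ℝ) :
    Tendsto (fun m : ℕ => (D * expSemigroup A (s / m) * D) ^ m) atTop
      (𝓝 (D * expSemigroup (D * A * D) s)) := by
  -- Both curves take the value `D`, not the identity, at 0 and have derivative `D * A * D` there.
  -- Since `D` is idempotent and commutes with `D * A * D`, the powers of the second curve are
  -- exactly the claimed limit.
  have hF : HasDerivAt (fun δ => D * expSemigroup A δ * D) (D * A * D) 0 := by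
    have := ((hasDerivAt_expSemigroup A 0).const_mul D).mul_const D
    simpa [expSemigroup_zero] using this
  have hG : HasDerivAt (fun δ => D * expSemigroup (D * A * D) δ) (D * A * D) 0 := by
    have := (hasDerivAt_expSemigroup (D * A * D) 0).const_mul D
    simpa [expSemigroup_zero, ← mul_assoc, hD] using this
  have h := tendsto_pow_sub_pow hF hG (by simp [expSemigroup_zero, hD])
    (by simpa [expSemigroup_zero, hD] using hn) s
  have hcomm : Commute D (D * A * D) := by
    change D * (D * A * D) = D * A * D * D
    rw [mul_assoc (D * A), hD, ← mul_assoc, ← mul_assoc, hD]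
  have hpow : ∀ᶠ m : ℕ in atTop, (D * expSemigroup (D * A * D) (s / m)) ^ m =
      D * expSemigroup (D * A * D) s := by
    filter_upwards [eventually_gt_atTop 0] with m hm
    have hc : Commute D (expSemigroup (D * A * D) (s / m)) := (hcomm.smul_right _).exp_right
    have hDm : D ^ m = D := (show IsIdempotentElem D from hD).pow_eq hm.ne'
    rw [hc.mul_pow, hDm, expSemigroup, expSemigroup]
    let _ : NormedAlgebra ℚ (E →L[ℝ] E) := NormedAlgebra.restrictScalars ℚ ℝ (E →L[ℝ] E)
    rw [← NormedSpace.exp_nsmul]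
    congr 2
    rw [← Nat.cast_smul_eq_nsmul ℝ, smul_smul]
    congr 1
    field_simp
  have h2 : Tendsto (fun m : ℕ => (D * expSemigroup (D * A * D) (s / m)) ^ m) atTop
      (𝓝 (D * expSemigroup (D * A * D) s)) :=
    tendsto_const_nhds.congr' (hpow.mono fun m hm => hm.symm)
  simpa using h.add h2

end Killing

lemma mul_pow_eq_pow_mul_of_idempotent {M : Type*} [Monoid M] {d : M} (hd : d * d = d) (e : M)
    (N : ℕ) : d * (e * d) ^ N = (d * e * d) ^ N * d := by
  induction N with
  | zero => simp
  | succ N ih =>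
    rw [pow_succ, ← mul_assoc, ih, pow_succ]
    simp only [mul_assoc, hd]

section Avoid

open BoundedContinuousFunction

/-- Setting a function to zero at a given point. -/
def maskAt (x : ℤ) (g : ℤ → ℝ) (y : ℤ) : ℝ := if y = x then 0 else g y

lemma isLocalBounded_maskAt (x : ℤ) : IsLocalBounded (maskAt x) 1 where
  nonneg := zero_le_one
  add g h := by
    funext y
    simp only [maskAt, Pi.add_apply]
    split_ifs <;> simp
  smul c g := by
    funext y
    simp only [maskAt, Pi.smul_apply, smul_eq_mul]
    split_ifs <;> simp
  bound g M h y := by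
    rw [maskAt, one_mul]
    split_ifs
    · simpa using (abs_nonneg _).trans (h y)
    · exact h y
  locality y := ⟨{y}, fun g h => by
    rw [maskAt, h y (by simp)]
    simp⟩

/-- Setting a function to zero at a given point, as an operator on bounded functions. -/
noncomputable def maskOp (x : ℤ) : (ℤ →ᵇ ℝ) →L[ℝ] (ℤ →ᵇ ℝ) := (isLocalBounded_maskAt x).op

lemma coe_maskOp (x : ℤ) (g : ℤ →ᵇ ℝ) : ⇑(maskOp x g) = maskAt x g := rfl

lemma maskOp_mul_self (x : ℤ) : maskOp x * maskOp x = maskOp x := by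
  refine ContinuousLinearMap.ext fun g => BoundedContinuousFunction.ext fun y => ?_
  change maskAt x (maskAt x g) y = maskAt x g y
  simp only [maskAt]
  split_ifs <;> rfl

/-- The reflection principle for the generator. The iterates of `L` on the sign are odd, hence
vanish at 0, so they satisfy the killing condition by themselves: on either side of `x` the killed
iterate is the odd one up to a sign, and a neighbour of `x` sees the value 0 there in both pictures.
-/
lemma killed_iterate (x : ℤ) (k : ℕ) (y : ℤ) :
    (fun g => maskAt x (walkGenerator 4 (maskAt x g)))^[k] (maskAt x 1) y =
      signFn (x - y) * (walkGenerator 4)^[k] signFn (x - y) := by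
  induction k generalizing y with
  | zero =>
    simp only [Function.iterate_zero, id, maskAt, Pi.one_apply]
    rcases lt_trichotomy y x with h | rfl | h
    · rw [if_neg h.ne, signFn_of_pos (by omega)]; norm_num
    · simp
    · rw [if_neg h.ne', signFn_of_neg (by omega)]; norm_num
  | succ k ih =>
    rw [Function.iterate_succ_apply', Function.iterate_succ_apply']
    set w := (walkGenerator 4)^[k] signFn
    have hw0 : w 0 = 0 := by
      have := walkGenerator_iterate_neg signFn_neg k 0
      rw [neg_zero] at this
      change w 0 = -w 0 at this
      linarith
    have hmask : maskAt x ((fun g => maskAt x (walkGenerator 4 (maskAt x g)))^[k] (maskAt x 1)) =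
        fun y => signFn (x - y) * w (x - y) := by
      funext y
      rw [maskAt, ih]
      split_ifs with h
      · simp [h]
      · rfl
    rw [hmask, maskAt]
    split_ifs with h
    · simp [h]
    · rw [walkGenerator_four, walkGenerator_four]
      have e1 : x - (y + 1) = x - y - 1 := by ring
      have e2 : x - (y - 1) = x - y + 1 := by ring
      rw [e1, e2]
      generalize hz : x - y = z
      have hz0 : z ≠ 0 := by omega
      rcases lt_or_gt_of_ne hz0 with h | h
      · rw [signFn_of_neg h, signFn_of_neg (show z - 1 < 0 by omega)]
        rcases eq_or_ne (z + 1) 0 with h' | h'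
        · rw [h', hw0]; ring
        · rw [signFn_of_neg (show z + 1 < 0 by omega)]; ring
      · rw [signFn_of_pos h, signFn_of_pos (show 0 < z + 1 by omega)]
        rcases eq_or_ne (z - 1) 0 with h' | h'
        · rw [h', hw0]; ring
        · rw [signFn_of_pos (show 0 < z - 1 by omega)]; ring

lemma killed_semigroup (x : ℤ) (s : ℝ) (y : ℤ) :
    expSemigroup (maskOp x * walkOp * maskOp x) s (maskOp x 1) y =
      signFn (x - y) * meanSign s (x - y) := by
  have h := hasSum_expSemigroup (maskOp x * walkOp * maskOp x) s (evalCLM ℝ y) (maskOp x 1)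
  have hit : ∀ k : ℕ, evalCLM ℝ y ((maskOp x * walkOp * maskOp x)^[k] (maskOp x 1)) =
      signFn (x - y) * (walkGenerator 4)^[k] signFn (x - y) := fun k => by
    rw [← killed_iterate]
    have : ∀ y, ((maskOp x * walkOp * maskOp x)^[k] (maskOp x 1)) y =
        (fun g => maskAt x (walkGenerator 4 (maskAt x g)))^[k] (maskAt x 1) y := by
      induction k with
      | zero => intro y; rfl
      | succ k ih =>
        intro y
        rw [Function.iterate_succ_apply', Function.iterate_succ_apply', ← funext ih]
        rfl
    exact this y
  simp only [hit] at h
  refine h.unique (((hasSum_meanSign s (x - y)).mul_left (signFn (x - y))).congr_fun fun k => ?_)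
  ring

variable {ΩW : Type*} [MeasurableSpace ΩW] {μ : Measure ΩW} {W : ℝ≥0 → ΩW → ℤ}

lemma step_eq (x : ℤ) (δ : ℝ) (g : ℤ →ᵇ ℝ) (y : ℤ) :
    ∑' z, transition (walkGenerator 4) δ y z * ({x}ᶜ : Set ℤ).indicator g z =
      expSemigroup walkOp δ (maskOp x g) y := by
  classical
  have hm : ({x}ᶜ : Set ℤ).indicator g = ⇑(maskOp x g) := by
    funext z
    rw [coe_maskOp, maskAt, Set.indicator_apply]
    simp only [Set.mem_compl_iff, Set.mem_singleton_iff]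
    split_ifs <;> rfl
  rw [hm, (isLocalBounded_walkGenerator.hasSum_transition δ _
    (fun z => (maskOp x g).norm_coe_le_norm z) y).tsum_eq]
  exact (hasSum_walkSemigroup δ (maskOp x g) y).tsum_eq

/-- The probability that the walk avoids `x` at the times of a grid. -/
lemma measureReal_avoid_grid (hW : IsMarkovChain (walkGenerator 4) 0 W μ) {x : ℤ} (hx : x ≠ 0)
    (δ : ℝ≥0) (N : ℕ) :
    μ.real {ω | ∀ l, 1 ≤ l → l ≤ N → W (l * δ) ω ≠ x} =
      ((maskOp x * expSemigroup walkOp δ * maskOp x) ^ N) (maskOp x 1) 0 := by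
  have h := hW.measureReal_forall_mem ({x}ᶜ : Set ℤ) δ N
  simp only [Set.mem_compl_iff, Set.mem_singleton_iff] at h
  simp only [ne_eq]
  rw [h]
  have hit : ∀ N, (fun (g : ℤ → ℝ) y => ∑' z, transition (walkGenerator 4) δ y z *
      ({x}ᶜ : Set ℤ).indicator g z)^[N] 1 = ⇑(((expSemigroup walkOp δ * maskOp x) ^ N) 1) := by
    intro N
    induction N with
    | zero => rfl
    | succ N ih =>
      rw [Function.iterate_succ_apply', ih, pow_succ']
      funext y
      exact step_eq x δ _ y
  rw [hit]
  have hop := mul_pow_eq_pow_mul_of_idempotent (maskOp_mul_self x) (expSemigroup walkOp δ) N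
  have h0 : (maskOp x * (expSemigroup walkOp δ * maskOp x) ^ N) 1 0 =
      ((expSemigroup walkOp δ * maskOp x) ^ N) 1 0 := by
    change maskAt x (((expSemigroup walkOp δ * maskOp x) ^ N) 1) 0 = _
    rw [maskAt, if_neg hx.symm]
  rw [← h0, hop]
  rfl

lemma tendsto_measureReal_avoid (hW : IsMarkovChain (walkGenerator 4) 0 W μ) {x : ℤ} (hx : 0 < x)
    (s : ℝ≥0) :
    Tendsto (fun N : ℕ => μ.real {ω | ∀ l, 1 ≤ l → l ≤ N → W (l * (s / N)) ω ≠ x}) atTop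
      (𝓝 (meanSign s x)) := by
  have h := tendsto_killed_product walkOp (maskOp x) (maskOp_mul_self x)
    (isLocalBounded_maskAt x).norm_op_le s
  have hc : Continuous fun B : (ℤ →ᵇ ℝ) →L[ℝ] (ℤ →ᵇ ℝ) => evalCLM ℝ (0 : ℤ) (B (maskOp x 1)) :=
    (evalCLM ℝ (0 : ℤ)).continuous.comp
      (ContinuousLinearMap.apply ℝ (ℤ →ᵇ ℝ) (maskOp x 1)).continuous
  have h' := (hc.tendsto _).comp h
  have hlim : evalCLM ℝ (0 : ℤ) ((maskOp x *
      expSemigroup (maskOp x * walkOp * maskOp x) s) (maskOp x 1)) = meanSign s x := by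
    change maskAt x (expSemigroup (maskOp x * walkOp * maskOp x) s (maskOp x 1)) 0 = _
    rw [maskAt, if_neg hx.ne, killed_semigroup, sub_zero, signFn_of_pos hx, one_mul]
  rw [hlim] at h'
  refine h'.congr fun N => ?_
  rw [measureReal_avoid_grid hW hx.ne']
  simp only [Function.comp_apply, NNReal.coe_div, NNReal.coe_natCast]
  rfl

end Avoid

end Stirring

namespace Stirring

/-! ### The law of the hitting times, from right-continuity and dyadic grids. -/

section HittingTime

variable {ΩW : Type*} {W : ℝ≥0 → ΩW → ℤ}

lemma exists_Ioo_of_right_continuous {ω : ΩW} (hω : ∀ t, ∀ᶠ s in 𝓝[>] t, W s ω = W t ω)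
    (t : ℝ≥0) : ∃ b, t < b ∧ ∀ s, t < s → s < b → W s ω = W t ω := by
  obtain ⟨b, hb, h⟩ := (mem_nhdsGT_iff_exists_Ioo_subset' (lt_add_one t)).1 (hω t)
  exact ⟨b, hb, fun s h1 h2 => h ⟨h1, h2⟩⟩

/-- The path is constant for a while after `s`, so a path that has missed `x` up to `s` misses it
strictly longer; the infimum cannot equal `s` without being attained. -/
lemma hittingTime_le_iff {ω : ΩW} (hω : ∀ t, ∀ᶠ s in 𝓝[>] t, W s ω = W t ω) (x : ℤ) (s : ℝ≥0) :
    hittingTime W x ω ≤ s ↔ ∃ t ≤ s, W t ω = x := by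
  constructor
  · intro h
    by_contra! hc
    obtain ⟨b, hb, h'⟩ := exists_Ioo_of_right_continuous hω s
    have : (b : ℝ≥0∞) ≤ hittingTime W x ω := by
      refine le_iInf₂ fun t ht => ?_
      rw [ENNReal.coe_le_coe]
      by_contra! hlt
      rcases le_or_gt t s with h1 | h1
      · exact hc t h1 ht
      · exact hc s le_rfl ((h' t h1 hlt).symm.trans ht)
    exact absurd (ENNReal.coe_le_coe.1 (this.trans h)) (not_le.2 hb)
  · rintro ⟨t, hts, ht⟩
    exact (iInf₂_le t ht).trans (ENNReal.coe_le_coe.2 hts)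

/-- After a visit at `t < s` the path stays at `x` for a positive time, and a fine grid has a point
in that interval. A visit at `s` itself is seen by the last grid point. -/
lemma exists_grid_iff {ω : ΩW} (hω : ∀ t, ∀ᶠ s in 𝓝[>] t, W s ω = W t ω) (x : ℤ) {s : ℝ≥0}
    (hs : 0 < s) :
    (∃ t ≤ s, W t ω = x) ↔
      ∃ j l : ℕ, 1 ≤ l ∧ l ≤ 2 ^ j ∧ W (l * (s / ((2 ^ j : ℕ) : ℝ≥0))) ω = x := by
  constructor
  · rintro ⟨t, hts, ht⟩
    rcases hts.eq_or_lt with rfl | hlt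
    · exact ⟨0, 1, le_rfl, le_rfl, by simpa using ht⟩
    · obtain ⟨b, hb, h'⟩ := exists_Ioo_of_right_continuous hω t
      have hb' : 0 < min b s - t := tsub_pos_of_lt (lt_min hb hlt)
      obtain ⟨j, hj⟩ : ∃ j : ℕ, s / (min b s - t) < 2 ^ j :=
        pow_unbounded_of_one_lt _ one_lt_two
      set δ : ℝ≥0 := s / ((2 ^ j : ℕ) : ℝ≥0) with hδ
      have hδ0 : 0 < δ := by positivity
      have hδb : δ < min b s - t := by
        rw [hδ, div_lt_iff₀ (by positivity)]
        rw [div_lt_iff₀ hb'] at hj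
        push_cast
        rwa [mul_comm]
      let l := ⌊t / δ⌋₊ + 1
      have h1 : t < l * δ := by
        rw [← div_lt_iff₀ hδ0]
        exact_mod_cast Nat.lt_floor_add_one (t / δ)
      have h2 : l * δ < min b s := by
        have : (⌊t / δ⌋₊ : ℝ≥0) * δ ≤ t := by
          rw [← le_div_iff₀ hδ0]
          exact Nat.floor_le zero_le
        calc (l : ℝ≥0) * δ = ⌊t / δ⌋₊ * δ + δ := by simp only [l]; push_cast; ring
          _ ≤ t + δ := by gcongr
          _ < t + (min b s - t) := by gcongr
          _ = min b s := add_tsub_cancel_of_le (lt_min hb hlt).le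
      refine ⟨j, l, by omega, ?_, (h' _ h1 (h2.trans_le (min_le_left _ _))).trans ht⟩
      have h3 : (l : ℝ≥0) * δ < s := h2.trans_le (min_le_right _ _)
      have h4 : s = ((2 ^ j : ℕ) : ℝ≥0) * δ := by
        rw [hδ, mul_div_cancel₀]
        positivity
      rw [h4] at h3
      exact_mod_cast (lt_of_mul_lt_mul_right h3 hδ0.le).le
  · rintro ⟨j, l, -, hl, h⟩
    refine ⟨_, ?_, h⟩
    have : (l : ℝ≥0) ≤ ((2 ^ j : ℕ) : ℝ≥0) := by exact_mod_cast hl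
    calc (l : ℝ≥0) * (s / ((2 ^ j : ℕ) : ℝ≥0))
        ≤ ((2 ^ j : ℕ) : ℝ≥0) * (s / ((2 ^ j : ℕ) : ℝ≥0)) := by
          gcongr
      _ = s := by
          rw [mul_div_cancel₀]
          positivity

variable [MeasurableSpace ΩW] {μ : Measure ΩW}

/-- On right-continuous paths the infimum may be taken over rational times. Measurability almost
everywhere is what keeps `Measure.map` in `hittingLaw` from its default value 0. -/
lemma aemeasurable_hittingTime (hW : IsMarkovChain (walkGenerator 4) 0 W μ) (x : ℤ) :
    AEMeasurable (hittingTime W x) μ := by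
  classical
  refine ⟨fun ω => ⨅ q : ℚ≥0, if W (q : ℝ≥0) ω = x then ((q : ℝ≥0) : ℝ≥0∞) else ⊤, ?_, ?_⟩
  · exact Measurable.iInf fun q =>
      Measurable.ite (hW.measurableSet_eq _ x) measurable_const measurable_const
  · filter_upwards [hW.right_continuous] with ω hω
    apply le_antisymm
    · refine le_iInf fun q => ?_
      split_ifs with h
      · exact (iInf₂_le (q : ℝ≥0) h : (⨅ (t : ℝ≥0) (_ : W t ω = x), (t : ℝ≥0∞)) ≤ _)
      · exact le_top
    · refine le_iInf₂ fun t ht => le_of_forall_gt_imp_ge_of_dense fun a ha => ?_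
      obtain ⟨b, hb, h'⟩ := exists_Ioo_of_right_continuous hω t
      obtain ⟨c, hc, hca⟩ := ENNReal.lt_iff_exists_nnreal_btwn.1 ha
      have hc' : t < min b c := lt_min hb (ENNReal.coe_lt_coe.1 hc)
      obtain ⟨q, hq1, hq2⟩ := exists_rat_btwn (NNReal.coe_lt_coe.2 hc')
      have hq0 : (0 : ℝ) ≤ q := t.coe_nonneg.trans hq1.le
      let r : ℚ≥0 := ⟨q, by exact_mod_cast hq0⟩
      have hr : (((r : ℝ≥0) : ℝ)) = q := by
        rfl
      have hr1 : t < (r : ℝ≥0) := by rw [← NNReal.coe_lt_coe, hr]; exact hq1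
      have hr2 : (r : ℝ≥0) < min b c := by rw [← NNReal.coe_lt_coe, hr]; exact hq2
      refine (iInf_le _ r).trans ?_
      rw [if_pos ((h' _ hr1 (hr2.trans_le (min_le_left _ _))).trans ht)]
      exact (ENNReal.coe_le_coe.2 (hr2.trans_le (min_le_right _ _)).le).trans hca.le

/-- For `x > 0` the events of avoiding `x` on the dyadic grids decrease, up to a null set, to
avoidance up to time `s`, while their probabilities converge to `meanSign s x` by the product
formula. For `x = 0` both sides are 1. -/
lemma measureReal_hittingTime_le (hW : IsMarkovChain (walkGenerator 4) 0 W μ) (x : ℕ) {s : ℝ≥0}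
    (hs : 0 < s) : μ.real {ω | hittingTime W x ω ≤ s} = 1 - meanSign s x := by
  have := hW.isProbabilityMeasure
  rcases Nat.eq_zero_or_pos x with rfl | hx
  · have h0 : ∀ᵐ ω ∂μ, W 0 ω = 0 := by
      have h := hW.finiteDimensional 0 (fun _ => 0) (fun _ => 0) rfl monotone_const rfl
      rw [Finset.range_zero, Finset.prod_empty] at h
      have h' : {ω | ∀ i ≤ 0, W 0 ω = 0} = {ω | W 0 ω = 0} := by ext; simp
      rw [h'] at h
      exact (prob_compl_eq_zero_iff (hW.measurableSet_eq 0 0)).2 (by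
        rwa [measureReal_def, ENNReal.toReal_eq_one_iff] at h)
    have h1 : ({ω | hittingTime W ((0 : ℕ) : ℤ) ω ≤ s} : Set ΩW) =ᵐ[μ] (Set.univ : Set ΩW) := by
      filter_upwards [h0] with ω hω
      refine propext ⟨fun _ => trivial, fun _ => ?_⟩
      exact (iInf₂_le (0 : ℝ≥0) (by simpa using hω)).trans (by simp)
    rw [measureReal_congr h1, probReal_univ, Nat.cast_zero, meanSign_zero_right, sub_zero]
  · let E : ℕ → Set ΩW := fun j =>
      {ω | ∀ l : ℕ, 1 ≤ l → l ≤ 2 ^ j → W (l * (s / ((2 ^ j : ℕ) : ℝ≥0))) ω ≠ x}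
    have hE : ∀ j, MeasurableSet (E j) := fun j => by
      have : E j = ⋂ (l : ℕ) (_ : 1 ≤ l) (_ : l ≤ 2 ^ j),
          {ω | W (l * (s / ((2 ^ j : ℕ) : ℝ≥0))) ω = x}ᶜ := by
        ext ω
        simp [E]
      rw [this]
      exact MeasurableSet.iInter fun _ => MeasurableSet.iInter fun _ => MeasurableSet.iInter
        fun _ => (hW.measurableSet_eq _ _).compl
    -- Each grid consists of the even points of the next one.
    have hanti : Antitone E := antitone_nat_of_succ_le fun j ω hω l h1 h2 => by
      have := hω (2 * l) (by omega) (by rw [pow_succ]; omega)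
      have h3 : ((2 * l : ℕ) : ℝ≥0) * (s / ((2 ^ (j + 1) : ℕ) : ℝ≥0)) =
          l * (s / ((2 ^ j : ℕ) : ℝ≥0)) := by
        push_cast
        rw [pow_succ]
        field_simp
      rwa [h3] at this
    have hlim := tendsto_measure_iInter_atTop (μ := μ) (fun j => (hE j).nullMeasurableSet) hanti
      ⟨0, measure_ne_top _ _⟩
    have hlim' : Tendsto (fun j => μ.real (E j)) atTop (𝓝 (μ.real (⋂ j, E j))) :=
      (ENNReal.tendsto_toReal (measure_ne_top _ _)).comp hlim
    have hlim2 := (tendsto_measureReal_avoid hW (x := x) (by exact_mod_cast hx) s).comp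
      (tendsto_pow_atTop_atTop_of_one_lt (one_lt_two (α := ℕ)))
    have heq := tendsto_nhds_unique hlim' hlim2
    have h1 : ({ω | hittingTime W x ω ≤ s} : Set ΩW) =ᵐ[μ] ((⋂ j, E j)ᶜ : Set ΩW) := by
      filter_upwards [hW.right_continuous] with ω hω
      refine propext ((hittingTime_le_iff hω x s).trans ((exists_grid_iff hω x hs).trans ?_))
      change _ ↔ ω ∈ (⋂ j, E j)ᶜ
      simp [E]
    rw [measureReal_congr h1, probReal_compl_eq_one_sub (MeasurableSet.iInter hE), heq]

end HittingTime

/-! ### First-passage decomposition of the exchange probability. -/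

section FirstPassage

open BoundedContinuousFunction

section Banach

variable {E : Type*} [NormedAddCommGroup E] [NormedSpace ℝ E] [CompleteSpace E]

lemma hasDerivAt_expSemigroup_vector (A : E →L[ℝ] E) (g : E) (t : ℝ) :
    HasDerivAt (fun t => expSemigroup A t g) (expSemigroup A t (A g)) t :=
  (ContinuousLinearMap.apply ℝ E g).hasFDerivAt.comp_hasDerivAt t (hasDerivAt_expSemigroup A t)

lemma hasDerivAt_duhamel (A : E →L[ℝ] E) (φ : E →L[ℝ] ℝ) (t : ℝ) {g : ℝ → E} {g' : E} {s : ℝ}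
    (hg : HasDerivAt g g' s) :
    HasDerivAt (fun s => φ (expSemigroup A (t - s) (g s)))
      (φ (expSemigroup A (t - s) (g' - A (g s)))) s := by
  have h1 : HasDerivAt (fun s => expSemigroup A (t - s)) (-(expSemigroup A (t - s) * A)) s := by
    exact ((hasDerivAt_expSemigroup A (t - s)).scomp s ((hasDerivAt_id s).const_sub t)).congr_deriv
      (by simp)
  have h2 := φ.hasFDerivAt.comp_hasDerivAt s (h1.clm_apply hg)
  refine h2.congr_deriv ?_
  congr 1
  rw [map_sub, sub_eq_neg_add (expSemigroup A (t - s) g')]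
  rfl

end Banach

/-- The odd function whose values at positive points are those of `g`, shifted by one. -/
def oddShift (g : ℤ → ℝ) (y : ℤ) : ℝ := signFn y * g (|y| + 1)

lemma isLocalBounded_oddShift : IsLocalBounded oddShift 1 where
  nonneg := zero_le_one
  add g h := by
    funext y
    simp only [oddShift, Pi.add_apply, mul_add]
  smul c g := by
    funext y
    simp only [oddShift, Pi.smul_apply, smul_eq_mul, mul_left_comm]
  bound g M h y := by
    rw [oddShift, abs_mul]
    exact mul_le_mul (abs_signFn_le y) (h _) (abs_nonneg _) zero_le_one
  locality y := ⟨{|y| + 1}, fun g h => by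
    rw [oddShift, h _ (by simp), mul_zero]⟩

/-- The shift commutes with the generator except next to the origin, where the odd extension has the
value 0 in place of `w 1`. The defect is a multiple of `walkGenerator 4 signFn`, which is supported
at 1 and -1. -/
lemma oddShift_walkGenerator (w : ℤ → ℝ) (y : ℤ) :
    oddShift (walkGenerator 4 w) y =
      walkGenerator 4 (oddShift w) y - w 1 * walkGenerator 4 signFn y := by
  simp only [oddShift, walkGenerator_four]
  rcases lt_trichotomy y 0 with h | rfl | h
  · rcases eq_or_ne y (-1) with rfl | h'
    · norm_num [signFn_of_neg]
      ring
    · rw [signFn_of_neg h, signFn_of_neg (show y + 1 < 0 by omega),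
        signFn_of_neg (show y - 1 < 0 by omega), abs_of_neg h,
        abs_of_neg (show y + 1 < 0 by omega), abs_of_neg (show y - 1 < 0 by omega)]
      ring_nf
  · norm_num [signFn_of_pos, signFn_of_neg]
  · rcases eq_or_ne y 1 with rfl | h'
    · norm_num [signFn_of_pos]
      ring
    · rw [signFn_of_pos h, signFn_of_pos (show 0 < y + 1 by omega),
        signFn_of_pos (show 0 < y - 1 by omega), abs_of_pos h,
        abs_of_pos (show 0 < y + 1 by omega), abs_of_pos (show 0 < y - 1 by omega)]
      ring_nf

/-- The probability that two neighbouring particles are exchanged at time `u`. -/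
noncomputable def exchangeFn (u : ℝ) : ℝ := (1 - meanSign u 1) / 2

/-- The derivative of `exchangeFn`. -/
noncomputable def exchangeDeriv (u : ℝ) : ℝ := -(walkGenerator 4 (meanSign u) 1) / 2

lemma hasDerivAt_exchangeFn (u : ℝ) : HasDerivAt exchangeFn (exchangeDeriv u) u :=
  ((hasDerivAt_meanSign 1 u).const_sub 1).div_const 2

lemma exchangeFn_zero : exchangeFn 0 = 0 := by
  rw [exchangeFn, meanSign_zero_left, signFn_of_pos one_pos]
  norm_num

lemma continuous_walkGenerator_meanSign (x : ℤ) :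
    Continuous fun u => walkGenerator 4 (meanSign u) x := by
  simp only [walkGenerator_four]
  have := continuous_meanSign
  fun_prop

lemma continuous_exchangeDeriv : Continuous exchangeDeriv :=
  (continuous_walkGenerator_meanSign 1).neg.div_const 2

lemma continuous_exchangeFn : Continuous exchangeFn :=
  continuous_iff_continuousAt.2 fun u => (hasDerivAt_exchangeFn u).continuousAt

/-- Decomposition of the exchange probability of two particles at distance `x + 1` at the time when
they become neighbours. -/
lemma integral_exchangeDeriv_mul (x : ℕ) (t : ℝ) :
    ∫ v in (0 : ℝ)..t, exchangeDeriv v * (1 - meanSign (t - v) x) =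
      (1 - meanSign t (x + 1)) / 2 := by
  let J : (ℤ →ᵇ ℝ) →L[ℝ] (ℤ →ᵇ ℝ) := isLocalBounded_oddShift.op
  -- At positive `y` this is `1 - meanSign s (y + 1)`, twice the right-hand side sought. It vanishes
  -- at `s = 0` and solves the heat equation with source `-(2 * exchangeFn s)` times the generator
  -- of the sign.
  let g : ℝ → ℤ →ᵇ ℝ := fun s => signBdd - J (walkSemigroup s signBdd)
  have hg : ∀ s, HasDerivAt g (-J (walkOp (walkSemigroup s signBdd))) s := fun s => by
    have h := J.hasFDerivAt.comp_hasDerivAt s (hasDerivAt_expSemigroup_vector walkOp signBdd s)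
    have h2 := walkSemigroup_walkOp s signBdd
    rw [← h2]
    exact h.const_sub signBdd
  have hg' : ∀ s, -J (walkOp (walkSemigroup s signBdd)) - walkOp (g s) =
      -(2 * exchangeFn s) • walkOp signBdd := fun s => by
    refine BoundedContinuousFunction.ext fun y => ?_
    have h1 := oddShift_walkGenerator (meanSign s) y
    have h2 : walkOp (g s) y =
        walkGenerator 4 signFn y - walkGenerator 4 (oddShift (meanSign s)) y := by
      simp only [g, map_sub]
      rfl
    change -oddShift (walkGenerator 4 (meanSign s)) y - walkOp (g s) y =
      -(2 * exchangeFn s) * walkGenerator 4 signFn y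
    rw [h2, h1, exchangeFn]
    ring
  have hV : ∀ s, HasDerivAt (fun s => 1 - meanSign (t - s) x)
      (walkGenerator 4 (meanSign (t - s)) x) s := fun s => by
    have := ((hasDerivAt_meanSign x (t - s)).scomp s ((hasDerivAt_id s).const_sub t)).const_sub 1
    simpa using this
  have hΦ : ∀ s ∈ Set.uIcc 0 t, HasDerivAt
      (fun s => evalCLM ℝ (x : ℤ) (expSemigroup walkOp (t - s) (g s)) +
        2 * exchangeFn s * (1 - meanSign (t - s) x))
      (2 * (exchangeDeriv s * (1 - meanSign (t - s) x))) s := fun s _ => by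
    have h1 := hasDerivAt_duhamel walkOp (evalCLM ℝ (x : ℤ)) t (hg s)
    have h2 := ((hasDerivAt_exchangeFn s).const_mul 2).mul (hV s)
    refine (h1.add h2).congr_deriv ?_
    rw [hg' s]
    have h3 : evalCLM ℝ (x : ℤ) (expSemigroup walkOp (t - s)
        (-(2 * exchangeFn s) • walkOp signBdd)) =
        -(2 * exchangeFn s) * walkGenerator 4 (meanSign (t - s)) x := by
      rw [map_smul, map_smul, smul_eq_mul]
      have := walkSemigroup_walkOp (t - s) signBdd
      congr 1
      exact DFunLike.congr_fun this (x : ℤ)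
    rw [h3]
    ring
  have hcont : Continuous fun s => exchangeDeriv s * (1 - meanSign (t - s) x) :=
    continuous_exchangeDeriv.mul (continuous_const.sub
      ((continuous_meanSign x).comp (continuous_const.sub continuous_id)))
  have h := intervalIntegral.integral_eq_sub_of_hasDerivAt hΦ
    ((continuous_const.mul hcont).intervalIntegrable _ _)
  rw [intervalIntegral.integral_const_mul] at h
  have h0 : walkSemigroup t (g 0) = 0 := by
    have : g 0 = 0 := by
      refine BoundedContinuousFunction.ext fun y => ?_
      simp only [g, walkSemigroup_zero]
      change signFn y - oddShift signFn y = 0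
      rw [oddShift, signFn_of_pos (show 0 < |y| + 1 by positivity), mul_one, sub_self]
    rw [this, map_zero]
  have h0' : evalCLM ℝ (x : ℤ) (expSemigroup walkOp (t - 0) (g 0)) = 0 := by
    rw [sub_zero]
    exact DFunLike.congr_fun h0 (x : ℤ)
  have ht : evalCLM ℝ (x : ℤ) (expSemigroup walkOp (t - t) (g t)) =
      signFn x - oddShift (meanSign t) x := by
    rw [sub_self]
    have := walkSemigroup_zero (g t)
    exact DFunLike.congr_fun this (x : ℤ)
  rw [h0', ht, exchangeFn_zero, sub_self, meanSign_zero_left, oddShift] at h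
  -- The two summands exchange roles at `s = t`. For `x > 0` the second vanishes because `meanSign 0
  -- x = 1`; for `x = 0` the first vanishes and the second gives the value.
  rcases Nat.eq_zero_or_pos x with rfl | hx
  · simp only [Nat.cast_zero, signFn_zero, exchangeFn] at h ⊢
    rw [zero_add]
    linarith
  · rw [signFn_of_pos (by exact_mod_cast hx), abs_of_nonneg (by positivity)] at h
    linarith

end FirstPassage

end Stirring

namespace Stirring

/-! ### Summation of the series that defines the limit function. -/

section LimitFunction

variable {ΩW : Type*} [MeasurableSpace ΩW] {μ : Measure ΩW} {W : ℝ≥0 → ΩW → ℤ}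

lemma isFiniteMeasure_hittingLaw (hW : IsMarkovChain (walkGenerator 4) 0 W μ) (x : ℤ) :
    IsFiniteMeasure (hittingLaw W μ x) := by
  have := hW.isProbabilityMeasure
  rw [hittingLaw]
  infer_instance

lemma measureReal_hittingLaw_Iic (hW : IsMarkovChain (walkGenerator 4) 0 W μ) (x : ℕ) {s : ℝ}
    (hs : 0 < s) :
    (hittingLaw W μ x).real (Set.Iic (ENNReal.ofReal s)) = 1 - meanSign s x := by
  rw [hittingLaw, map_measureReal_apply_of_aemeasurable (aemeasurable_hittingTime hW x)
    measurableSet_Iic]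
  have := measureReal_hittingTime_le hW x (s := s.toNNReal) (by simpa using hs)
  rw [Real.coe_toNNReal _ hs.le] at this
  exact this

lemma meanSign_le_one (hW : IsMarkovChain (walkGenerator 4) 0 W μ) (x : ℕ) {s : ℝ} (hs : 0 < s) :
    meanSign s x ≤ 1 := by
  have := measureReal_hittingLaw_Iic hW x hs
  have h : 0 ≤ (hittingLaw W μ x).real (Set.Iic (ENNReal.ofReal s)) := measureReal_nonneg
  linarith

lemma integrableOn_exchangeFn (hW : IsMarkovChain (walkGenerator 4) 0 W μ) (x : ℤ) (t : ℝ) :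
    IntegrableOn (fun s : ℝ≥0∞ => exchangeFn ((t - s.toReal).toNNReal : ℝ))
      (Set.Iic (ENNReal.ofReal t)) (hittingLaw W μ x) := by
  have := isFiniteMeasure_hittingLaw hW x
  obtain ⟨C, hC⟩ := (isCompact_Icc (a := (0 : ℝ)) (b := max t 0)).exists_bound_of_continuousOn
    continuous_exchangeFn.continuousOn
  refine Integrable.of_bound (C := C) ?_ (ae_of_all _ fun s => hC _ ⟨NNReal.coe_nonneg _, ?_⟩)
  · exact (continuous_exchangeFn.measurable.comp (measurable_coe_nnreal_real.comp
      (measurable_const.sub ENNReal.measurable_toReal).real_toNNReal)).aestronglyMeasurable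
  · rw [Real.coe_toNNReal']
    exact max_le_max (by linarith [ENNReal.toReal_nonneg (a := s)]) le_rfl

lemma integral_hittingLaw (hW : IsMarkovChain (walkGenerator 4) 0 W μ) (x : ℕ) {t : ℝ}
    (ht : 0 < t) :
    ∫ s in Set.Iic (ENNReal.ofReal t), exchangeFn ((t - s.toReal).toNNReal : ℝ)
      ∂(hittingLaw W μ x) = (1 - meanSign t (x + 1)) / 2 := by
  have := isFiniteMeasure_hittingLaw hW x
  set H := hittingLaw W μ x
  -- Since `exchangeFn 0 = 0`, the integrand is the integral of `exchangeDeriv` over `v ≤ t - s`.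
  -- Fubini then leaves the distribution function of the hitting time at `t - v`, which is known.
  let F : ℝ≥0∞ → ℝ → ℝ := fun s v => if s ≤ ENNReal.ofReal (t - v) then exchangeDeriv v else 0
  have hF : Measurable (Function.uncurry F) := by
    refine Measurable.ite (measurableSet_le measurable_fst
      (ENNReal.measurable_ofReal.comp (measurable_const.sub measurable_snd))) ?_ measurable_const
    exact continuous_exchangeDeriv.measurable.comp measurable_snd
  have hint : Integrable (Function.uncurry F) (H.prod (volume.restrict (Set.Ioc 0 t))) := by
    have h1 : Integrable exchangeDeriv (volume.restrict (Set.Ioc 0 t)) :=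
      (continuous_exchangeDeriv.integrableOn_Icc (a := 0) (b := t)).mono_set Set.Ioc_subset_Icc_self
    refine Integrable.mono' (h1.norm.comp_snd H) hF.aestronglyMeasurable (ae_of_all _ fun q => ?_)
    simp only [Function.uncurry, F]
    split_ifs
    · exact le_rfl
    · simp
  have h1 : ∀ s, ∫ v in Set.Ioc 0 t, F s v =
      (Set.Iic (ENNReal.ofReal t)).indicator
        (fun s : ℝ≥0∞ => exchangeFn ((t - s.toReal).toNNReal : ℝ)) s := fun s => by
    by_cases hs : s ≤ ENNReal.ofReal t
    · have hs' : s.toReal ≤ t := ENNReal.toReal_le_of_le_ofReal ht.le hs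
      have hsfin : s ≠ ⊤ := ne_top_of_le_ne_top ENNReal.ofReal_ne_top hs
      rw [Set.indicator_of_mem (show s ∈ Set.Iic (ENNReal.ofReal t) from hs),
        Real.coe_toNNReal _ (by linarith)]
      have h2 : ∀ v ∈ Set.Ioc 0 t, F s v = (Set.Iic (t - s.toReal)).indicator exchangeDeriv v := by
        intro v hv
        simp only [F, Set.indicator_apply, Set.mem_Iic]
        refine if_congr ?_ rfl rfl
        rw [ENNReal.le_ofReal_iff_toReal_le hsfin (by linarith [hv.2])]
        constructor <;> intro <;> linarith
      rw [setIntegral_congr_fun measurableSet_Ioc h2, setIntegral_indicator measurableSet_Iic]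
      have h3 : Set.Ioc 0 t ∩ Set.Iic (t - s.toReal) = Set.Ioc 0 (t - s.toReal) := by
        ext v
        simp only [Set.mem_inter_iff, Set.mem_Ioc, Set.mem_Iic]
        have := ENNReal.toReal_nonneg (a := s)
        constructor
        · rintro ⟨⟨h1, h2⟩, h3⟩; exact ⟨h1, h3⟩
        · rintro ⟨h1, h2⟩; exact ⟨⟨h1, by linarith⟩, h2⟩
      rw [h3, ← intervalIntegral.integral_of_le (by linarith),
        intervalIntegral.integral_eq_sub_of_hasDerivAt (fun v _ => hasDerivAt_exchangeFn v)
          (continuous_exchangeDeriv.intervalIntegrable _ _), exchangeFn_zero, sub_zero]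
    · rw [Set.indicator_of_notMem (show s ∉ Set.Iic (ENNReal.ofReal t) from hs)]
      refine setIntegral_eq_zero_of_forall_eq_zero fun v hv => if_neg fun h => hs (h.trans ?_)
      exact ENNReal.ofReal_le_ofReal (by linarith [hv.1])
  -- The endpoint `v = t` is left out because the distribution function is available at positive
  -- times only.
  have h2 : ∀ v ∈ Set.Ioo 0 t, ∫ s, F s v ∂H = exchangeDeriv v * (1 - meanSign (t - v) x) := by
    intro v hv
    have : (fun s => F s v) =
        (Set.Iic (ENNReal.ofReal (t - v))).indicator fun _ => exchangeDeriv v := by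
      funext s
      simp only [F, Set.indicator_apply, Set.mem_Iic]
    rw [this, integral_indicator measurableSet_Iic, setIntegral_const,
      measureReal_hittingLaw_Iic hW x (by linarith [hv.2]), smul_eq_mul, mul_comm]
  calc ∫ s in Set.Iic (ENNReal.ofReal t), exchangeFn ((t - s.toReal).toNNReal : ℝ) ∂H
      = ∫ s, (∫ v in Set.Ioc 0 t, F s v) ∂H := by
        rw [← integral_indicator measurableSet_Iic]
        exact integral_congr_ae (ae_of_all _ fun s => (h1 s).symm)
    _ = ∫ v in Set.Ioc 0 t, (∫ s, F s v ∂H) := integral_integral_swap hint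
    _ = ∫ v in Set.Ioo 0 t, (∫ s, F s v ∂H) := integral_Ioc_eq_integral_Ioo
    _ = ∫ v in Set.Ioo 0 t, exchangeDeriv v * (1 - meanSign (t - v) x) :=
        setIntegral_congr_fun measurableSet_Ioo h2
    _ = ∫ v in (0 : ℝ)..t, exchangeDeriv v * (1 - meanSign (t - v) x) := by
        rw [intervalIntegral.integral_of_le ht.le, integral_Ioc_eq_integral_Ioo]
    _ = _ := integral_exchangeDeriv_mul x t

/-- From `y > k`, `k` applications of the generator see only positive sites, where the sign is
constant. -/
lemma walkGenerator_iterate_signFn_of_lt (k : ℕ) {y : ℤ} (hy : (k : ℤ) < y) :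
    (walkGenerator 4)^[k] signFn y = if k = 0 then 1 else 0 := by
  induction k generalizing y with
  | zero => simpa using signFn_of_pos (by simpa using hy)
  | succ k ih =>
    push_cast at hy
    rw [Function.iterate_succ_apply', walkGenerator_four, ih (by omega), ih (by omega),
      ih (by omega)]
    simp

lemma abs_meanSign_term_le (t : ℝ) (x : ℤ) (k : ℕ) :
    ‖t ^ k / (k.factorial : ℝ) * (walkGenerator 4)^[k] signFn x‖ ≤
      (|t| * 8) ^ k / (k.factorial : ℝ) := by
  rw [norm_mul, norm_div, norm_pow, Real.norm_eq_abs, Real.norm_natCast, mul_pow,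
    mul_div_right_comm]
  refine mul_le_mul_of_nonneg_left ?_ (by positivity)
  simpa using (isLocalBounded_walkGenerator.iterate k).bound signFn 1 abs_signFn_le x

lemma abs_meanSign_le (t : ℝ) (x : ℤ) : |meanSign t x| ≤ Real.exp (|t| * 8) := by
  rw [← (hasSum_meanSign t x).tsum_eq, ← Real.norm_eq_abs, Real.exp_eq_exp_ℝ,
    NormedSpace.exp_eq_tsum_div]
  exact tsum_of_norm_bounded (Real.summable_pow_div_factorial _).hasSum (abs_meanSign_term_le t x)

lemma tendsto_meanSign_atTop (t : ℝ) :
    Tendsto (fun N : ℕ => meanSign t N) atTop (𝓝 1) := by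
  have h := tendsto_tsum_of_dominated_convergence (𝓕 := atTop)
    (f := fun (N : ℕ) (k : ℕ) => t ^ k / (k.factorial : ℝ) * (walkGenerator 4)^[k] signFn N)
    (g := fun k => if k = 0 then 1 else 0)
    (Real.summable_pow_div_factorial (|t| * 8)) (fun k => ?_)
    (Eventually.of_forall fun N k => abs_meanSign_term_le t N k)
  · simpa only [tsum_ite_eq, (hasSum_meanSign t _).tsum_eq] using h
  · refine tendsto_const_nhds.congr' ?_
    filter_upwards [eventually_gt_atTop k] with N hN
    rw [walkGenerator_iterate_signFn_of_lt k (by exact_mod_cast hN)]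
    split_ifs with hk <;> simp [hk]

/-- The limit of the normalized distance. -/
noncomputable def limitProfile (t : ℝ) : ℝ := ∫ s in (0 : ℝ)..t, meanSign s 1

/-- The generator is twice the second difference, so the time derivative of the sum telescopes to
one difference at the origin, where `meanSign s 0 = 0`, and one at `N`. The latter tends to 0. -/
lemma sum_one_sub_meanSign (N : ℕ) (t : ℝ) :
    ∑ x ∈ Finset.range N, (1 - meanSign t (x + 1)) / 2 =
      ∫ s in (0 : ℝ)..t, (meanSign s 1 - (meanSign s (N + 1) - meanSign s N)) := by
  have hd : ∀ s, HasDerivAt (fun t => ∑ x ∈ Finset.range N, (1 - meanSign t (x + 1)) / 2)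
      (meanSign s 1 - (meanSign s (N + 1) - meanSign s N)) s := fun s => by
    have h := HasDerivAt.fun_sum (u := Finset.range N) fun x _ =>
      ((hasDerivAt_meanSign ((x : ℤ) + 1) s).const_sub 1).div_const 2
    refine h.congr_deriv ?_
    induction N with
    | zero => simp [meanSign_zero_right]
    | succ N ih =>
      rw [Finset.sum_range_succ, ih (HasDerivAt.fun_sum (u := Finset.range N) fun x _ =>
        ((hasDerivAt_meanSign ((x : ℤ) + 1) s).const_sub 1).div_const 2), walkGenerator_four]
      push_cast
      rw [add_sub_cancel_right]
      ring
  have hc : Continuous fun s => meanSign s 1 - (meanSign s (N + 1) - meanSign s N) :=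
    (continuous_meanSign _).sub ((continuous_meanSign _).sub (continuous_meanSign _))
  rw [intervalIntegral.integral_eq_sub_of_hasDerivAt (fun s _ => hd s) (hc.intervalIntegrable _ _)]
  have h0 : ∑ x ∈ Finset.range N, (1 - meanSign 0 ((x : ℤ) + 1)) / 2 = 0 :=
    Finset.sum_eq_zero fun x _ => by
      rw [meanSign_zero_left, signFn_of_pos (by positivity)]
      norm_num
  rw [h0, sub_zero]

lemma hasSum_one_sub_meanSign (hW : IsMarkovChain (walkGenerator 4) 0 W μ) {t : ℝ} (ht : 0 < t) :
    HasSum (fun x : ℕ => (1 - meanSign t (x + 1)) / 2) (limitProfile t) := by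
  rw [hasSum_iff_tendsto_nat_of_nonneg]
  · simp only [sum_one_sub_meanSign]
    refine intervalIntegral.tendsto_integral_filter_of_dominated_convergence
      (fun _ => 3 * Real.exp (t * 8)) (Eventually.of_forall fun N => ?_)
      (Eventually.of_forall fun N => ae_of_all _ fun s hs => ?_) (by simp)
      (ae_of_all _ fun s _ => ?_)
    · exact ((continuous_meanSign _).sub ((continuous_meanSign _).sub
        (continuous_meanSign _))).aestronglyMeasurable
    · rw [Set.uIoc_of_le ht.le] at hs
      have h : ∀ x, |meanSign s x| ≤ Real.exp (t * 8) := fun x =>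
        (abs_meanSign_le s x).trans (Real.exp_le_exp.2 (by
          rw [abs_of_pos hs.1]
          linarith [hs.2]))
      have h1 := abs_le.1 (h 1)
      have h2 := abs_le.1 (h (N + 1))
      have h3 := abs_le.1 (h N)
      rw [Real.norm_eq_abs, abs_le]
      constructor <;> linarith
    · have h1 := tendsto_meanSign_atTop s
      have h2 := h1.comp (tendsto_add_atTop_nat 1)
      have h3 := (h2.sub h1).const_sub (meanSign s 1)
      simpa using h3
  · intro x
    have := meanSign_le_one hW (x + 1) ht
    push_cast at this
    linarith

lemma hasDerivAt_limitProfile (t : ℝ) : HasDerivAt limitProfile (meanSign t 1) t :=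
  intervalIntegral.integral_hasDerivAt_right ((continuous_meanSign 1).intervalIntegrable _ _)
    (continuous_meanSign 1).stronglyMeasurable.stronglyMeasurableAtFilter
    (continuous_meanSign 1).continuousAt

lemma contDiff_limitProfile : ContDiff ℝ (⊤ : ℕ∞) limitProfile := by
  refine contDiff_infty_iff_deriv.2
    ⟨fun t => (hasDerivAt_limitProfile t).differentiableAt, ?_⟩
  rw [show deriv limitProfile = fun t => meanSign t 1 from
    funext fun t => (hasDerivAt_limitProfile t).deriv]
  exact contDiff_meanSign 1

/-- These Taylor coefficients are the ones to be matched with those of the mean number of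
inversions. -/
lemma hasSum_limitProfile (t : ℝ) :
    HasSum (fun k : ℕ => t ^ (k + 1) / ((k + 1).factorial : ℝ) * (walkGenerator 4)^[k] signFn 1)
      (limitProfile t) := by
  have h := intervalIntegral.hasSum_integral_of_dominated_convergence (a := 0) (b := t)
    (μ := volume)
    (F := fun (k : ℕ) (s : ℝ) => s ^ k / (k.factorial : ℝ) * (walkGenerator 4)^[k] signFn 1)
    (f := fun s => meanSign s 1) (fun (k : ℕ) _ => (|t| * 8) ^ k / (k.factorial : ℝ))
    (fun k => (by fun_prop : Continuous fun s : ℝ => s ^ k / (k.factorial : ℝ) *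
      (walkGenerator 4)^[k] signFn 1).aestronglyMeasurable)
    (fun k => ae_of_all _ fun s hs => (abs_meanSign_term_le s 1 k).trans ?_)
    (ae_of_all _ fun _ _ => Real.summable_pow_div_factorial _) (by simp)
    (ae_of_all _ fun s _ => hasSum_meanSign s 1)
  · refine h.congr_fun fun k => ?_
    rw [intervalIntegral.integral_mul_const, intervalIntegral.integral_div, integral_pow,
      Nat.factorial_succ]
    push_cast
    simp only [ne_eq, add_eq_zero, one_ne_zero, and_false, not_false_eq_true, zero_pow, sub_zero]
    field_simp
  · have : |s| ≤ |t| := by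
      have := Set.abs_sub_left_of_mem_uIcc (Set.uIoc_subset_uIcc hs)
      simpa using this
    gcongr

lemma limitFn_eq (hW : IsMarkovChain (walkGenerator 4) 0 W μ) {p : ℝ≥0 → ℝ}
    (hp : ∀ u : ℝ≥0, p u = exchangeFn u) {t : ℝ} (ht : 0 < t) :
    limitFn W μ p t = limitProfile t := by
  rw [limitFn, ← (hasSum_one_sub_meanSign hW ht).tsum_eq]
  refine tsum_congr fun x => ?_
  simp only [hp]
  exact integral_hittingLaw hW x ht

end LimitFunction

end Stirring

namespace Stirring

/-! ### Large-time asymptotics by Fourier inversion. -/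

section Fourier

open Real

/-- Fourier coefficients of the powers of the symbol of the rate-four walk. -/
noncomputable def symbolCoeff (k : ℕ) (x : ℤ) : ℝ :=
  ∫ θ in -π..π, (-4 * (1 - cos θ)) ^ k * cos (x * θ)

lemma symbolCoeff_zero (x : ℤ) : symbolCoeff 0 x = if x = 0 then 2 * π else 0 := by
  simp only [symbolCoeff, pow_zero, one_mul]
  split_ifs with h
  · subst h
    simp
    ring
  · have hx : (x : ℝ) ≠ 0 := by exact_mod_cast h
    rw [intervalIntegral.integral_comp_mul_left (fun y => cos y) hx, integral_cos, mul_neg, sin_neg,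
      sin_int_mul_pi]
    simp

/-- In the variable `x` the generator multiplies `cos (x * θ)` by its symbol `-4 * (1 - cos θ)`. -/
lemma symbolCoeff_succ (k : ℕ) (x : ℤ) :
    symbolCoeff (k + 1) x = walkGenerator 4 (symbolCoeff k) x := by
  have hc : ∀ y : ℤ, IntervalIntegrable
      (fun θ => (-4 * (1 - cos θ)) ^ k * cos (y * θ)) volume (-π) π := fun y =>
    (by fun_prop : Continuous fun θ : ℝ => (-4 * (1 - cos θ)) ^ k * cos (y * θ)).intervalIntegrable
      _ _
  rw [walkGenerator_four]
  simp only [symbolCoeff]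
  rw [← intervalIntegral.integral_sub (hc _) (hc _), ← intervalIntegral.integral_sub (hc _) (hc _),
    ← intervalIntegral.integral_const_mul, ← intervalIntegral.integral_const_mul,
    ← intervalIntegral.integral_add (((hc _).sub (hc _)).const_mul _)
      (((hc _).sub (hc _)).const_mul _)]
  refine intervalIntegral.integral_congr fun θ _ => ?_
  push_cast
  rw [add_mul, sub_mul, one_mul, cos_add, cos_sub]
  ring

/-- The sign is not summable, but its first difference is the sum of the point masses at 0 and 1,
whose Fourier coefficients are explicit. -/
lemma walkGenerator_iterate_signFn_sub (k : ℕ) (x : ℤ) :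
    2 * π * ((walkGenerator 4)^[k] signFn x - (walkGenerator 4)^[k] signFn (x - 1)) =
      symbolCoeff k x + symbolCoeff k (x - 1) := by
  induction k generalizing x with
  | zero =>
    rw [symbolCoeff_zero, symbolCoeff_zero]
    simp only [Function.iterate_zero, id]
    rcases lt_trichotomy x 0 with h | rfl | h
    · rw [signFn_of_neg h, signFn_of_neg (by omega), if_neg h.ne, if_neg (by omega)]; ring
    · norm_num [signFn_of_neg]
    · rcases eq_or_ne x 1 with rfl | h'
      · norm_num [signFn_of_pos]
      · rw [signFn_of_pos h, signFn_of_pos (by omega), if_neg h.ne', if_neg (by omega)]; ring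
  | succ k ih =>
    rw [Function.iterate_succ_apply', symbolCoeff_succ, symbolCoeff_succ]
    simp only [walkGenerator_four]
    have h1 := ih x
    have h2 := ih (x + 1)
    have h3 := ih (x - 1)
    rw [add_sub_cancel_right] at h2
    rw [sub_add_cancel]
    linear_combination (-4) * h1 + 2 * h2 + 2 * h3

lemma walkGenerator_iterate_signFn_one (k : ℕ) :
    2 * π * (walkGenerator 4)^[k] signFn 1 =
      ∫ θ in -π..π, (-4 * (1 - cos θ)) ^ k * (1 + cos θ) := by
  have h0 : (walkGenerator 4)^[k] signFn 0 = 0 := by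
    have := walkGenerator_iterate_neg signFn_neg k 0
    rw [neg_zero] at this
    linarith
  have h := walkGenerator_iterate_signFn_sub k 1
  rw [sub_self, h0, sub_zero] at h
  rw [h, symbolCoeff, symbolCoeff, ← intervalIntegral.integral_add]
  · refine intervalIntegral.integral_congr fun θ _ => ?_
    simp
    ring
  all_goals exact Continuous.intervalIntegrable (by fun_prop) _ _

lemma meanSign_one_eq_integral (t : ℝ) :
    meanSign t 1 = 1 / (2 * π) * ∫ θ in -π..π, exp (-4 * (1 - cos θ) * t) * (1 + cos θ) := by
  have h := intervalIntegral.hasSum_integral_of_dominated_convergence (a := -π) (b := π)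
    (μ := volume)
    (F := fun (k : ℕ) (θ : ℝ) => (-4 * (1 - cos θ) * t) ^ k / (k.factorial : ℝ) * (1 + cos θ))
    (f := fun θ => exp (-4 * (1 - cos θ) * t) * (1 + cos θ))
    (fun (k : ℕ) _ => (8 * |t|) ^ k / (k.factorial : ℝ) * 2)
    (fun k => (by fun_prop : Continuous fun θ : ℝ =>
      (-4 * (1 - cos θ) * t) ^ k / (k.factorial : ℝ) * (1 + cos θ)).aestronglyMeasurable)
    (fun k => ae_of_all _ fun θ _ => ?_)
    (ae_of_all _ fun _ _ => (Real.summable_pow_div_factorial _).mul_right 2) (by simp)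
    (ae_of_all _ fun θ _ => ?_)
  · have h2 := (hasSum_meanSign t 1).mul_left (2 * π)
    have h3 : 2 * π * meanSign t 1 =
        ∫ θ in -π..π, exp (-4 * (1 - cos θ) * t) * (1 + cos θ) := by
      refine h2.unique (h.congr_fun fun k => ?_)
      rw [mul_left_comm, walkGenerator_iterate_signFn_one, ← intervalIntegral.integral_const_mul]
      refine intervalIntegral.integral_congr fun θ _ => ?_
      simp only [mul_pow]
      ring
    rw [← h3]
    field_simp
  · have h1 := neg_one_le_cos θ
    have h2 := cos_le_one θ
    rw [norm_mul, norm_div, norm_pow, Real.norm_natCast, Real.norm_eq_abs, Real.norm_eq_abs]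
    gcongr
    · rw [abs_mul]
      gcongr
      rw [abs_le]
      constructor <;> linarith
    · rw [abs_le]
      constructor <;> linarith
  · rw [Real.exp_eq_exp_ℝ]
    exact (NormedSpace.exp_series_hasSum_exp' (𝕂 := ℝ) (-4 * (1 - cos θ) * t)).congr_fun
      (fun k => by rw [smul_eq_mul, div_eq_inv_mul]) |>.mul_right _

/-- The rescaled integrand in the Fourier representation. -/
noncomputable def scaledKernel (t φ : ℝ) : ℝ :=
  (Set.Ioc (-(π * √t)) (π * √t)).indicator
    (fun φ => exp (-4 * (1 - cos (φ / √t)) * t) * (1 + cos (φ / √t))) φ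

lemma sqrt_mul_meanSign_one {t : ℝ} (ht : 0 < t) :
    √t * meanSign t 1 = 1 / (2 * π) * ∫ φ, scaledKernel t φ := by
  have hs : √t ≠ 0 := (sqrt_pos.2 ht).ne'
  have h := intervalIntegral.integral_comp_div (a := -(π * √t)) (b := π * √t)
    (fun θ => exp (-4 * (1 - cos θ) * t) * (1 + cos θ)) hs
  rw [neg_div, mul_div_cancel_right₀ _ hs, smul_eq_mul,
    intervalIntegral.integral_of_le (by linarith [mul_pos pi_pos (sqrt_pos.2 ht)])] at h
  rw [meanSign_one_eq_integral, mul_left_comm, ← h, ← integral_indicator measurableSet_Ioc]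
  rfl

lemma scaledKernel_le {t : ℝ} (ht : 0 < t) (φ : ℝ) :
    ‖scaledKernel t φ‖ ≤ 2 * exp (-(8 / π ^ 2) * φ ^ 2) := by
  rw [scaledKernel, Set.indicator_apply]
  split_ifs with h
  · have hs : 0 < √t := sqrt_pos.2 ht
    have h1 := neg_one_le_cos (φ / √t)
    have h2 := cos_le_one (φ / √t)
    have h3 : |φ / √t| ≤ π := by
      rw [abs_div, abs_of_pos hs, div_le_iff₀ hs, abs_le]
      exact ⟨h.1.le, h.2⟩
    -- On `|y| ≤ π` one has `1 - cos y ≥ 2 / π ^ 2 * y ^ 2`; the factor 4 of the symbol gives `8 / π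
    -- ^ 2`.
    have h4 := cos_le_one_sub_mul_cos_sq h3
    rw [norm_mul, Real.norm_eq_abs, Real.norm_eq_abs, abs_of_pos (exp_pos _), mul_comm]
    refine mul_le_mul ?_ (exp_le_exp.2 ?_) (exp_pos _).le (by norm_num)
    · rw [abs_le]
      constructor <;> linarith
    · rw [div_pow, sq_sqrt ht.le] at h4
      have h5 : 2 / π ^ 2 * (φ ^ 2 / t) * t = 2 / π ^ 2 * φ ^ 2 := by field_simp
      have h6 : 2 / π ^ 2 * (φ ^ 2 / t) * t ≤ (1 - cos (φ / √t)) * t :=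
        mul_le_mul_of_nonneg_right (by linarith) ht.le
      have h7 : 8 / π ^ 2 * φ ^ 2 = 4 * (2 / π ^ 2 * φ ^ 2) := by ring
      linarith
  · simp only [norm_zero]
    positivity

lemma tendsto_scaledKernel (φ : ℝ) :
    Tendsto (fun t => scaledKernel t φ) atTop (𝓝 (2 * exp (-2 * φ ^ 2))) := by
  have hs : Tendsto (fun t : ℝ => φ / √t) atTop (𝓝 0) :=
    tendsto_const_nhds.div_atTop tendsto_sqrt_atTop
  -- With `y = φ / √t`, the identity `1 - cos y = y ^ 2 / 2 * sinc (y / 2) ^ 2` turns the exponent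
  -- into `-2 * φ ^ 2 * sinc (y / 2) ^ 2`, and the limit is plain continuity at `y = 0`.
  have h1 : Tendsto (fun t : ℝ => exp (-2 * φ ^ 2 * sinc (φ / √t / 2) ^ 2) * (1 + cos (φ / √t)))
      atTop (𝓝 (exp (-2 * φ ^ 2 * sinc (0 / 2) ^ 2) * (1 + cos 0))) := by
    have hc : Continuous fun y : ℝ => exp (-2 * φ ^ 2 * sinc (y / 2) ^ 2) * (1 + cos y) := by
      have := continuous_sinc
      fun_prop
    exact (hc.tendsto 0).comp hs
  have h2 : exp (-2 * φ ^ 2 * sinc (0 / 2) ^ 2) * (1 + cos 0) = 2 * exp (-2 * φ ^ 2) := by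
    rw [zero_div, sinc_zero, cos_zero]
    ring_nf
  rw [h2] at h1
  refine h1.congr' ?_
  filter_upwards [eventually_gt_atTop 0,
    tendsto_sqrt_atTop.eventually (eventually_gt_atTop (|φ| / π))] with t ht hφ
  have hs0 : 0 < √t := sqrt_pos.2 ht
  rw [div_lt_iff₀ pi_pos, mul_comm] at hφ
  rw [scaledKernel, Set.indicator_of_mem
    (show φ ∈ Set.Ioc (-(π * √t)) (π * √t) from ⟨(abs_lt.1 hφ).1, (abs_lt.1 hφ).2.le⟩)]
  congr 2
  set y := φ / √t with hy
  have h3 : 1 - cos y = 2 * sin (y / 2) ^ 2 := by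
    rw [sin_sq_eq_half_sub]
    ring_nf
  have h4 : sin (y / 2) = y / 2 * sinc (y / 2) := by
    rcases eq_or_ne (y / 2) 0 with h | h
    · simp [h]
    · rw [sinc_of_ne_zero h, mul_div_cancel₀ _ h]
  have h5 : φ ^ 2 = y ^ 2 * t := by
    rw [hy, div_pow, sq_sqrt ht.le]
    field_simp
  rw [h3, h4, h5]
  ring

lemma integrable_scaledKernel_bound :
    Integrable fun φ : ℝ => 2 * exp (-(8 / π ^ 2) * φ ^ 2) :=
  (integrable_exp_neg_mul_sq (by positivity)).const_mul 2

lemma tendsto_sqrt_mul_meanSign_one :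
    Tendsto (fun t => √t * meanSign t 1) atTop (𝓝 (1 / √(2 * π))) := by
  have hmeas : ∀ t, AEStronglyMeasurable (scaledKernel t) volume := fun t => by
    refine (Continuous.aestronglyMeasurable ?_).indicator measurableSet_Ioc
    fun_prop
  have h := tendsto_integral_filter_of_dominated_convergence (l := atTop) (μ := volume)
    (F := scaledKernel) _ (Eventually.of_forall hmeas)
    ((eventually_gt_atTop 0).mono fun t ht => ae_of_all _ (scaledKernel_le ht))
    integrable_scaledKernel_bound (ae_of_all _ tendsto_scaledKernel)
  have h2 := h.const_mul (1 / (2 * π))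
  have h3 : 1 / (2 * π) * ∫ φ, 2 * exp (-2 * φ ^ 2) = 1 / √(2 * π) := by
    rw [integral_const_mul, integral_gaussian]
    have e1 : √(π / 2) = √(2 * π) / 2 := by
      rw [show π / 2 = (2 * π) / 2 ^ 2 by ring, sqrt_div (by positivity), sqrt_sq (by norm_num)]
    have e2 : √(2 * π) * √(2 * π) = 2 * π := mul_self_sqrt (by positivity)
    have e3 : √(2 * π) ≠ 0 := (sqrt_pos.2 (by positivity)).ne'
    rw [e1, eq_div_iff e3, show 1 / (2 * π) * (2 * (√(2 * π) / 2)) * √(2 * π) =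
      √(2 * π) * √(2 * π) / (2 * π) by ring, e2, div_self (by positivity)]
  rw [h3] at h2
  refine h2.congr' ?_
  filter_upwards [eventually_gt_atTop 0] with t ht
  rw [sqrt_mul_meanSign_one ht]

lemma exists_sqrt_mul_meanSign_one_le :
    ∃ C, ∀ t, 0 < t → |√t * meanSign t 1| ≤ C := by
  refine ⟨1 / (2 * π) * ∫ φ, 2 * exp (-(8 / π ^ 2) * φ ^ 2), fun t ht => ?_⟩
  rw [sqrt_mul_meanSign_one ht, abs_mul, abs_of_pos (show 0 < 1 / (2 * π) by positivity),
    ← Real.norm_eq_abs (∫ φ, _)]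
  exact mul_le_mul_of_nonneg_left (norm_integral_le_of_norm_le integrable_scaledKernel_bound
    (ae_of_all _ (scaledKernel_le ht))) (by positivity)

theorem tendsto_limitProfile_div_sqrt :
    Tendsto (fun t => limitProfile t / √t) atTop (𝓝 √(2 / π)) := by
  obtain ⟨C, hC⟩ := exists_sqrt_mul_meanSign_one_le
  have hrep : ∀ t, 0 < t →
      limitProfile t / √t = ∫ u in (0 : ℝ)..1, √t * meanSign (t * u) 1 := fun t ht => by
    have h := intervalIntegral.integral_comp_mul_left (a := 0) (b := 1)
      (fun s => meanSign s 1) ht.ne'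
    rw [mul_zero, mul_one, smul_eq_mul] at h
    rw [intervalIntegral.integral_const_mul, h, limitProfile]
    have : t = √t * √t := (mul_self_sqrt ht.le).symm
    have hs0 : √t ≠ 0 := (sqrt_pos.2 ht).ne'
    rw [div_eq_iff hs0]
    field_simp
    rw [sq_sqrt ht.le]
  -- A factor bounded uniformly in `t` and `u` times the integrable singularity `u ^ (-1/2)`, whose
  -- integral over the unit interval is 2.
  have hfac : ∀ t u : ℝ, 0 < t → 0 < u →
      √t * meanSign (t * u) 1 = √(t * u) * meanSign (t * u) 1 * u ^ (-(1 / 2) : ℝ) := by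
    intro t u ht hu
    rw [rpow_neg hu.le, ← sqrt_eq_rpow, sqrt_mul ht.le]
    have := (sqrt_pos.2 hu).ne'
    field_simp
  have hlim := intervalIntegral.tendsto_integral_filter_of_dominated_convergence (l := atTop)
    (a := 0) (b := 1) (μ := volume) (F := fun t u => √t * meanSign (t * u) 1)
    (f := fun u => 1 / √(2 * π) * u ^ (-(1 / 2) : ℝ))
    (fun u => C * u ^ (-(1 / 2) : ℝ))
    (Eventually.of_forall fun t => (continuous_const.mul ((continuous_meanSign 1).comp
      (continuous_const.mul continuous_id))).aestronglyMeasurable)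
    ((eventually_gt_atTop 0).mono fun t ht => ae_of_all _ fun u hu => ?_)
    ((intervalIntegral.intervalIntegrable_rpow' (by norm_num)).const_mul C)
    (ae_of_all _ fun u hu => ?_)
  · have hval : ∫ u in (0 : ℝ)..1, 1 / √(2 * π) * u ^ (-(1 / 2) : ℝ) = √(2 / π) := by
      rw [intervalIntegral.integral_const_mul, integral_rpow (Or.inl (by norm_num))]
      have e1 : √(2 / π) = 2 / √(2 * π) := by
        rw [show 2 / π = 2 ^ 2 / (2 * π) by field_simp, sqrt_div (by positivity),
          sqrt_sq (by norm_num)]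
      rw [e1]
      norm_num
      ring
    rw [hval] at hlim
    refine hlim.congr' ?_
    filter_upwards [eventually_gt_atTop 0] with t ht
    rw [hrep t ht]
  · rw [Set.uIoc_of_le zero_le_one] at hu
    rw [hfac t u ht hu.1, norm_mul, Real.norm_eq_abs, Real.norm_eq_abs,
      abs_of_pos (rpow_pos_of_pos hu.1 _)]
    exact mul_le_mul_of_nonneg_right (hC _ (mul_pos ht hu.1)) (rpow_pos_of_pos hu.1 _).le
  · rw [Set.uIoc_of_le zero_le_one] at hu
    have h1 : Tendsto (fun t : ℝ => t * u) atTop atTop := tendsto_id.atTop_mul_const hu.1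
    refine ((tendsto_sqrt_mul_meanSign_one.comp h1).mul_const _).congr' ?_
    filter_upwards [eventually_gt_atTop 0] with t ht
    exact (hfac t u ht hu.1).symm

end Fourier

end Stirring

namespace Stirring

/-! ### Maxima of partial sums and Spitzer's identity. -/

section WalkMax

/-- The maximum of the partial sums `0, x 0, x 0 + x 1, …` with at most `n` terms. -/
def walkMax : ℕ → (ℕ → ℝ) → ℝ
  | 0, _ => 0
  | n + 1, x => max 0 (x 0 + walkMax n fun i => x (i + 1))

lemma sum_le_walkMax (n : ℕ) (x : ℕ → ℝ) {k : ℕ} (hk : k ≤ n) :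
    ∑ i ∈ Finset.range k, x i ≤ walkMax n x := by
  induction n generalizing x k with
  | zero =>
    obtain rfl : k = 0 := by omega
    simp [walkMax]
  | succ n ih =>
    rw [walkMax]
    cases k with
    | zero => simp
    | succ k =>
      rw [Finset.sum_range_succ', add_comm]
      exact le_max_of_le_right (add_le_add le_rfl (ih (fun i => x (i + 1)) (by omega)))

lemma exists_walkMax_eq (n : ℕ) (x : ℕ → ℝ) :
    ∃ k ≤ n, walkMax n x = ∑ i ∈ Finset.range k, x i := by
  induction n generalizing x with
  | zero => exact ⟨0, le_rfl, by simp [walkMax]⟩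
  | succ n ih =>
    rw [walkMax]
    rcases le_total (x 0 + walkMax n fun i => x (i + 1)) 0 with h | h
    · exact ⟨0, by omega, by rw [max_eq_left h]; simp⟩
    · obtain ⟨k, hk, he⟩ := ih fun i => x (i + 1)
      exact ⟨k + 1, by omega, by rw [max_eq_right h, he, Finset.sum_range_succ', add_comm]⟩

lemma walkMax_nonneg (n : ℕ) (x : ℕ → ℝ) : 0 ≤ walkMax n x := by
  simpa using sum_le_walkMax n x (Nat.zero_le n)

lemma walkMax_le (n : ℕ) (x : ℕ → ℝ) : walkMax n x ≤ ∑ i ∈ Finset.range n, |x i| := by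
  obtain ⟨k, hk, h⟩ := exists_walkMax_eq n x
  rw [h]
  exact (Finset.sum_le_sum fun i _ => le_abs_self _).trans
    (Finset.sum_le_sum_of_subset_of_nonneg (Finset.range_subset_range.2 hk)
      fun _ _ _ => abs_nonneg _)

lemma walkMax_congr {n : ℕ} {x y : ℕ → ℝ} (h : ∀ i < n, x i = y i) : walkMax n x = walkMax n y := by
  induction n generalizing x y with
  | zero => rfl
  | succ n ih =>
    rw [walkMax, walkMax, h 0 (by omega), ih fun i hi => h (i + 1) (by omega)]

/-- A positive total makes the empty sum irrelevant to the maximum; a nonpositive total is itself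
irrelevant. This dichotomy drives the recursion for the mean. -/
lemma walkMax_succ_of_pos {n : ℕ} {x : ℕ → ℝ} (h : 0 < ∑ i ∈ Finset.range (n + 1), x i) :
    walkMax (n + 1) x = x 0 + walkMax n fun i => x (i + 1) := by
  rw [walkMax, max_eq_right]
  rw [Finset.sum_range_succ', add_comm] at h
  exact h.le.trans (add_le_add le_rfl (sum_le_walkMax n (fun i => x (i + 1)) le_rfl))

lemma walkMax_succ_of_nonpos {n : ℕ} {x : ℕ → ℝ} (h : ∑ i ∈ Finset.range (n + 1), x i ≤ 0) :
    walkMax (n + 1) x = walkMax n x := by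
  apply le_antisymm
  · obtain ⟨k, hk, he⟩ := exists_walkMax_eq (n + 1) x
    rcases Nat.lt_or_ge n k with h' | h'
    · obtain rfl : k = n + 1 := by omega
      rw [he]
      exact h.trans (walkMax_nonneg n x)
    · rw [he]
      exact sum_le_walkMax n x h'
  · obtain ⟨k, hk, he⟩ := exists_walkMax_eq n x
    rw [he]
    exact sum_le_walkMax (n + 1) x (by omega)

lemma measurable_walkMax (n : ℕ) : Measurable (walkMax n) := by
  induction n with
  | zero => exact measurable_const
  | succ n ih =>
    exact measurable_const.max ((measurable_pi_apply 0).add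
      (ih.comp (measurable_pi_lambda _ fun i => measurable_pi_apply (i + 1))))

/-- Extension of a finite sequence by zero. -/
def extendZero {n : ℕ} (y : Fin n → ℝ) (i : ℕ) : ℝ := if h : i < n then y ⟨i, h⟩ else 0

lemma measurable_extendZero {n : ℕ} : Measurable (extendZero (n := n)) := by
  refine measurable_pi_lambda _ fun i => ?_
  unfold extendZero
  split_ifs with h
  · exact measurable_pi_apply _
  · exact measurable_const

end WalkMax

section Spitzer

variable {Ω : Type*} [MeasurableSpace Ω] {Q : Measure Ω} {ξ : ℕ → Ω → ℝ} {γ : Measure ℝ}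

/-- Independent identically distributed variables are exchangeable. -/
lemma integral_comp_perm [IsProbabilityMeasure Q] (hind : iIndepFun ξ Q)
    (hlaw : ∀ i, HasLaw (ξ i) γ Q) {n : ℕ} (π : Equiv.Perm (Fin n)) {Φ : (Fin n → ℝ) → ℝ}
    (hΦ : Measurable Φ) :
    ∫ ω, Φ (fun i => ξ i ω) ∂Q = ∫ ω, Φ (fun i => ξ (π i) ω) ∂Q := by
  have h : ∀ π : Equiv.Perm (Fin n),
      Measure.map (fun ω (i : Fin n) => ξ (π i) ω) Q = Measure.pi fun _ => γ := fun π => by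
    have hinj : Function.Injective fun i : Fin n => ((π i : Fin n) : ℕ) :=
      Fin.val_injective.comp π.injective
    rw [(iIndepFun_iff_map_fun_eq_pi_map fun i => (hlaw _).aemeasurable).1 (hind.precomp hinj)]
    simp only [(hlaw _).map_eq]
  have hm : ∀ π : Equiv.Perm (Fin n), AEMeasurable (fun ω (i : Fin n) => ξ (π i) ω) Q :=
    fun π => aemeasurable_pi_lambda _ fun i => (hlaw _).aemeasurable
  refine (integral_map (hm 1) hΦ.aestronglyMeasurable).symm.trans ?_
  rw [h 1, ← h π, integral_map (hm π) hΦ.aestronglyMeasurable]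

/-- The recursion behind Spitzer's identity for the expected maximum of a random walk. -/
lemma integral_walkMax_succ [IsProbabilityMeasure Q] (hind : iIndepFun ξ Q)
    (hlaw : ∀ i, HasLaw (ξ i) γ Q) (hint : ∀ i, Integrable (ξ i) Q) (n : ℕ) :
    ∫ ω, walkMax (n + 1) (fun i => ξ i ω) ∂Q = ∫ ω, walkMax n (fun i => ξ i ω) ∂Q +
      (∫ ω, max (∑ i ∈ Finset.range (n + 1), ξ i ω) 0 ∂Q) / (n + 1) := by
  have hm : ∀ i, AEMeasurable (ξ i) Q := fun i => (hlaw i).aemeasurable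
  have hsumabs : ∀ (k : ℕ) (f : ℕ → ℕ), Integrable (fun ω => ∑ i ∈ Finset.range k, |ξ (f i) ω|) Q :=
    fun k f => integrable_finsetSum _ fun i _ => (hint (f i)).abs
  have hM : ∀ f : ℕ → ℕ, Integrable (fun ω => walkMax n fun i => ξ (f i) ω) Q := fun f => by
    refine (hsumabs n f).mono' ((measurable_walkMax n).comp_aemeasurable
      (aemeasurable_pi_lambda _ fun i => hm (f i))).aestronglyMeasurable (ae_of_all _ fun ω => ?_)
    rw [Real.norm_eq_abs, abs_of_nonneg (walkMax_nonneg _ _)]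
    exact walkMax_le n _
  set S : Ω → ℝ := fun ω => ∑ i ∈ Finset.range (n + 1), ξ i ω with hS
  have hSm : AEMeasurable S Q := Finset.aemeasurable_fun_sum _ fun i _ => hm i
  have hpos : NullMeasurableSet {ω | 0 < S ω} Q := nullMeasurableSet_lt aemeasurable_const hSm
  have hind' : ∀ f : Ω → ℝ, Integrable f Q → Integrable (fun ω => if 0 < S ω then f ω else 0) Q :=
    fun f hf => by
      have := hf.indicator₀ hpos
      refine this.congr (ae_of_all _ fun ω => ?_)
      simp only [Set.indicator_apply, Set.mem_ofPred_eq]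
  -- On `0 < S` the maximum is the first step plus the maximum of the shifted walk; otherwise it is
  -- the maximum over `n` steps.
  have hdec : ∀ ω, walkMax (n + 1) (fun i => ξ i ω) =
      (if 0 < S ω then ξ 0 ω else 0) +
        ((if 0 < S ω then walkMax n (fun i => ξ (i + 1) ω) else 0) +
          (walkMax n (fun i => ξ i ω) - if 0 < S ω then walkMax n (fun i => ξ i ω) else 0)) := by
    intro ω
    by_cases h : 0 < S ω
    · rw [walkMax_succ_of_pos h, if_pos h, if_pos h, if_pos h]
      ring
    · rw [walkMax_succ_of_nonpos (not_lt.1 h), if_neg h, if_neg h, if_neg h]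
      ring
  -- Cyclic rotation of the `n + 1` steps preserves `S` and the joint law, so the shifted and the
  -- unshifted maximum cancel in the mean.
  have hrot : ∫ ω, (if 0 < S ω then walkMax n (fun i => ξ i ω) else 0) ∂Q =
      ∫ ω, (if 0 < S ω then walkMax n (fun i => ξ (i + 1) ω) else 0) ∂Q := by
    have h := integral_comp_perm hind hlaw (finRotate (n + 1))
      (Φ := fun y => if 0 < ∑ i, y i then walkMax n (extendZero y) else 0)
      (Measurable.ite (measurableSet_lt measurable_const
        (Finset.measurable_fun_sum _ fun i _ => measurable_pi_apply i))
        ((measurable_walkMax n).comp measurable_extendZero) measurable_const)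
    have h1 : ∀ ω, ∑ i : Fin (n + 1), ξ i ω = S ω := fun ω =>
      (Finset.sum_range fun i => ξ i ω).symm
    have h2 : ∀ ω, ∑ i : Fin (n + 1), ξ (finRotate (n + 1) i) ω = S ω := fun ω => by
      rw [← h1]
      exact Equiv.sum_comp (finRotate (n + 1)) fun i : Fin (n + 1) => ξ i ω
    simp only [h1, h2] at h
    refine Eq.trans (integral_congr_ae (ae_of_all _ fun ω => ?_))
      (h.trans (integral_congr_ae (ae_of_all _ fun ω => ?_)))
    · simp only
      congr 1
      exact walkMax_congr fun i hi => by rw [extendZero, dif_pos (by omega)]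
    · simp only
      congr 1
      refine walkMax_congr fun i hi => ?_
      rw [extendZero, dif_pos (by omega)]
      congr 1
      rw [finRotate_of_lt hi]
  -- By exchangeability every step has the same mean on `0 < S`, and together the steps add up to
  -- the positive part of `S`.
  have hfirst : (∫ ω, (if 0 < S ω then ξ 0 ω else 0) ∂Q) = (∫ ω, max (S ω) 0 ∂Q) / (n + 1) := by
    have hi : ∀ i ∈ Finset.range (n + 1), ∫ ω, (if 0 < S ω then ξ i ω else 0) ∂Q =
        ∫ ω, (if 0 < S ω then ξ 0 ω else 0) ∂Q := fun i hi => by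
      let j : Fin (n + 1) := ⟨i, Finset.mem_range.1 hi⟩
      have h := integral_comp_perm hind hlaw (Equiv.swap 0 j)
        (Φ := fun y => if 0 < ∑ i, y i then y 0 else 0)
        (Measurable.ite (measurableSet_lt measurable_const
          (Finset.measurable_fun_sum _ fun i _ => measurable_pi_apply i))
          (measurable_pi_apply 0) measurable_const)
      have h1 : ∀ ω, ∑ i : Fin (n + 1), ξ i ω = S ω := fun ω =>
        (Finset.sum_range fun i => ξ i ω).symm
      have h2 : ∀ ω, ∑ i : Fin (n + 1), ξ (Equiv.swap 0 j i) ω = S ω := fun ω => by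
        rw [← h1]
        exact Equiv.sum_comp (Equiv.swap 0 j) fun i : Fin (n + 1) => ξ i ω
      simp only [h1, h2, Equiv.swap_apply_left] at h
      exact h.symm
    have hsum : ∫ ω, max (S ω) 0 ∂Q =
        ∑ i ∈ Finset.range (n + 1), ∫ ω, (if 0 < S ω then ξ i ω else 0) ∂Q := by
      rw [← integral_finsetSum _ fun i _ => hind' _ (hint i)]
      refine integral_congr_ae (ae_of_all _ fun ω => ?_)
      simp only
      split_ifs with h
      · rw [max_eq_left h.le]
      · rw [max_eq_right (not_lt.1 h), Finset.sum_const_zero]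
    rw [hsum, Finset.sum_congr rfl hi, Finset.sum_const, Finset.card_range, nsmul_eq_mul]
    push_cast
    rw [mul_div_cancel_left₀]
    positivity
  have hM0 := hM id
  have hM1 := hM (· + 1)
  simp only [id] at hM0
  simp only [hdec]
  have hsub : Integrable (fun ω => walkMax n (fun i => ξ i ω) -
      if 0 < S ω then walkMax n (fun i => ξ i ω) else 0) Q := hM0.sub (hind' _ hM0)
  have hadd : Integrable (fun ω => (if 0 < S ω then walkMax n (fun i => ξ (i + 1) ω) else 0) +
      (walkMax n (fun i => ξ i ω) - if 0 < S ω then walkMax n (fun i => ξ i ω) else 0)) Q :=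
    (hind' _ hM1).add hsub
  rw [integral_add (hind' _ (hint 0)) hadd, integral_add (hind' _ hM1) hsub,
    integral_sub hM0 (hind' _ hM0), hrot, hfirst]
  ring

lemma integral_walkMax [IsProbabilityMeasure Q] (hind : iIndepFun ξ Q)
    (hlaw : ∀ i, HasLaw (ξ i) γ Q) (hint : ∀ i, Integrable (ξ i) Q) (n : ℕ) :
    ∫ ω, walkMax n (fun i => ξ i ω) ∂Q =
      ∑ k ∈ Finset.range n, (∫ ω, max (∑ i ∈ Finset.range (k + 1), ξ i ω) 0 ∂Q) / (k + 1) := by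
  induction n with
  | zero => simp [walkMax]
  | succ n ih => rw [integral_walkMax_succ hind hlaw hint, ih, Finset.sum_range_succ]

end Spitzer

section Gaussian

lemma integral_max_gaussianReal {v : ℝ≥0} (hv : v ≠ 0) :
    ∫ x, max x 0 ∂(gaussianReal 0 v) = √((v : ℝ) / (2 * Real.pi)) := by
  have hv' : 0 < (v : ℝ) := by positivity
  have h1 : ∀ x : ℝ, gaussianPDFReal 0 v x • max x 0 = (Set.Ioi (0 : ℝ)).indicator
      (fun x => (√(2 * Real.pi * v))⁻¹ *
        (x ^ (1 : ℝ) * Real.exp (-(1 / (2 * v)) * x ^ (2 : ℝ)))) x := by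
    intro x
    rw [Set.indicator_apply]
    split_ifs with h
    · rw [max_eq_left (le_of_lt h), gaussianPDFReal, smul_eq_mul, Real.rpow_one, Real.rpow_two,
        sub_zero, show -x ^ 2 / (2 * (v : ℝ)) = -(1 / (2 * v)) * x ^ 2 by ring]
      ring
    · rw [max_eq_right (not_lt.1 h), smul_zero]
  rw [integral_gaussianReal_eq_integral_smul hv]
  simp only [h1]
  rw [integral_indicator measurableSet_Ioi, integral_const_mul,
    integral_rpow_mul_exp_neg_mul_rpow two_pos (by norm_num) (by positivity)]
  rw [show (-(1 + 1) / 2 : ℝ) = -1 by norm_num, show ((1 + 1) / 2 : ℝ) = 1 by norm_num,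
    Real.Gamma_one, Real.rpow_neg_one]
  have h2 : √((v : ℝ) / (2 * Real.pi)) = v / √(2 * Real.pi * v) := by
    rw [show (v : ℝ) / (2 * Real.pi) = (v : ℝ) ^ 2 / (2 * Real.pi * v) by field_simp,
      Real.sqrt_div (by positivity), Real.sqrt_sq hv'.le]
  rw [h2]
  field_simp

end Gaussian

end Stirring

namespace Stirring

/-! ### Sums of inverse square roots. -/

section InverseSqrt

lemma sum_inv_sqrt_le (N : ℕ) : ∑ k ∈ Finset.range N, 1 / √((k : ℝ) + 1) ≤ 2 * √N := by
  induction N with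
  | zero => simp
  | succ N ih =>
    rw [Finset.sum_range_succ]
    have h1 : 0 < √((N : ℝ) + 1) := Real.sqrt_pos.2 (by positivity)
    have h2 : √((N : ℝ) + 1) * √((N : ℝ) + 1) = N + 1 := Real.mul_self_sqrt (by positivity)
    have h3 : √(N : ℝ) * √(N : ℝ) = N := Real.mul_self_sqrt (by positivity)
    have h4 : 1 / √((N : ℝ) + 1) ≤ 2 * (√((N : ℝ) + 1) - √(N : ℝ)) := by
      rw [div_le_iff₀ h1]
      nlinarith [sq_nonneg (√((N : ℝ) + 1) - √(N : ℝ))]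
    push_cast
    linarith

lemma le_sum_inv_sqrt (N : ℕ) :
    2 * √((N : ℝ) + 1) - 2 ≤ ∑ k ∈ Finset.range N, 1 / √((k : ℝ) + 1) := by
  induction N with
  | zero => simp
  | succ N ih =>
    rw [Finset.sum_range_succ]
    have h1 : 0 < √((N : ℝ) + 1) := Real.sqrt_pos.2 (by positivity)
    have h2 : √((N : ℝ) + 1) * √((N : ℝ) + 1) = N + 1 := Real.mul_self_sqrt (by positivity)
    have h3 : √((N : ℝ) + 1 + 1) * √((N : ℝ) + 1 + 1) = N + 1 + 1 :=
      Real.mul_self_sqrt (by positivity)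
    have h4 : 2 * (√((N : ℝ) + 1 + 1) - √((N : ℝ) + 1)) ≤ 1 / √((N : ℝ) + 1) := by
      rw [le_div_iff₀ h1]
      nlinarith [sq_nonneg (√((N : ℝ) + 1 + 1) - √((N : ℝ) + 1))]
    push_cast
    linarith

lemma tendsto_sum_inv_sqrt :
    Tendsto (fun N : ℕ => (∑ k ∈ Finset.range N, 1 / √((k : ℝ) + 1)) / √N) atTop (𝓝 2) := by
  have hs : Tendsto (fun N : ℕ => √(N : ℝ)) atTop atTop :=
    Real.tendsto_sqrt_atTop.comp tendsto_natCast_atTop_atTop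
  have hl : Tendsto (fun N : ℕ => 2 - 2 / √(N : ℝ)) atTop (𝓝 2) := by
    simpa using (tendsto_const_nhds (x := (2 : ℝ))).sub
      ((tendsto_const_nhds (x := (2 : ℝ))).div_atTop hs)
  refine tendsto_of_tendsto_of_tendsto_of_le_of_le' hl tendsto_const_nhds ?_ ?_
  · filter_upwards [eventually_gt_atTop 0] with N hN
    have h0 : 0 < √(N : ℝ) := Real.sqrt_pos.2 (by exact_mod_cast hN)
    have h1 : √(N : ℝ) ≤ √((N : ℝ) + 1) := Real.sqrt_le_sqrt (by linarith)
    rw [le_div_iff₀ h0, sub_mul, div_mul_cancel₀ _ h0.ne']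
    linarith [le_sum_inv_sqrt N]
  · filter_upwards [eventually_gt_atTop 0] with N hN
    have h0 : 0 < √(N : ℝ) := Real.sqrt_pos.2 (by exact_mod_cast hN)
    rw [div_le_iff₀ h0]
    exact sum_inv_sqrt_le N

end InverseSqrt

/-! ### The expected maximum of Brownian motion. -/

section BrownianMaximum

variable {ΩB : Type*} {B : ℝ≥0 → ΩB → ℝ}

/-- The `k`-th time of the dyadic grid of the interval from `0` to `4`. -/
noncomputable def gridTime (m k : ℕ) : ℝ≥0 := 4 * (k / 2 ^ m)

lemma monotone_gridTime (m : ℕ) : Monotone (gridTime m) := fun a b h => by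
  unfold gridTime
  gcongr

/-- The maximum over a dyadic grid. -/
noncomputable def gridMax (B : ℝ≥0 → ΩB → ℝ) (m : ℕ) (ω : ΩB) : ℝ :=
  walkMax (2 ^ m) fun k => B (gridTime m (k + 1)) ω - B (gridTime m k) ω

lemma sum_increments (m k : ℕ) (ω : ΩB) :
    ∑ i ∈ Finset.range k, (B (gridTime m (i + 1)) ω - B (gridTime m i) ω) =
      B (gridTime m k) ω - B 0 ω := by
  rw [Finset.sum_range_sub (fun i => B (gridTime m i) ω)]
  simp [gridTime]

lemma le_gridMax {m k : ℕ} (hk : k ≤ 2 ^ m) (ω : ΩB) :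
    B (gridTime m k) ω - B 0 ω ≤ gridMax B m ω := by
  rw [← sum_increments]
  exact sum_le_walkMax (2 ^ m) (fun k => B (gridTime m (k + 1)) ω - B (gridTime m k) ω) hk

lemma exists_gridMax_eq (B : ℝ≥0 → ΩB → ℝ) (m : ℕ) (ω : ΩB) :
    ∃ k ≤ 2 ^ m, gridMax B m ω = B (gridTime m k) ω - B 0 ω := by
  obtain ⟨k, hk, h⟩ := exists_walkMax_eq (2 ^ m)
    fun k => B (gridTime m (k + 1)) ω - B (gridTime m k) ω
  exact ⟨k, hk, h.trans (sum_increments m k ω)⟩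

lemma monotone_gridMax (B : ℝ≥0 → ΩB → ℝ) (ω : ΩB) : Monotone fun m => gridMax B m ω := by
  refine monotone_nat_of_le_succ fun m => ?_
  obtain ⟨k, hk, h⟩ := exists_gridMax_eq B m ω
  have ht : gridTime m k = gridTime (m + 1) (2 * k) := by
    rw [gridTime, gridTime, pow_succ]
    push_cast
    field_simp
  rw [h, ht]
  exact le_gridMax (by rw [pow_succ]; omega) ω

lemma tendsto_gridMax {ω : ΩB} (hc : Continuous fun t => B t ω) (h0 : B 0 ω = 0) :
    Tendsto (fun m => gridMax B m ω) atTop (𝓝 (⨆ s : Set.Icc (0 : ℝ≥0) 1, B (4 * s) ω)) := by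
  have hg : Continuous fun s : Set.Icc (0 : ℝ≥0) 1 => B (4 * s) ω :=
    hc.comp (continuous_const.mul continuous_subtype_val)
  -- Without boundedness the real supremum would be the default value 0.
  have hbdd : BddAbove (Set.range fun s : Set.Icc (0 : ℝ≥0) 1 => B (4 * s) ω) :=
    (isCompact_range hg).bddAbove
  have hne : Nonempty (Set.Icc (0 : ℝ≥0) 1) := ⟨⟨0, by simp⟩⟩
  refine tendsto_order.2 ⟨fun a ha => ?_, fun a ha => Eventually.of_forall fun m => ?_⟩
  · obtain ⟨s, hs⟩ := exists_lt_of_lt_ciSup ha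
    have h1 : Tendsto (fun m : ℕ => (⌊(s : ℝ≥0) * 2 ^ m⌋₊ : ℝ≥0) / 2 ^ m) atTop (𝓝 (s : ℝ≥0)) := by
      rw [← NNReal.tendsto_coe]
      have := (tendsto_nat_floor_mul_div_atTop (R := ℝ) (s : ℝ≥0).coe_nonneg).comp
        (tendsto_pow_atTop_atTop_of_one_lt (one_lt_two (α := ℝ)))
      refine this.congr fun m => ?_
      simp only [Function.comp_apply, NNReal.coe_div, NNReal.coe_natCast, NNReal.coe_pow,
        NNReal.coe_ofNat]
      congr 2
    have h2 : Tendsto (fun m : ℕ => B (gridTime m ⌊(s : ℝ≥0) * 2 ^ m⌋₊) ω) atTop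
        (𝓝 (B (4 * s) ω)) := (hc.tendsto _).comp (h1.const_mul 4)
    filter_upwards [h2.eventually (lt_mem_nhds hs)] with m hm
    refine hm.trans_le ?_
    have h3 : ⌊(s : ℝ≥0) * 2 ^ m⌋₊ ≤ 2 ^ m := by
      refine Nat.floor_le_of_le ?_
      push_cast
      exact mul_le_of_le_one_left zero_le s.2.2
    have h4 := le_gridMax (B := B) h3 ω
    rwa [h0, sub_zero] at h4
  · obtain ⟨k, hk, h⟩ := exists_gridMax_eq B m ω
    rw [h, h0, sub_zero]
    have hk' : (k / 2 ^ m : ℝ≥0) ∈ Set.Icc (0 : ℝ≥0) 1 :=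
      ⟨zero_le, div_le_one_of_le₀ (by exact_mod_cast hk) zero_le⟩
    exact (le_ciSup hbdd ⟨_, hk'⟩).trans_lt ha

variable [MeasurableSpace ΩB] {Q : Measure ΩB}

lemma hasLaw_sub_of_le (hB : IsBrownianReal B Q) {s t : ℝ≥0} (h : s ≤ t) :
    HasLaw (fun ω => B t ω - B s ω) (gaussianReal 0 (t - s)) Q := by
  have h1 := hB.toIsPreBrownianReal.hasLaw_sub t s
  have h2 : nndist t.1 s.1 = t - s := by
    rw [← NNReal.coe_inj, coe_nndist, Real.dist_eq, NNReal.coe_sub h]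
    exact abs_of_nonneg (sub_nonneg.2 (NNReal.coe_le_coe.2 h))
  rw [h2] at h1
  exact h1

lemma integral_gridMax (hB : IsBrownianReal B Q) (m : ℕ) :
    ∫ ω, gridMax B m ω ∂Q = √(2 / Real.pi) *
      ((∑ k ∈ Finset.range (2 ^ m), 1 / √((k : ℝ) + 1)) / √((2 ^ m : ℕ) : ℝ)) := by
  have hpre := hB.toIsPreBrownianReal
  have := hpre.isGaussianProcess.isProbabilityMeasure
  have hlaw : ∀ k, HasLaw (fun ω => B (gridTime m (k + 1)) ω - B (gridTime m k) ω)
      (gaussianReal 0 (4 / 2 ^ m)) Q := fun k => by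
    have h := hasLaw_sub_of_le hB (monotone_gridTime m (Nat.le_succ k))
    have h' : gridTime m (k + 1) - gridTime m k = 4 / 2 ^ m := by
      rw [gridTime, gridTime, ← mul_tsub, ← NNReal.sub_div]
      push_cast
      rw [add_tsub_cancel_left, mul_one_div]
    rw [Nat.succ_eq_add_one, h'] at h
    exact h
  unfold gridMax
  rw [integral_walkMax (hpre.hasIndepIncrements.nat (monotone_gridTime m)) hlaw
    (fun k => (hpre.integrable_eval _).sub (hpre.integrable_eval _)), Finset.sum_div,
    Finset.mul_sum]
  refine Finset.sum_congr rfl fun k _ => ?_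
  simp only [sum_increments]
  have h1 : HasLaw (fun ω => B (gridTime m (k + 1)) ω - B 0 ω)
      (gaussianReal 0 (gridTime m (k + 1))) Q := by
    simpa using hasLaw_sub_of_le hB (zero_le (a := gridTime m (k + 1)))
  have h2 : ∫ ω, max (B (gridTime m (k + 1)) ω - B 0 ω) 0 ∂Q =
      √((gridTime m (k + 1) : ℝ) / (2 * Real.pi)) := by
    rw [← integral_max_gaussianReal (by unfold gridTime; positivity)]
    exact h1.integral_comp (f := fun x => max x 0)
      (continuous_id.max continuous_const).aestronglyMeasurable
  rw [h2]
  -- The variance is `4 * (k + 1) / 2 ^ m`. After division by `k + 1` in Spitzer's identity, each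
  -- term is a constant times `1 / √(k + 1)`.
  have h3 : (gridTime m (k + 1) : ℝ) / (2 * Real.pi) =
      2 / Real.pi * ((k + 1) / ((2 ^ m : ℕ) : ℝ)) := by
    rw [gridTime]
    push_cast
    field_simp
    norm_num
  rw [h3, Real.sqrt_mul (by positivity),
    Real.sqrt_div (show 0 ≤ (k : ℝ) + 1 by positivity)]
  have h4 : √((k : ℝ) + 1) * √((k : ℝ) + 1) = k + 1 := Real.mul_self_sqrt (by positivity)
  have h5 : 0 < √((k : ℝ) + 1) := Real.sqrt_pos.2 (by positivity)
  have h6 : √((k : ℝ) + 1) / (k + 1) = 1 / √((k : ℝ) + 1) := by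
    rw [div_eq_div_iff (by positivity) h5.ne', h4, one_mul]
  rw [← h6]
  ring

/-- The grid maxima increase to the supremum almost surely, so monotone convergence of the Lebesgue
integrals yields integrability and the value together. -/
theorem brownian_maximum (hB : IsBrownianReal B Q) :
    Integrable (fun ω => ⨆ s : Set.Icc (0 : ℝ≥0) 1, B (4 * s) ω) Q ∧
      1 / 2 * ∫ ω, (⨆ s : Set.Icc (0 : ℝ≥0) 1, B (4 * s) ω) ∂Q = √(2 / Real.pi) := by
  have hpre := hB.toIsPreBrownianReal
  have := hpre.isGaussianProcess.isProbabilityMeasure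
  set M : ΩB → ℝ := fun ω => ⨆ s : Set.Icc (0 : ℝ≥0) 1, B (4 * s) ω
  have hmeas : ∀ m, AEMeasurable (gridMax B m) Q := fun m =>
    (measurable_walkMax _).comp_aemeasurable (aemeasurable_pi_lambda _ fun k =>
      (hpre.aemeasurable _).sub (hpre.aemeasurable _))
  have hnn : ∀ m ω, 0 ≤ gridMax B m ω := fun m ω => walkMax_nonneg _ _
  have hint : ∀ m, Integrable (gridMax B m) Q := fun m => by
    have hs : Integrable (fun ω => ∑ k ∈ Finset.range (2 ^ m),
        |B (gridTime m (k + 1)) ω - B (gridTime m k) ω|) Q :=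
      integrable_finsetSum _ fun k _ =>
        ((hpre.integrable_eval _).sub (hpre.integrable_eval _)).abs
    refine hs.mono' (hmeas m).aestronglyMeasurable (ae_of_all _ fun ω => ?_)
    rw [Real.norm_eq_abs, abs_of_nonneg (hnn m ω)]
    exact walkMax_le _ _
  have hlim : ∀ᵐ ω ∂Q, Tendsto (fun m => gridMax B m ω) atTop (𝓝 (M ω)) := by
    filter_upwards [hB.cont, hpre.eval_zero_ae_eq_zero] with ω hc h0
    exact tendsto_gridMax hc h0
  have hMm : AEStronglyMeasurable M Q :=
    aestronglyMeasurable_of_tendsto_ae atTop (fun m => (hmeas m).aestronglyMeasurable) hlim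
  have hM0 : ∀ᵐ ω ∂Q, 0 ≤ M ω := by
    filter_upwards [hlim] with ω h
    exact ge_of_tendsto' h fun m => hnn m ω
  have hval : Tendsto (fun m => ∫ ω, gridMax B m ω ∂Q) atTop (𝓝 (√(2 / Real.pi) * 2)) := by
    simp only [integral_gridMax hB]
    exact (tendsto_sum_inv_sqrt.comp (tendsto_pow_atTop_atTop_of_one_lt
      (one_lt_two (α := ℕ)))).const_mul _
  have h1 := lintegral_tendsto_of_tendsto_of_monotone
    (f := fun m ω => ENNReal.ofReal (gridMax B m ω)) (F := fun ω => ENNReal.ofReal (M ω))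
    (fun m => (hmeas m).ennreal_ofReal)
    (ae_of_all _ fun ω a b h => ENNReal.ofReal_le_ofReal (monotone_gridMax B ω h))
    (hlim.mono fun ω h => ENNReal.tendsto_ofReal h)
  have h2 : Tendsto (fun m => ∫⁻ ω, ENNReal.ofReal (gridMax B m ω) ∂Q) atTop
      (𝓝 (ENNReal.ofReal (√(2 / Real.pi) * 2))) := by
    simp only [← fun m => ofReal_integral_eq_lintegral_ofReal (hint m) (ae_of_all _ (hnn m))]
    exact ENNReal.tendsto_ofReal hval
  have h3 := tendsto_nhds_unique h1 h2
  have hMint : Integrable M Q := by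
    refine ⟨hMm, ?_⟩
    rw [hasFiniteIntegral_iff_ofReal hM0, h3]
    exact ENNReal.ofReal_lt_top
  refine ⟨hMint, ?_⟩
  rw [integral_eq_lintegral_of_nonneg_ae hM0 hMm, h3, ENNReal.toReal_ofReal (by positivity)]
  ring

end BrownianMaximum

end Stirring

namespace Stirring

/-! ### The semigroup of the adjacent-transposition walk. -/

section PermSemigroup

variable {n : ℕ}

/-- The generator of the random adjacent-transposition walk as a bounded operator. -/
noncomputable def permOp (n : ℕ) :
    (Equiv.Perm (Fin n) → ℝ) →L[ℝ] (Equiv.Perm (Fin n) → ℝ) :=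
  LinearMap.toContinuousLinearMap
    ⟨⟨adjacentGenerator n, (isLocalBounded_adjacentGenerator n).add⟩,
      (isLocalBounded_adjacentGenerator n).smul⟩

/-- The semigroup of the random adjacent-transposition walk. -/
noncomputable def permSemigroup (n : ℕ) (t : ℝ) :
    (Equiv.Perm (Fin n) → ℝ) →L[ℝ] (Equiv.Perm (Fin n) → ℝ) := expSemigroup (permOp n) t

lemma permSemigroup_apply (t : ℝ) (g : Equiv.Perm (Fin n) → ℝ) (σ : Equiv.Perm (Fin n)) :
    HasSum (fun k : ℕ => t ^ k / (k.factorial : ℝ) * (adjacentGenerator n)^[k] g σ)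
      (permSemigroup n t g σ) :=
  hasSum_expSemigroup (permOp n) t (ContinuousLinearMap.proj σ) g

lemma adjacentGenerator_comp_mul_right (g : Equiv.Perm (Fin n) → ℝ) (ρ : Equiv.Perm (Fin n)) :
    adjacentGenerator n (fun τ => g (τ * ρ)) = fun τ => adjacentGenerator n g (τ * ρ) := by
  funext τ
  simp only [adjacentGenerator, mul_assoc]

lemma adjacentGenerator_iterate_comp_mul_right (k : ℕ) (g : Equiv.Perm (Fin n) → ℝ)
    (ρ : Equiv.Perm (Fin n)) :
    (adjacentGenerator n)^[k] (fun τ => g (τ * ρ)) =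
      fun τ => (adjacentGenerator n)^[k] g (τ * ρ) := by
  induction k generalizing g with
  | zero => rfl
  | succ k ih =>
    rw [Function.iterate_succ_apply, adjacentGenerator_comp_mul_right, ih,
      Function.iterate_succ_apply]

/-- The walk is invariant under right multiplication. -/
lemma permSemigroup_eq_sum (t : ℝ) (g : Equiv.Perm (Fin n) → ℝ) (σ : Equiv.Perm (Fin n)) :
    permSemigroup n t g σ = ∑ τ, transition (adjacentGenerator n) t 1 τ * g (τ * σ) := by
  obtain ⟨M, hM⟩ := Finite.exists_le fun τ : Equiv.Perm (Fin n) => |g (τ * σ)|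
  have h := (isLocalBounded_adjacentGenerator n).hasSum_transition t (fun τ => g (τ * σ)) hM 1
  have h2 := (hasSum_fintype _).unique h
  rw [← (permSemigroup_apply t g σ).tsum_eq, h2]
  refine tsum_congr fun k => ?_
  simp only [adjacentGenerator_iterate_comp_mul_right, one_mul]

lemma permSemigroup_one_eq_sum (t : ℝ) (g : Equiv.Perm (Fin n) → ℝ) :
    permSemigroup n t g 1 = ∑ τ, transition (adjacentGenerator n) t 1 τ * g τ := by
  simp [permSemigroup_eq_sum]

variable {Ω : Type*} [MeasurableSpace Ω] {P : Measure Ω} {X : ℝ≥0 → Ω → Equiv.Perm (Fin n)}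

lemma IsMarkovChain.measureReal_mem_perm (hX : IsMarkovChain (adjacentGenerator n) 1 X P)
    (A : Set (Equiv.Perm (Fin n))) (t : ℝ≥0) :
    P.real {ω | X t ω ∈ A} = ∑ τ, transition (adjacentGenerator n) t 1 τ * A.indicator 1 τ := by
  rw [hX.measureReal_mem, tsum_fintype]

lemma transition_perm_nonneg (hX : IsMarkovChain (adjacentGenerator n) 1 X P) (t : ℝ≥0)
    (τ : Equiv.Perm (Fin n)) : 0 ≤ transition (adjacentGenerator n) t 1 τ := by
  classical
  have h := hX.measureReal_mem_perm {τ} t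
  simp only [Set.indicator_apply, Set.mem_singleton_iff, Pi.one_apply, mul_ite, mul_one, mul_zero,
    Finset.sum_ite_eq', Finset.mem_univ, if_true] at h
  rw [← h]
  exact measureReal_nonneg

lemma sum_transition_perm (hX : IsMarkovChain (adjacentGenerator n) 1 X P) (t : ℝ≥0) :
    ∑ τ, transition (adjacentGenerator n) t 1 τ = 1 := by
  have := hX.isProbabilityMeasure
  have h := hX.measureReal_mem_perm Set.univ t
  simpa using h.symm

lemma permSemigroup_mono (hX : IsMarkovChain (adjacentGenerator n) 1 X P) (t : ℝ≥0)
    {g h : Equiv.Perm (Fin n) → ℝ} (hgh : ∀ τ, g τ ≤ h τ) (σ : Equiv.Perm (Fin n)) :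
    permSemigroup n t g σ ≤ permSemigroup n t h σ := by
  rw [permSemigroup_eq_sum, permSemigroup_eq_sum]
  exact Finset.sum_le_sum fun τ _ =>
    mul_le_mul_of_nonneg_left (hgh _) (transition_perm_nonneg hX t τ)

lemma permSemigroup_const (hX : IsMarkovChain (adjacentGenerator n) 1 X P) (t : ℝ≥0) (c : ℝ)
    (σ : Equiv.Perm (Fin n)) : permSemigroup n t (fun _ => c) σ = c := by
  rw [permSemigroup_eq_sum, ← Finset.sum_mul, sum_transition_perm hX, one_mul]

end PermSemigroup

/-! ### Order signs and the drift of the number of inversions. -/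

section MeanDistance

variable {n : ℕ}

lemma sum_adjacentPairs_swap (φ : Fin n → ℝ) (a : Fin n) :
    ∑ e ∈ adjacentPairs n, (φ (Equiv.swap e.1 e.2 a) - φ a) =
      (if h : (a : ℕ) + 1 < n then φ ⟨a + 1, h⟩ - φ a else 0) +
        (if 0 < (a : ℕ) then φ ⟨a - 1, by omega⟩ - φ a else 0) := by
  have h1 : ∀ e ∈ adjacentPairs n, φ (Equiv.swap e.1 e.2 a) - φ a =
      (if e.1 = a then φ e.2 - φ a else 0) + (if e.2 = a then φ e.1 - φ a else 0) := by
    intro e he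
    rw [mem_adjacentPairs] at he
    have hne : e.1 ≠ e.2 := by rw [ne_eq, Fin.ext_iff]; omega
    rw [Equiv.swap_apply_def]
    by_cases ha : a = e.1
    · subst ha
      simp [hne.symm]
    · by_cases hb : a = e.2
      · subst hb
        simp [hne, hne.symm]
      · simp [ha, hb, Ne.symm ha, Ne.symm hb]
  rw [Finset.sum_congr rfl h1, Finset.sum_add_distrib]
  congr 1
  · split_ifs with h
    · rw [Finset.sum_eq_single (a, (⟨a + 1, h⟩ : Fin n))]
      · simp
      · intro e he hne
        rw [mem_adjacentPairs] at he
        refine if_neg fun h2 => hne ?_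
        ext
        · simp [h2]
        · simp [← he, h2]
      · intro h2
        exact absurd (mem_adjacentPairs.2 rfl) h2
    · refine Finset.sum_eq_zero fun e he => if_neg fun h2 => h ?_
      rw [mem_adjacentPairs] at he
      rw [← h2]
      have := e.2.isLt
      omega
  · split_ifs with h
    · rw [Finset.sum_eq_single ((⟨a - 1, by omega⟩ : Fin n), a)]
      · simp
      · intro e he hne
        rw [mem_adjacentPairs] at he
        refine if_neg fun h2 => hne ?_
        ext
        · simp only [← h2]
          omega
        · simp [h2]
      · intro h2
        exact absurd (mem_adjacentPairs.2 (by simp only; omega)) h2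
    · refine Finset.sum_eq_zero fun e he => if_neg fun h2 => h ?_
      rw [mem_adjacentPairs] at he
      rw [← h2]
      omega

/-- The sign that tells whether the particle at `i` has a smaller label than the one at `j`. -/
def orderSign (i j : Fin n) (σ : Equiv.Perm (Fin n)) : ℝ :=
  signFn (((σ⁻¹ j : Fin n) : ℕ) - ((σ⁻¹ i : Fin n) : ℕ))

lemma orderSign_swap (i j : Fin n) (σ : Equiv.Perm (Fin n)) :
    orderSign i j σ = -orderSign j i σ := by
  rw [orderSign, orderSign, ← signFn_neg, neg_sub]

/-- Duality: an exchange in the permutation is the same exchange applied to the two observed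
positions, so order signs form a closed family under the dynamics. -/
lemma orderSign_swap_mul (a b i j : Fin n) (σ : Equiv.Perm (Fin n)) :
    orderSign i j (Equiv.swap a b * σ) = orderSign (Equiv.swap a b i) (Equiv.swap a b j) σ := by
  rw [orderSign, orderSign, mul_inv_rev, Equiv.swap_inv]
  rfl

/-- An exchange creates an inversion when the left label is the smaller one and destroys one
otherwise, so the increment is the order sign. -/
lemma adjacentGenerator_inversions :
    adjacentGenerator n (fun σ => (inversions σ : ℝ)) =
      (1 / ((n : ℝ) - 1)) • ∑ e ∈ adjacentPairs n, orderSign e.1 e.2 := by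
  funext σ
  rw [Pi.smul_apply, Finset.sum_apply, smul_eq_mul, adjacentGenerator]
  congr 1
  refine Finset.sum_congr rfl fun e he => ?_
  have hne : σ⁻¹ e.1 ≠ σ⁻¹ e.2 := fun h => by
    have := mem_adjacentPairs.1 he
    rw [(σ⁻¹).injective h] at this
    omega
  rcases lt_or_gt_of_ne hne with h | h
  · rw [inversions_swap_mul_of_lt he h, orderSign, signFn_of_pos]
    · push_cast; ring
    · rw [Fin.lt_def] at h; omega
  · rw [← inversions_swap_mul_of_gt he h, orderSign, signFn_of_neg]
    · push_cast; ring
    · rw [Fin.lt_def] at h; omega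

/-- The nearest neighbour differences of a function of a position, with reflection at the ends. -/
lemma adjacentGenerator_orderSign (i j : Fin n) :
    adjacentGenerator n (orderSign i j) = (1 / ((n : ℝ) - 1)) •
      (((if h : (i : ℕ) + 1 < n then orderSign ⟨i + 1, h⟩ j - orderSign i j else 0) +
        (if 0 < (i : ℕ) then orderSign ⟨i - 1, by omega⟩ j - orderSign i j else 0)) +
      ((if h : (j : ℕ) + 1 < n then orderSign i ⟨j + 1, h⟩ - orderSign i j else 0) +
        (if 0 < (j : ℕ) then orderSign i ⟨j - 1, by omega⟩ - orderSign i j else 0))) := by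
  funext σ
  rw [Pi.smul_apply, smul_eq_mul, adjacentGenerator]
  congr 1
  have h : ∀ e : Fin n × Fin n, orderSign i j (Equiv.swap e.1 e.2 * σ) - orderSign i j σ =
      (orderSign (Equiv.swap e.1 e.2 i) j σ - orderSign i j σ) +
        (orderSign i (Equiv.swap e.1 e.2 j) σ - orderSign i j σ) := fun e => by
    rw [orderSign_swap_mul]
    exact swap_sub_eq_add (G := fun i j => orderSign i j σ) (fun i j => orderSign_swap i j σ)
      e.1 e.2 i j
  simp only [h]
  rw [Finset.sum_add_distrib, sum_adjacentPairs_swap (fun a => orderSign a j σ) i,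
    sum_adjacentPairs_swap (fun a => orderSign i a σ) j]
  simp only [Pi.add_apply]
  congr 2 <;> split_ifs <;> rfl

lemma abs_orderSign_le (i j : Fin n) (σ : Equiv.Perm (Fin n)) : |orderSign i j σ| ≤ 1 :=
  abs_signFn_le _

/-- One application gives at most four differences of order signs, hence the factor 8. Unlike the
bound from the operator norm, this one decays like the `k`-th power of 1/n, which is needed at times
of order n. -/
lemma abs_adjacentGenerator_iterate_orderSign_le (k : ℕ) (i j : Fin n) (σ : Equiv.Perm (Fin n)) :
    |(adjacentGenerator n)^[k] (orderSign i j) σ| ≤ (8 * |1 / ((n : ℝ) - 1)|) ^ k := by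
  induction k generalizing i j with
  | zero => simpa using abs_orderSign_le i j σ
  | succ k ih =>
    have hk := (isLocalBounded_adjacentGenerator n).iterate k
    have hdiff : ∀ (p : Prop) [Decidable p] (i' j' : p → Fin n),
        |(adjacentGenerator n)^[k]
          (if h : p then orderSign (i' h) (j' h) - orderSign i j else 0) σ| ≤
          2 * (8 * |1 / ((n : ℝ) - 1)|) ^ k := fun p _ i' j' => by
      split_ifs with h
      · rw [hk.sub, Pi.sub_apply]
        have h1 := abs_le.1 (ih (i' h) (j' h))
        have h2 := abs_le.1 (ih i j)
        rw [abs_le]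
        constructor <;> linarith
      · rw [hk.zero]
        simp only [Pi.zero_apply, abs_zero]
        positivity
    rw [Function.iterate_succ_apply, adjacentGenerator_orderSign, hk.smul, hk.add, hk.add, hk.add,
      Pi.smul_apply, smul_eq_mul, abs_mul, pow_succ]
    have hdiff' : ∀ (p : Prop) [Decidable p] (i' j' : Fin n),
        |(adjacentGenerator n)^[k] (if p then orderSign i' j' - orderSign i j else 0) σ| ≤
          2 * (8 * |1 / ((n : ℝ) - 1)|) ^ k := fun p _ i' j' =>
      hdiff p (fun _ => i') fun _ => j'
    have h1 := abs_le.1 (hdiff ((i : ℕ) + 1 < n) (fun h => ⟨i + 1, h⟩) fun _ => j)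
    have h2 := abs_le.1 (hdiff' (0 < (i : ℕ)) ⟨i - 1, by omega⟩ j)
    have h3 := abs_le.1 (hdiff ((j : ℕ) + 1 < n) (fun _ => i) fun h => ⟨j + 1, h⟩)
    have h4 := abs_le.1 (hdiff' (0 < (j : ℕ)) i ⟨j - 1, by omega⟩)
    rw [← mul_assoc, mul_comm |1 / ((n : ℝ) - 1)|]
    refine mul_le_mul_of_nonneg_right ?_ (abs_nonneg _)
    rw [abs_le]
    simp only [Pi.add_apply]
    constructor <;> linarith [h1.1, h1.2, h2.1, h2.2, h3.1, h3.2, h4.1, h4.2]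

/-- Away from the ends, order signs evolve as the sign of the rate-four walk. -/
lemma adjacentGenerator_iterate_orderSign_one (k : ℕ) (i j : Fin n) (hi : k ≤ i) (hi' : i + k < n)
    (hj : k ≤ j) (hj' : j + k < n) :
    (adjacentGenerator n)^[k] (orderSign i j) 1 =
      (1 / ((n : ℝ) - 1)) ^ k * (walkGenerator 4)^[k] signFn ((j : ℕ) - (i : ℕ)) := by
  induction k generalizing i j with
  | zero => simp [orderSign]
  | succ k ih =>
    have hk := (isLocalBounded_adjacentGenerator n).iterate k
    rw [Function.iterate_succ_apply, adjacentGenerator_orderSign, dif_pos (by omega),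
      if_pos (by omega), dif_pos (by omega), if_pos (by omega), hk.smul, hk.add, hk.add, hk.add,
      hk.sub, hk.sub, hk.sub, hk.sub, Pi.smul_apply, smul_eq_mul]
    simp only [Pi.add_apply, Pi.sub_apply]
    rw [ih ⟨i + 1, by omega⟩ j (by show k ≤ (i : ℕ) + 1; omega)
        (by show (i : ℕ) + 1 + k < n; omega) (by omega) (by omega),
      ih ⟨i - 1, by omega⟩ j (by show k ≤ (i : ℕ) - 1; omega)
        (by show (i : ℕ) - 1 + k < n; omega) (by omega) (by omega),
      ih i ⟨j + 1, by omega⟩ (by omega) (by omega) (by show k ≤ (j : ℕ) + 1; omega)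
        (by show (j : ℕ) + 1 + k < n; omega),
      ih i ⟨j - 1, by omega⟩ (by omega) (by omega) (by show k ≤ (j : ℕ) - 1; omega)
        (by show (j : ℕ) - 1 + k < n; omega),
      ih i j (by omega) (by omega) (by omega) (by omega), Function.iterate_succ_apply',
      walkGenerator_four, pow_succ]
    have e1 : ((j : ℕ) : ℤ) - ((⟨i + 1, by omega⟩ : Fin n) : ℕ) = (j : ℕ) - (i : ℕ) - 1 := by
      simp only; push_cast; ring
    have e2 : ((j : ℕ) : ℤ) - ((⟨i - 1, by omega⟩ : Fin n) : ℕ) = (j : ℕ) - (i : ℕ) + 1 := by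
      simp only; omega
    have e3 : (((⟨j + 1, by omega⟩ : Fin n) : ℕ) : ℤ) - (i : ℕ) = (j : ℕ) - (i : ℕ) + 1 := by
      simp only; push_cast; ring
    have e4 : (((⟨j - 1, by omega⟩ : Fin n) : ℕ) : ℤ) - (i : ℕ) = (j : ℕ) - (i : ℕ) - 1 := by
      simp only; omega
    rw [e1, e2, e3, e4]
    ring

lemma adjacentPairs_card (m : ℕ) : (adjacentPairs (m + 1)).card = m := by
  have : adjacentPairs (m + 1) =
      (Finset.univ : Finset (Fin m)).image fun i => (i.castSucc, i.succ) := by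
    ext ⟨a, b⟩
    simp only [mem_adjacentPairs, Finset.mem_image, Finset.mem_univ, true_and, Prod.mk.injEq]
    constructor
    · intro h
      exact ⟨⟨a, by omega⟩, Fin.ext (by simp), Fin.ext (by simpa using h)⟩
    · rintro ⟨i, rfl, rfl⟩
      simp
  rw [this, Finset.card_image_of_injective, Finset.card_univ, Fintype.card_fin]
  intro i j h
  exact Fin.castSucc_injective m (Prod.mk.inj h).1

lemma card_boundary_pairs_le (n k : ℕ) :
    ((adjacentPairs n).filter fun e => ¬(k ≤ (e.1 : ℕ) ∧ (e.2 : ℕ) + k < n)).card ≤ 2 * k := by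
  have h : ((adjacentPairs n).filter fun e => ¬(k ≤ (e.1 : ℕ) ∧ (e.2 : ℕ) + k < n)).card ≤
      (Finset.range k ∪ Finset.Ico (n - 1 - k) (n - 1)).card := by
    refine Finset.card_le_card_of_injOn (fun e => (e.1 : ℕ)) ?_ ?_
    · intro e he
      have he := Finset.mem_filter.1 he
      have h1 := mem_adjacentPairs.1 he.1
      have h2 := e.2.isLt
      simp only [Finset.coe_union, Finset.coe_range, Finset.coe_Ico, Set.mem_union, Set.mem_Iio,
        Set.mem_Ico]
      omega
    · intro e he e' he' h
      have h1 := mem_adjacentPairs.1 (Finset.mem_filter.1 he).1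
      have h2 := mem_adjacentPairs.1 (Finset.mem_filter.1 he').1
      simp only at h
      ext <;> omega
  refine h.trans ((Finset.card_union_le _ _).trans ?_)
  rw [Finset.card_range, Nat.card_Ico]
  omega

end MeanDistance

end Stirring

namespace Stirring

/-! ### Variance bound through the carré du champ. -/

section Variance

variable {n : ℕ} {Ω : Type*} [MeasurableSpace Ω] {P : Measure Ω}
  {X : ℝ≥0 → Ω → Equiv.Perm (Fin n)}

lemma sub_le_mul_of_hasDerivAt_le {F F' : ℝ → ℝ} {C t : ℝ} (ht : 0 ≤ t)
    (hF : ∀ s, HasDerivAt F (F' s) s) (hF' : ∀ s, 0 ≤ s → s ≤ t → F' s ≤ C) :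
    F t - F 0 ≤ C * t := by
  have h := (convex_Icc (0 : ℝ) t).image_sub_le_mul_sub_of_deriv_le (f := F) (C := C)
    (fun s _ => (hF s).continuousAt.continuousWithinAt)
    (fun s _ => (hF s).differentiableAt.differentiableWithinAt)
    (fun s hs => by
      rw [(hF s).deriv]
      have := interior_subset hs
      exact hF' s this.1 this.2) 0 (Set.left_mem_Icc.2 ht) t (Set.right_mem_Icc.2 ht) ht
  rwa [sub_zero] at h

/-- The carré du champ of the random adjacent-transposition walk. -/
lemma adjacentGenerator_mul_self_sub (h : Equiv.Perm (Fin n) → ℝ) (σ : Equiv.Perm (Fin n)) :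
    adjacentGenerator n (h * h) σ - 2 * (h σ * adjacentGenerator n h σ) =
      1 / ((n : ℝ) - 1) * ∑ e ∈ adjacentPairs n, (h (Equiv.swap e.1 e.2 * σ) - h σ) ^ 2 := by
  simp only [adjacentGenerator, Pi.mul_apply]
  rw [mul_left_comm (h σ), mul_left_comm (2 : ℝ), ← mul_sub, Finset.mul_sum, Finset.mul_sum,
    ← Finset.sum_sub_distrib]
  congr 1
  exact Finset.sum_congr rfl fun e _ => by ring

/-- The distance between the positions of two particles. -/
def separation (i j : Fin n) (σ : Equiv.Perm (Fin n)) : ℝ := |((σ i : ℕ) : ℝ) - ((σ j : ℕ) : ℝ)|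

lemma sum_abs_swap_sub_le (a : Fin n) :
    ∑ e ∈ adjacentPairs n, |((Equiv.swap e.1 e.2 a : ℕ) : ℝ) - ((a : ℕ) : ℝ)| ≤ 2 := by
  have h := sum_adjacentPairs_swap (fun x => |((x : ℕ) : ℝ) - ((a : ℕ) : ℝ)|) a
  simp only [sub_self, abs_zero, sub_zero] at h
  rw [h]
  have h1 : (if h : (a : ℕ) + 1 < n then |(((⟨a + 1, h⟩ : Fin n) : ℕ) : ℝ) - ((a : ℕ) : ℝ)| else 0)
      ≤ 1 := by
    split_ifs <;> simp
  have h2 : (if 0 < (a : ℕ) then |(((⟨a - 1, by omega⟩ : Fin n) : ℕ) : ℝ) - ((a : ℕ) : ℝ)| else 0)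
      ≤ 1 := by
    split_ifs with h
    · rw [Nat.cast_sub h]
      simp
    · simp
  linarith

/-- At most two edges touch each particle, and each moves it by one; for two particles this totals
4. -/
lemma adjacentGenerator_separation_le (hn : 1 ≤ n) (i j : Fin n) (σ : Equiv.Perm (Fin n)) :
    adjacentGenerator n (separation i j) σ ≤ 1 / ((n : ℝ) - 1) * 4 := by
  have hn' : (1 : ℝ) ≤ n := by exact_mod_cast hn
  refine mul_le_mul_of_nonneg_left ?_ (by positivity [sub_nonneg.2 hn'])
  calc ∑ e ∈ adjacentPairs n, (separation i j (Equiv.swap e.1 e.2 * σ) - separation i j σ)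
      ≤ ∑ e ∈ adjacentPairs n, (|((Equiv.swap e.1 e.2 (σ i) : ℕ) : ℝ) - ((σ i : ℕ) : ℝ)| +
          |((Equiv.swap e.1 e.2 (σ j) : ℕ) : ℝ) - ((σ j : ℕ) : ℝ)|) := by
        refine Finset.sum_le_sum fun e _ => ?_
        simp only [separation, Equiv.Perm.mul_apply]
        refine (abs_sub_abs_le_abs_sub _ _).trans ?_
        rw [sub_sub_sub_comm]
        exact abs_sub _ _
    _ ≤ 4 := by
        rw [Finset.sum_add_distrib]
        linarith [sum_abs_swap_sub_le (σ i), sum_abs_swap_sub_le (σ j)]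

/-- The mean distance of two particles grows at most linearly. -/
lemma permSemigroup_separation_le (hX : IsMarkovChain (adjacentGenerator n) 1 X P) (hn : 1 ≤ n)
    (i j : Fin n) (t : ℝ≥0) :
    permSemigroup n t (separation i j) 1 ≤ separation i j 1 + 1 / ((n : ℝ) - 1) * 4 * t := by
  have h := sub_le_mul_of_hasDerivAt_le (C := 1 / ((n : ℝ) - 1) * 4) t.2
    (hasDerivAt_expSemigroup_apply (permOp n)
      (ContinuousLinearMap.proj (R := ℝ) (φ := fun _ : Equiv.Perm (Fin n) => ℝ) 1)
      (separation i j)) fun s hs _ => by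
    have h1 := permSemigroup_mono hX ⟨s, hs⟩ (adjacentGenerator_separation_le hn i j) 1
    exact h1.trans (permSemigroup_const hX ⟨s, hs⟩ _ 1).le
  rw [expSemigroup_zero] at h
  have h2 : permSemigroup n t (separation i j) 1 - separation i j 1 ≤
      1 / ((n : ℝ) - 1) * 4 * t := h
  exact sub_le_iff_le_add'.1 h2

/-- The mean number of inversions depends on the starting point in a Lipschitz way. -/
lemma abs_permSemigroup_inversions_swap_sub_le (hX : IsMarkovChain (adjacentGenerator n) 1 X P)
    (hn : 1 ≤ n) (t : ℝ≥0) {e : Fin n × Fin n} (he : e ∈ adjacentPairs n)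
    (σ : Equiv.Perm (Fin n)) :
    |permSemigroup n t (fun σ => (inversions σ : ℝ)) (Equiv.swap e.1 e.2 * σ) -
      permSemigroup n t (fun σ => (inversions σ : ℝ)) σ| ≤
      2 * (1 + 1 / ((n : ℝ) - 1) * 4 * t) := by
  have hsep : separation e.1 e.2 1 = 1 := by
    rw [mem_adjacentPairs] at he
    simp [separation, ← he]
  have h1 := permSemigroup_separation_le hX hn e.1 e.2 t
  rw [hsep, permSemigroup_one_eq_sum] at h1
  rw [permSemigroup_eq_sum, permSemigroup_eq_sum, ← Finset.sum_sub_distrib]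
  refine (Finset.abs_sum_le_sum_abs _ _).trans
    (le_trans ?_ (mul_le_mul_of_nonneg_left h1 two_pos.le))
  rw [Finset.mul_sum]
  refine Finset.sum_le_sum fun τ _ => ?_
  rw [← mul_sub, abs_mul, abs_of_nonneg (transition_perm_nonneg hX t τ), mul_left_comm]
  refine mul_le_mul_of_nonneg_left ?_ (transition_perm_nonneg hX t τ)
  -- Both starting points are driven by the same `τ`. Moved past `τ`, the initial exchange becomes
  -- an exchange of the positions `τ e.1` and `τ e.2`, which changes the inversions by at most twice
  -- their distance.
  have h2 : τ * (Equiv.swap e.1 e.2 * σ) = Equiv.swap (τ e.1) (τ e.2) * (τ * σ) := by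
    rw [← mul_assoc, ← mul_assoc, Equiv.mul_swap_eq_swap_mul]
  rw [h2, separation]
  rcases le_total (τ e.1 : ℕ) (τ e.2) with h | h
  · have h3 := abs_inversions_swap_mul_sub_le _ _ _ (Nat.add_sub_cancel' h) (τ * σ)
    rw [Nat.cast_sub h] at h3
    exact h3.trans (by rw [abs_sub_comm]; gcongr; exact le_abs_self _)
  · have h3 := abs_inversions_swap_mul_sub_le _ _ _ (Nat.add_sub_cancel' h) (τ * σ)
    rw [Nat.cast_sub h, Equiv.swap_comm] at h3
    exact h3.trans (by gcongr; exact le_abs_self _)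

lemma card_adjacentPairs (hn : 1 ≤ n) : ((adjacentPairs n).card : ℝ) = n - 1 := by
  obtain ⟨m, rfl⟩ := Nat.exists_eq_add_of_le' hn
  rw [adjacentPairs_card]
  push_cast
  ring

/-- The variance of the number of inversions at time `t`. -/
lemma variance_inversions_le (hX : IsMarkovChain (adjacentGenerator n) 1 X P) (hn : 2 ≤ n)
    (t : ℝ≥0) :
    permSemigroup n t (fun σ => (inversions σ : ℝ) * inversions σ) 1 -
      permSemigroup n t (fun σ => (inversions σ : ℝ)) 1 ^ 2 ≤
      (2 * (1 + 1 / ((n : ℝ) - 1) * 4 * t)) ^ 2 * t := by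
  have hn' : (0 : ℝ) < (n : ℝ) - 1 := by
    have : (2 : ℝ) ≤ n := by exact_mod_cast hn
    linarith
  set g : Equiv.Perm (Fin n) → ℝ := fun σ => (inversions σ : ℝ) with hg
  set C : ℝ := 2 * (1 + 1 / ((n : ℝ) - 1) * 4 * t) with hC
  let φ := ContinuousLinearMap.proj (R := ℝ) (φ := fun _ : Equiv.Perm (Fin n) => ℝ) 1
  -- With semigroup P, the function s ↦ P_{t-s}((P_s g)^2) at the identity interpolates between the
  -- second moment and the squared mean; minus its derivative is P_{t-s} applied to the carré du
  -- champ of P_s g.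
  have hderiv := fun s => (hasDerivAt_duhamel (permOp n) φ t
    ((hasDerivAt_expSemigroup_vector (permOp n) g s).mul
      (hasDerivAt_expSemigroup_vector (permOp n) g s))).neg
  have h := sub_le_mul_of_hasDerivAt_le (C := C ^ 2) t.2 hderiv fun s hs hst => by
    have hst' : 0 ≤ (t : ℝ) - s := sub_nonneg.2 hst
    rw [← map_neg, ← map_neg]
    refine le_trans (permSemigroup_mono hX ⟨t - s, hst'⟩ (h := fun _ => C ^ 2) (fun σ => ?_) 1)
      (permSemigroup_const hX ⟨t - s, hst'⟩ _ 1).le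
    have h1 := adjacentGenerator_mul_self_sub (permSemigroup n s g) σ
    have h2 : adjacentGenerator n (permSemigroup n s g) = expSemigroup (permOp n) s (permOp n g) :=
      (expSemigroup_apply_comm (permOp n) s g).symm
    rw [h2] at h1
    have h3 : ∀ e ∈ adjacentPairs n, (permSemigroup n s g (Equiv.swap e.1 e.2 * σ) -
        permSemigroup n s g σ) ^ 2 ≤ C ^ 2 := fun e he => by
      have hC' : 2 * (1 + 1 / ((n : ℝ) - 1) * 4 * s) ≤ C := by
        rw [hC]
        gcongr
        exact hst
      exact sq_le_sq.2 (((abs_permSemigroup_inversions_swap_sub_le hX (by omega) ⟨s, hs⟩ he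
        σ).trans hC').trans (le_abs_self C))
    -- There are n-1 edges, each with rate 1/(n-1), so the carré du champ is at most `C ^ 2`.
    have h4 := Finset.sum_le_card_nsmul _ _ _ h3
    rw [nsmul_eq_mul, card_adjacentPairs (by omega)] at h4
    have h5 := mul_le_mul_of_nonneg_left h4 (one_div_pos.2 hn').le
    rw [← h1, ← mul_assoc (1 / ((n : ℝ) - 1)), one_div_mul_cancel hn'.ne', one_mul] at h5
    refine le_trans (le_of_eq ?_) h5
    change -((expSemigroup (permOp n) s (permOp n g) * expSemigroup (permOp n) s g +
      expSemigroup (permOp n) s g * expSemigroup (permOp n) s (permOp n g)) σ -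
      adjacentGenerator n (permSemigroup n s g * permSemigroup n s g) σ) = _
    simp only [Pi.add_apply, Pi.mul_apply, permSemigroup]
    ring
  have h0 : -(expSemigroup (permOp n) (t - t) (expSemigroup (permOp n) t g *
        expSemigroup (permOp n) t g) 1) -
      -(expSemigroup (permOp n) (t - 0) (expSemigroup (permOp n) 0 g *
        expSemigroup (permOp n) 0 g) 1) ≤ C ^ 2 * t := h
  rw [sub_self, sub_zero, expSemigroup_zero] at h0
  have h1 : -(permSemigroup n t g 1 * permSemigroup n t g 1) -
    -(permSemigroup n t (g * g) 1) ≤ C ^ 2 * t := h0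
  calc _ = -(permSemigroup n t g 1 * permSemigroup n t g 1) - -(permSemigroup n t (g * g) 1) := by
        rw [sq]
        have : g * g = fun σ => (inversions σ : ℝ) * inversions σ := rfl
        rw [this]
        ring
    _ ≤ _ := h1

end Variance

end Stirring

namespace Stirring

/-! ### Convergence of the mean, coefficient by coefficient. -/

section MeanLimit

/-- The Taylor coefficients of the mean distance per particle. -/
noncomputable def meanCoeff (n k : ℕ) : ℝ :=
  (n : ℝ) ^ k * (1 / ((n : ℝ) - 1) *
    ∑ e ∈ adjacentPairs n, (adjacentGenerator n)^[k] (orderSign e.1 e.2) 1)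

lemma adjacentGenerator_iterate_succ_inversions (n k : ℕ) :
    (adjacentGenerator n)^[k + 1] (fun σ => (inversions σ : ℝ)) 1 =
      1 / ((n : ℝ) - 1) *
        ∑ e ∈ adjacentPairs n, (adjacentGenerator n)^[k] (orderSign e.1 e.2) 1 := by
  have hk := (isLocalBounded_adjacentGenerator n).iterate k
  rw [Function.iterate_succ_apply, adjacentGenerator_inversions, hk.smul, hk.sum, Pi.smul_apply,
    Finset.sum_apply, smul_eq_mul]

/-- The constant term is absent because the identity has no inversions. The time nt and the division
by n leave the factor n^k in `meanCoeff`. -/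
lemma hasSum_mean_inversions {n : ℕ} (hn : n ≠ 0) (t : ℝ) :
    HasSum (fun k : ℕ => t ^ (k + 1) / ((k + 1).factorial : ℝ) * meanCoeff n k)
      (permSemigroup n (n * t) (fun σ => (inversions σ : ℝ)) 1 / n) := by
  have h := (hasSum_nat_add_iff' 1).2
    (permSemigroup_apply (n * t) (fun σ : Equiv.Perm (Fin n) => (inversions σ : ℝ)) 1)
  simp only [Finset.sum_range_one, pow_zero, Function.iterate_zero, id, inversions_one,
    Nat.cast_zero, mul_zero, sub_zero] at h
  refine (h.div_const (n : ℝ)).congr_fun ?_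
  intro k
  rw [adjacentGenerator_iterate_succ_inversions, meanCoeff]
  have : (n : ℝ) ≠ 0 := Nat.cast_ne_zero.2 hn
  field_simp
  ring

variable {n : ℕ}

lemma pos_and_mul_one_div_pred_bounds (hn : 2 ≤ n) :
    0 < (n : ℝ) - 1 ∧ 0 ≤ (n : ℝ) * (1 / ((n : ℝ) - 1)) ∧ (n : ℝ) * (1 / ((n : ℝ) - 1)) ≤ 2 := by
  have h : (2 : ℝ) ≤ n := by exact_mod_cast hn
  have h1 : (0 : ℝ) < (n : ℝ) - 1 := by linarith
  refine ⟨h1, by positivity, ?_⟩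
  rw [mul_one_div, div_le_iff₀ h1]
  linarith

/-- The base is 8 n/(n-1), and n/(n-1) ≤ 2. The uniformity in `n` is what dominated convergence of
the series requires. -/
lemma abs_meanCoeff_le (hn : 2 ≤ n) (k : ℕ) : |meanCoeff n k| ≤ 16 ^ k := by
  obtain ⟨h1, h2, h3⟩ := pos_and_mul_one_div_pred_bounds hn
  have h4 : |∑ e ∈ adjacentPairs n, (adjacentGenerator n)^[k] (orderSign e.1 e.2) 1| ≤
      ((n : ℝ) - 1) * (8 * (1 / ((n : ℝ) - 1))) ^ k := by
    rw [← card_adjacentPairs (by omega), ← nsmul_eq_mul, card_adjacentPairs (by omega)]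
    refine (Finset.abs_sum_le_sum_abs _ _).trans (Finset.sum_le_card_nsmul _ _ _ fun e _ => ?_)
    have := abs_adjacentGenerator_iterate_orderSign_le k e.1 e.2 1
    rwa [abs_of_pos (one_div_pos.2 h1)] at this
  rw [meanCoeff, abs_mul, abs_mul, abs_of_pos (one_div_pos.2 h1),
    abs_of_nonneg (pow_nonneg n.cast_nonneg k)]
  calc _ ≤ (n : ℝ) ^ k * (1 / ((n : ℝ) - 1) *
        (((n : ℝ) - 1) * (8 * (1 / ((n : ℝ) - 1))) ^ k)) := by gcongr
    _ = (8 * ((n : ℝ) * (1 / ((n : ℝ) - 1)))) ^ k := by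
        rw [← mul_assoc (1 / ((n : ℝ) - 1)), one_div_mul_cancel h1.ne', one_mul, ← mul_pow]
        ring
    _ ≤ 16 ^ k := by
        gcongr
        linarith

/-- Edges farther than `k` from the ends agree exactly with the walk on the integers. At most 2k
edges remain, each with error at most 2 (8/(n-1))^k, and the prefactor 1/(n-1) makes their
contribution vanish. -/
lemma abs_meanCoeff_sub_le (hn : 2 ≤ n) (k : ℕ) :
    |meanCoeff n k - ((n : ℝ) * (1 / ((n : ℝ) - 1))) ^ k * (walkGenerator 4)^[k] signFn 1| ≤
      4 * k * 16 ^ k * (1 / ((n : ℝ) - 1)) := by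
  obtain ⟨h1, h2, h3⟩ := pos_and_mul_one_div_pred_bounds hn
  set l := 1 / ((n : ℝ) - 1) with hl
  have hlpos : 0 < l := one_div_pos.2 h1
  set c := (walkGenerator 4)^[k] signFn 1 with hc
  have hcb : |c| ≤ 8 ^ k := by
    simpa using (isLocalBounded_walkGenerator.iterate k).bound signFn 1 abs_signFn_le 1
  have h4 : |∑ e ∈ adjacentPairs n,
      ((adjacentGenerator n)^[k] (orderSign e.1 e.2) 1 - l ^ k * c)| ≤ 4 * k * (8 * l) ^ k := by
    rw [← Finset.sum_filter_add_sum_filter_not (adjacentPairs n)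
      (fun e => k ≤ (e.1 : ℕ) ∧ (e.2 : ℕ) + k < n), Finset.sum_eq_zero, zero_add]
    · refine (Finset.abs_sum_le_sum_abs _ _).trans
        ((Finset.sum_le_card_nsmul _ _ (2 * (8 * l) ^ k) fun e _ => ?_).trans ?_)
      · have h5 := abs_adjacentGenerator_iterate_orderSign_le k e.1 e.2 1
        rw [← hl, abs_of_pos hlpos] at h5
        have h6 : |l ^ k * c| ≤ (8 * l) ^ k := by
          rw [abs_mul, abs_of_pos (pow_pos hlpos k), mul_pow, mul_comm]
          gcongr
        exact (abs_sub _ _).trans (by linarith)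
      · rw [nsmul_eq_mul]
        have h5 : (((adjacentPairs n).filter
            fun e => ¬(k ≤ (e.1 : ℕ) ∧ (e.2 : ℕ) + k < n)).card : ℝ) ≤ 2 * k := by
          exact_mod_cast card_boundary_pairs_le n k
        calc _ ≤ 2 * (k : ℝ) * (2 * (8 * l) ^ k) := by gcongr
          _ = _ := by ring
    · intro e he
      obtain ⟨he, h5, h6⟩ := Finset.mem_filter.1 he
      have h7 := mem_adjacentPairs.1 he
      rw [adjacentGenerator_iterate_orderSign_one k e.1 e.2 h5 (by omega) (by omega) h6]
      have h8 : ((e.2 : ℕ) : ℤ) - (e.1 : ℕ) = 1 := by omega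
      rw [h8, sub_self]
  have h5 : meanCoeff n k - ((n : ℝ) * l) ^ k * c = (n : ℝ) ^ k * l *
      ∑ e ∈ adjacentPairs n, ((adjacentGenerator n)^[k] (orderSign e.1 e.2) 1 - l ^ k * c) := by
    rw [meanCoeff, ← hl, Finset.sum_sub_distrib, Finset.sum_const, nsmul_eq_mul,
      card_adjacentPairs (by omega), mul_pow]
    have h6 : l * ((n : ℝ) - 1) = 1 := one_div_mul_cancel h1.ne'
    linear_combination ((n : ℝ) ^ k * l ^ k * c) * h6
  rw [h5, abs_mul, abs_of_nonneg (by positivity)]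
  calc (n : ℝ) ^ k * l * _ ≤ (n : ℝ) ^ k * l * (4 * k * (8 * l) ^ k) := by gcongr
    _ = 4 * k * (8 * ((n : ℝ) * l)) ^ k * l := by
        rw [mul_pow, mul_pow, mul_pow]
        ring
    _ ≤ _ := by
        gcongr
        linarith

lemma tendsto_one_div_pred : Tendsto (fun n : ℕ => 1 / ((n : ℝ) - 1)) atTop (𝓝 0) := by
  simp only [one_div]
  exact tendsto_inv_atTop_zero.comp
    (tendsto_atTop_add_const_right _ (-1 : ℝ) tendsto_natCast_atTop_atTop)

lemma tendsto_mul_inv_pred :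
    Tendsto (fun n : ℕ => (n : ℝ) * (1 / ((n : ℝ) - 1))) atTop (𝓝 1) := by
  have h : Tendsto (fun n : ℕ => 1 + 1 / ((n : ℝ) - 1)) atTop (𝓝 (1 + 0)) :=
    tendsto_one_div_pred.const_add 1
  rw [add_zero] at h
  refine h.congr' ?_
  filter_upwards [eventually_ge_atTop 2] with n hn
  have := (pos_and_mul_one_div_pred_bounds hn).1
  field_simp
  ring

lemma tendsto_meanCoeff (k : ℕ) :
    Tendsto (fun n => meanCoeff n k) atTop (𝓝 ((walkGenerator 4)^[k] signFn 1)) := by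
  have h1 : Tendsto (fun n : ℕ => meanCoeff n k -
      ((n : ℝ) * (1 / ((n : ℝ) - 1))) ^ k * (walkGenerator 4)^[k] signFn 1) atTop (𝓝 0) := by
    refine squeeze_zero_norm' (a := fun n : ℕ => 4 * k * 16 ^ k * (1 / ((n : ℝ) - 1))) ?_ ?_
    · filter_upwards [eventually_ge_atTop 2] with n hn
      exact abs_meanCoeff_sub_le hn k
    · simpa using tendsto_one_div_pred.const_mul (4 * (k : ℝ) * 16 ^ k)
  have h2 := h1.add ((tendsto_mul_inv_pred.pow k).mul_const ((walkGenerator 4)^[k] signFn 1))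
  simpa using h2

/-- Convergence of the mean distance per particle. -/
theorem tendsto_mean_inversions (t : ℝ) :
    Tendsto (fun n : ℕ => permSemigroup n (n * t) (fun σ => (inversions σ : ℝ)) 1 / n) atTop
      (𝓝 (limitProfile t)) := by
  have hbound : Summable fun k : ℕ => |t| * ((|t| * 16) ^ k / (k.factorial : ℝ)) :=
    (Real.summable_pow_div_factorial (|t| * 16)).mul_left _
  have h := tendsto_tsum_of_dominated_convergence (𝓕 := atTop)
    (f := fun n k : ℕ => t ^ (k + 1) / ((k + 1).factorial : ℝ) * meanCoeff n k) hbound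
    (fun k => (tendsto_meanCoeff k).const_mul _) (by
      filter_upwards [eventually_ge_atTop 2] with n hn k
      rw [Real.norm_eq_abs, abs_mul, abs_div, abs_pow, Nat.abs_cast]
      calc |t| ^ (k + 1) / ((k + 1).factorial : ℝ) * |meanCoeff n k|
          ≤ |t| ^ (k + 1) / (k.factorial : ℝ) * 16 ^ k := by
            gcongr
            · exact k.le_succ
            · exact abs_meanCoeff_le hn k
        _ = |t| * ((|t| * 16) ^ k / (k.factorial : ℝ)) := by
            rw [pow_succ, mul_pow]
            ring)
  rw [(hasSum_limitProfile t).tsum_eq] at h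
  refine h.congr' ?_
  filter_upwards [eventually_ne_atTop 0] with n hn
  exact (hasSum_mean_inversions hn t).tsum_eq

end MeanLimit

end Stirring

namespace Stirring

/-! ### Chebyshev's inequality and convergence in probability. -/

section LawOfLargeNumbers

lemma measureReal_abs_sub_ge_le {n : ℕ} (hn : 2 ≤ n) {Ω : Type*} [MeasurableSpace Ω]
    {P : Measure Ω} {X : ℝ≥0 → Ω → Equiv.Perm (Fin n)}
    (hX : IsMarkovChain (adjacentGenerator n) 1 X P) (t : ℝ≥0) (c : ℝ) {ε : ℝ} (hε : 0 < ε) :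
    P.real {ω | ε ≤ |(inversions (X (n * t) ω) : ℝ) / n - c|} ≤
      ((2 * (1 + 8 * t)) ^ 2 * t * (1 / n) +
        (permSemigroup n (n * t) (fun σ => (inversions σ : ℝ)) 1 / n - c) ^ 2) / ε ^ 2 := by
  have hn0 : (0 : ℝ) < n := by exact_mod_cast (by omega : 0 < n)
  obtain ⟨h1, h2, h3⟩ := pos_and_mul_one_div_pred_bounds hn
  have hvar := variance_inversions_le hX hn (n * t)
  have hq := transition_perm_nonneg hX (n * t)
  have hsum := sum_transition_perm hX (n * t)
  have hP := hX.measureReal_mem_perm {σ | ε ≤ |(inversions σ : ℝ) / n - c|} (n * t)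
  rw [permSemigroup_one_eq_sum, permSemigroup_one_eq_sum] at hvar
  rw [permSemigroup_one_eq_sum]
  push_cast at hvar hq hsum hP ⊢
  set q := fun τ => transition (adjacentGenerator n) (n * t) 1 τ with hqdef
  set m := ∑ τ, transition (adjacentGenerator n) (n * t) 1 τ * (inversions τ : ℝ) with hm
  set v := ∑ τ, transition (adjacentGenerator n) (n * t) 1 τ *
    ((inversions τ : ℝ) * inversions τ) with hv
  have hvar' : v - m ^ 2 ≤ (2 * (1 + 8 * t)) ^ 2 * (n * t) := by
    refine hvar.trans ?_
    -- At time nt the Lipschitz constant stays bounded since n/(n-1) ≤ 2, so the variance is of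
    -- order n.
    have : 1 / ((n : ℝ) - 1) * 4 * (n * t) ≤ 8 * t := by
      calc _ = (n : ℝ) * (1 / ((n : ℝ) - 1)) * (4 * t) := by ring
        _ ≤ 2 * (4 * t) := by gcongr
        _ = _ := by ring
    gcongr
  -- The second moment about `c` is the variance plus the squared bias of the mean.
  have hmom : ∑ τ, transition (adjacentGenerator n) (n * t) 1 τ *
      ((inversions τ : ℝ) / n - c) ^ 2 = (v - m ^ 2) / (n : ℝ) ^ 2 + (m / n - c) ^ 2 := by
    have : ∀ τ : Equiv.Perm (Fin n), transition (adjacentGenerator n) (n * t) 1 τ *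
        ((inversions τ : ℝ) / n - c) ^ 2 =
        1 / (n : ℝ) ^ 2 * (transition (adjacentGenerator n) (n * t) 1 τ *
          ((inversions τ : ℝ) * inversions τ)) -
        2 * c / n * (transition (adjacentGenerator n) (n * t) 1 τ * (inversions τ : ℝ)) +
        c ^ 2 * transition (adjacentGenerator n) (n * t) 1 τ := fun τ => by ring
    simp only [this]
    rw [Finset.sum_add_distrib, Finset.sum_sub_distrib, ← Finset.mul_sum, ← Finset.mul_sum,
      ← Finset.mul_sum, hsum]
    ring
  rw [le_div_iff₀ (by positivity)]
  calc _ = ∑ τ, transition (adjacentGenerator n) (n * t) 1 τ *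
        ({σ : Equiv.Perm (Fin n) | ε ≤ |(inversions σ : ℝ) / n - c|}.indicator 1 τ * ε ^ 2) := by
        simp only [← mul_assoc]
        rw [← Finset.sum_mul, ← hP]
        rfl
    _ ≤ ∑ τ, transition (adjacentGenerator n) (n * t) 1 τ * ((inversions τ : ℝ) / n - c) ^ 2 := by
        refine Finset.sum_le_sum fun τ _ => mul_le_mul_of_nonneg_left ?_ (hq τ)
        by_cases h : τ ∈ ({σ | ε ≤ |(inversions σ : ℝ) / n - c|} : Set (Equiv.Perm (Fin n)))
        · rw [Set.indicator_of_mem h, Pi.one_apply, one_mul, ← sq_abs (_ - c)]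
          exact pow_le_pow_left₀ hε.le h 2
        · rw [Set.indicator_of_notMem h, zero_mul]
          positivity
    _ ≤ _ := by
        rw [hmom]
        gcongr
        calc (v - m ^ 2) / (n : ℝ) ^ 2 ≤ (2 * (1 + 8 * t)) ^ 2 * (n * t) / (n : ℝ) ^ 2 := by gcongr
          _ = _ := by field_simp

/-- The law of large numbers for the number of inversions. -/
theorem tendsto_measure_inversions {Ω : ℕ → Type*} [∀ n, MeasurableSpace (Ω n)]
    (P : ∀ n, Measure (Ω n)) (X : ∀ n, ℝ≥0 → Ω n → Equiv.Perm (Fin n))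
    (hX : ∀ n, IsMarkovChain (adjacentGenerator n) 1 (X n) (P n)) (t : ℝ≥0) {ε : ℝ}
    (hε : 0 < ε) :
    Tendsto (fun n : ℕ => P n {ω | ε ≤ |(inversions (X n (n * t) ω) : ℝ) / n - limitProfile t|})
      atTop (𝓝 0) := by
  have h1 : Tendsto (fun n : ℕ => ((2 * (1 + 8 * (t : ℝ))) ^ 2 * t * (1 / n) +
      (permSemigroup n (n * t) (fun σ => (inversions σ : ℝ)) 1 / n - limitProfile t) ^ 2) / ε ^ 2)
      atTop (𝓝 0) := by
    have := (((tendsto_one_div_atTop_nhds_zero_nat (𝕜 := ℝ)).const_mul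
      ((2 * (1 + 8 * (t : ℝ))) ^ 2 * t)).add
      (((tendsto_mean_inversions t).sub_const (limitProfile t)).pow 2)).div_const (ε ^ 2)
    simpa using this
  have h2 : Tendsto (fun n : ℕ =>
      (P n).real {ω | ε ≤ |(inversions (X n (n * t) ω) : ℝ) / n - limitProfile t|})
      atTop (𝓝 0) := by
    refine squeeze_zero' (Eventually.of_forall fun n => measureReal_nonneg) ?_ h1
    -- For n = 0 the rate 1/(n-1) is negative and for n = 1 it is the default value 0; both are
    -- discarded in the limit.
    filter_upwards [eventually_ge_atTop 2] with n hn
    exact measureReal_abs_sub_ge_le hn (hX n) t _ hε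
  have h3 := ENNReal.tendsto_ofReal h2
  rw [ENNReal.ofReal_zero] at h3
  refine h3.congr fun n => ?_
  have := (hX n).isProbabilityMeasure
  exact ENNReal.ofReal_toReal (measure_ne_top _ _)

end LawOfLargeNumbers

end Stirring

/-! ### Assembly of the main theorem. -/

theorem theorem2
    {Ω : ℕ → Type*} [∀ n, MeasurableSpace (Ω n)] (P : ∀ n, Measure (Ω n))
    (X : ∀ n, ℝ≥0 → Ω n → Equiv.Perm (Fin n))
    (hX : ∀ n, Stirring.IsMarkovChain (Stirring.adjacentGenerator n) 1 (X n) (P n))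
    {ΩW : Type*} [MeasurableSpace ΩW] (μ : Measure ΩW) (W : ℝ≥0 → ΩW → ℤ)
    (hW : Stirring.IsMarkovChain (Stirring.walkGenerator 4) 0 W μ)
    {ΩY : Type*} [MeasurableSpace ΩY] (ν : Measure ΩY) (Y Y' : ℝ≥0 → ΩY → ℤ)
    (hY : Stirring.IsMarkovChain Stirring.stirringGenerator (0, 1)
      (fun t ω => (Y t ω, Y' t ω)) ν)
    (p : ℝ≥0 → ℝ) (hp : p = Stirring.exchangeProb Y Y' ν)
    (f : ℝ → ℝ) (hf : f = Stirring.limitFn W μ p) :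
    -- the distance is the number of inversions
    (∀ (n : ℕ) (σ : Equiv.Perm (Fin n)), Stirring.adjacentDist σ = Stirring.inversions σ) ∧
    -- the integrals and the series that define `f` converge
    (∀ t : ℝ, 0 < t →
      (∀ x : ℕ, IntegrableOn (fun s : ℝ≥0∞ => p (t - s.toReal).toNNReal)
        (Set.Iic (ENNReal.ofReal t)) (Stirring.hittingLaw W μ x)) ∧
      Summable fun x : ℕ => ∫ s in Set.Iic (ENNReal.ofReal t),
        p (t - s.toReal).toNNReal ∂(Stirring.hittingLaw W μ x)) ∧
    -- convergence in probability of the distance at time `n t`, divided by `n`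
    (∀ t : ℝ≥0, 0 < t → ∀ ε : ℝ, 0 < ε →
      Tendsto (fun n : ℕ =>
        P n {ω | ε ≤ |(Stirring.adjacentDist (X n (n * t) ω) : ℝ) / n - f t|}) atTop (𝓝 0)) ∧
    -- smoothness
    ContDiffOn ℝ (⊤ : ℕ∞) f (Set.Ioi 0) ∧
    -- behaviour for large times
    Tendsto (fun t : ℝ => f t / √t) atTop (𝓝 √(2 / Real.pi)) ∧
    (∀ {ΩB : Type*} [MeasurableSpace ΩB] (Q : Measure ΩB) (B : ℝ≥0 → ΩB → ℝ),
      IsBrownianReal B Q →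
        Integrable (fun ω => ⨆ s : Set.Icc (0 : ℝ≥0) 1, B (4 * s) ω) Q ∧
        1 / 2 * ∫ ω, (⨆ s : Set.Icc (0 : ℝ≥0) 1, B (4 * s) ω) ∂Q = √(2 / Real.pi)) := by
  obtain rfl : p = fun u : ℝ≥0 => Stirring.exchangeFn u :=
    hp.trans (funext fun u => Stirring.exchangeProb_eq hY u)
  have hft : ∀ t : ℝ, 0 < t → f t = Stirring.limitProfile t := fun t ht => by
    rw [hf]
    exact Stirring.limitFn_eq hW (fun _ => rfl) ht
  refine ⟨fun n σ => Stirring.adjacentDist_eq_inversions σ, fun t ht => ⟨fun x => ?_, ?_⟩,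
    fun t ht ε hε => ?_, ?_, ?_, fun Q B hB => Stirring.brownian_maximum hB⟩
  · exact Stirring.integrableOn_exchangeFn hW x t
  · refine ((Stirring.hasSum_one_sub_meanSign hW ht).summable).congr fun x => ?_
    exact (Stirring.integral_hittingLaw hW x ht).symm
  · simp only [Stirring.adjacentDist_eq_inversions]
    rw [hft t ht]
    exact Stirring.tendsto_measure_inversions P X hX t hε
  · exact Stirring.contDiff_limitProfile.contDiffOn.congr fun t ht => hft t ht
  · refine Stirring.tendsto_limitProfile_div_sqrt.congr' ?_
    filter_upwards [eventually_gt_atTop 0] with t ht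
    rw [hft t ht]
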